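/- Let $d\ge 1$, $\alpha>1$, and let $Q\subset\mathbb R^d$ be a homogeneous Poisson point process of rate one. For $x\in\mathbb R^d$ let $q(x)$ be a point of $Q$ closest to $x$ in the Euclidean norm $\|\cdot\|$, ties being broken arbitrarily. For $x,y\in\mathbb R^d$ let $T(x,y)$ be the infimum of $\sum_{i=1}^{m-1}\|q_i-q_{i+1}\|^\alpha$ over all finite sequences $(q_1,\dots,q_m)$ of points of $Q$ with $q_1=q(x)$ and $q_m=q(y)$. Let $e_1$ be the first standard basis vector and, for real $n$, put $T_n=T(0,ne_1)$. Let $\psi:(0,\infty)\to(0,\infty)$ be a function that satisfies the following two conditions. (1) There are constants $C_0,C_1,\kappa_1,\kappa_2>0$ such that $\mathbb P(|T_n-\mathbb E T_n|>\lambda\psi(n))\le C_1\exp(-C_0\lambda^{\kappa_1})$ for all real $n\ge 1$ and $0\le\lambda\le C_0n^{\kappa_2}$. (2) There are constants $n_0>0$, $D_0>1$ and $\kappa_3\in(0,1/2)$ such that $\psi$ is nondecreasing on $[n_0,\infty)$ and $c^{-(1-\kappa_3)}\psi(n)\le\psi(n/c)\le D_0c^{-\kappa_3}\psi(n)$ for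 all real $n\ge n_0$ and $1\le c\le n^{1/2}$. Put $\eta=\frac1{2\kappa_1}+\frac1{\kappa_1\kappa_3}$, let $\log^{(0)}n=n$ and $\log^{(k)}n=\log(\log^{(k-1)}n)$, and for $k\ge 0$ write $$\mathcal B^{(k)}(n)=\Big\{(x_1,x_2)\in\mathbb R\times\mathbb R^{d-1}:\ |x_1|\le\psi(n),\ \|x_2\|\le\frac{n^{1/2}\psi(n)^{1/2}}{(\log^{(k)}n)^{\eta}}\Big\}.$$ Then $T(x,y)$ is integrable for all $x,y\in\mathbb R^d$, and for every integer $k\ge1$ and every real $r>0$ there is a constant $D>0$, not depending on $n$, such that for all sufficiently large real $n$, with $B_1=\mathcal B^{(k-1)}(n)$ and $B_2=ne_1+\mathcal B^{(k-1)}(n)$, $$\mathbb P\Big(\sup_{x\in B_1,\,y\in B_2}|T(x,y)-\mathbb E T(x,y)|>D\,\psi(n)\,(\log^{(k)}n)^{1/\kappa_1}\Big)\le\frac1{(\log^{(k-1)}n)^r}.$$ (If the event is not measurable, because of the tie-breaking, the bound is for its outer probability.) -/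

import Mathlib

open MeasureTheory ProbabilityTheory Filter

noncomputable section

namespace EuclideanFPP

/-- `Q` is a homogeneous Poisson point process of rate one on `ℝ^d`: a random locally finite set
such that the number of points in a bounded Borel set is Poisson distributed with mean the
Lebesgue measure of the set, and the numbers of points in finitely many pairwise disjoint bounded
Borel sets are independent. -/
structure IsRateOnePoisson {d : ℕ} {Ω : Type*} [MeasurableSpace Ω]
    (Q : Ω → Set (EuclideanSpace ℝ (Fin d))) (P : Measure Ω) : Prop where
  locallyFinite : ∀ᵐ ω ∂P, ∀ A : Set (EuclideanSpace ℝ (Fin d)),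
    Bornology.IsBounded A → (Q ω ∩ A).Finite
  hasLaw_count : ∀ A : Set (EuclideanSpace ℝ (Fin d)), MeasurableSet A → Bornology.IsBounded A →
    HasLaw (fun ω => (Q ω ∩ A).ncard) (poissonMeasure (volume A).toNNReal) P
  indep_count : ∀ (m : ℕ) (A : Fin m → Set (EuclideanSpace ℝ (Fin d))),
    (∀ i, MeasurableSet (A i)) → (∀ i, Bornology.IsBounded (A i)) →
    Pairwise (fun i j => Disjoint (A i) (A j)) →
    iIndepFun (fun i ω => (Q ω ∩ A i).ncard) P

/-- `q` sends every point of space to a closest point of the configuration `S`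
(ties are broken in an arbitrary way). -/
def IsNearestPointMap {d : ℕ} (S : Set (EuclideanSpace ℝ (Fin d)))
    (q : EuclideanSpace ℝ (Fin d) → EuclideanSpace ℝ (Fin d)) : Prop :=
  ∀ x, q x ∈ S ∧ ∀ p ∈ S, ‖x - q x‖ ≤ ‖x - p‖

/-- The passage times of the finite paths `p 0, …, p m` of points of `S` from `a` to `b`. The
path time is the sum of the `α`-th powers of the lengths of its steps. -/
def pathTimes {d : ℕ} (α : ℝ) (S : Set (EuclideanSpace ℝ (Fin d)))
    (a b : EuclideanSpace ℝ (Fin d)) : Set ℝ :=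
  {t | ∃ (m : ℕ) (p : ℕ → EuclideanSpace ℝ (Fin d)),
    (∀ i ≤ m, p i ∈ S) ∧ p 0 = a ∧ p m = b ∧ t = ∑ i ∈ Finset.range m, ‖p i - p (i + 1)‖ ^ α}

/-- The passage time `T(x, y) = T(q(x), q(y))` in the configuration `S` with nearest-point
map `q`: the infimum of the passage times of the paths in `S` from `q x` to `q y`. -/
def passageTime {d : ℕ} (α : ℝ) (S : Set (EuclideanSpace ℝ (Fin d)))
    (q : EuclideanSpace ℝ (Fin d) → EuclideanSpace ℝ (Fin d))
    (x y : EuclideanSpace ℝ (Fin d)) : ℝ :=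
  sInf (pathTimes α S (q x) (q y))

/-- The point `n e₁`, for a real number `n`. -/
def axisPoint (d : ℕ) [NeZero d] (n : ℝ) : EuclideanSpace ℝ (Fin d) :=
  EuclideanSpace.single 0 n

/-- The fluctuations of `T_n = T(0, n e₁)` are on the scale `ψ n`, with (stretched) exponential
tails in the stated range. -/
def ConcentratesOnScale {d : ℕ} [NeZero d] {Ω : Type*} [MeasurableSpace Ω] (P : Measure Ω)
    (T : Ω → EuclideanSpace ℝ (Fin d) → EuclideanSpace ℝ (Fin d) → ℝ) (ψ : ℝ → ℝ)
    (C₀ C₁ κ₁ κ₂ : ℝ) : Prop :=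
  ∀ n : ℝ, 1 ≤ n → ∀ l : ℝ, 0 ≤ l → l ≤ C₀ * n ^ κ₂ →
    P.real {ω | l * ψ n < |T ω 0 (axisPoint d n) - ∫ ω', T ω' 0 (axisPoint d n) ∂P|}
      ≤ C₁ * Real.exp (-C₀ * l ^ κ₁)

/-- The growth conditions on the scale function `ψ : (0, ∞) → (0, ∞)`. -/
structure IsRegularScale (ψ : ℝ → ℝ) (n₀ D₀ κ₃ : ℝ) : Prop where
  pos : ∀ s, 0 < s → 0 < ψ s
  mono : MonotoneOn ψ (Set.Ici n₀)
  scaling : ∀ n, n₀ ≤ n → ∀ c, 1 ≤ c → c ≤ n ^ (1 / 2 : ℝ) →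
    1 / c ^ (1 - κ₃) * ψ n ≤ ψ (n / c) ∧ ψ (n / c) ≤ D₀ / c ^ κ₃ * ψ n

/-- The exponent `η = β + γ`, where `β = 1 / (2 κ₁)` and `γ = 1 / (κ₁ κ₃)`. -/
def etaExponent (κ₁ κ₃ : ℝ) : ℝ := 1 / (2 * κ₁) + 1 / (κ₁ * κ₃)

/-- The `k`-th iterate of the logarithm, `log^(0) n = n`. -/
def iterLog (k : ℕ) (n : ℝ) : ℝ := Real.log^[k] n

/-- The flat box of the points `(x₁, x₂) ∈ ℝ × ℝ^(d-1)` such that `|x₁| ≤ ψ n` and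
`‖x₂‖ ≤ n^(1/2) ψ(n)^(1/2) / (log^(k) n)^η`; `x - x₁ e₁` is `x₂`, seen in `ℝ^d`. -/
def flatBox (d : ℕ) [NeZero d] (ψ : ℝ → ℝ) (η : ℝ) (k : ℕ) (n : ℝ) :
    Set (EuclideanSpace ℝ (Fin d)) :=
  {x | |x 0| ≤ ψ n ∧
    ‖x - axisPoint d (x 0)‖ ≤ n ^ (1 / 2 : ℝ) * ψ n ^ (1 / 2 : ℝ) / iterLog k n ^ η}

end EuclideanFPP

end

set_option linter.unusedSectionVars false

/-! By isotropy the law of `T x y` depends only on `‖x - y‖` (`identDistrib_passageTime`), so `E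
T(x, y) = h ‖x - y‖` with `h s = E T(0, s e₁)`. The function `h` is subadditive. Hence `h s / s`
decreases to its infimum `μ` in the sense of Fekete, `μ s ≤ h s`, and `μ > 0` by a first moment
bound over chains of occupied cubes. The scale `ψ` is replaced by a comparable function `Φ` that
satisfies power bounds between any two scales with constant one (`IsPowerScale`).

Chaining (`exists_upperChain`). Let `x` range over a parabolic region at distance about `n` before
`u`, of width `√(n Φ n)`. A transverse displacement of that size changes the distance by only `O(Φ
n)`. Joining `x` to `u` through grid points on the scales `n`, `n/c`, `n/c²`, ... costs on each
scale a bounded number of grid points, while the error decreases geometrically because `Φ` does. So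
all these `x` satisfy `T x u ≤ μ (u - x)₀ + O((t + M) Φ n)` at once, outside an event of probability
`exp(-(C₀/2) t^κ₁)`, provided that `h s ≤ μ s + M Φ s`.

Mean (`exists_mean_le`). That proviso is proved by halving. A nearly optimal path from `0` to `L e₁`
passes close to the plane halfway. If both halves are typically longer than half of the mean, a
contradiction arises; so `h s - μ s ≤ (h L - μ L)/2 + error` for some `s` in `[L/2, 5L/8]`
(`exists_midpoint`, `exists_halving`). Starting at enormous `L`, where `h L - μ L` is a small
multiple of `L`, and descending, one finds that `h s - μ s` is of the order of the error
(`IsMeanTime.descent`). A crude union bound over the plane gives an error with an extra power of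
`L`. Chaining on a scale `L/(2c)` then gives an error that contains the unknown constant `M` with a
small factor, so that `M` can be bootstrapped to a finite value.

Boxes (`exists_prob_box_le`). For `x` near `0` and `y` near `n e₁`, an upper bound for `T x y` goes
through two fixed points of the axis between them. For a lower bound, `x` and `y` are inserted
between two fixed points of the axis outside: the passage time of the outer pair is bounded from
below by concentration at a single pair, and the pieces to `x` and from `y` are bounded from above
by chaining. Thus only upper bounds have to be uniform. With `t` a multiple of `(log^(k) n)^(1/κ₁)`
the exceptional probability is a negative power of `log^(k-1) n`. -/

namespace EuclideanFPP

/-! ### Passage times in a fixed configuration -/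

section Deterministic

variable {d : ℕ} {α : ℝ} {S : Set (EuclideanSpace ℝ (Fin d))}
  {q : EuclideanSpace ℝ (Fin d) → EuclideanSpace ℝ (Fin d)}

lemma IsNearestPointMap.eq_self (hq : IsNearestPointMap S q) {p : EuclideanSpace ℝ (Fin d)}
    (hp : p ∈ S) : q p = p := by
  have h := (hq p).2 p hp
  simp only [sub_self, norm_zero] at h
  exact (sub_eq_zero.1 (norm_le_zero_iff.1 h)).symm

lemma pathTimes_nonneg {a b : EuclideanSpace ℝ (Fin d)} {t : ℝ} (ht : t ∈ pathTimes α S a b) :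
    0 ≤ t := by
  obtain ⟨m, p, -, -, -, rfl⟩ := ht
  exact Finset.sum_nonneg fun i _ => Real.rpow_nonneg (norm_nonneg _) _

lemma bddBelow_pathTimes (a b : EuclideanSpace ℝ (Fin d)) : BddBelow (pathTimes α S a b) :=
  ⟨0, fun _ ht => pathTimes_nonneg ht⟩

lemma step_mem_pathTimes {a b : EuclideanSpace ℝ (Fin d)} (ha : a ∈ S) (hb : b ∈ S) :
    ‖a - b‖ ^ α ∈ pathTimes α S a b := by
  refine ⟨1, fun i => if i = 0 then a else b, ?_, by simp, by simp, by simp⟩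
  intro i _
  dsimp only
  split_ifs <;> assumption

lemma passageTime_nonneg (x y : EuclideanSpace ℝ (Fin d)) : 0 ≤ passageTime α S q x y :=
  Real.sInf_nonneg fun _ ht => pathTimes_nonneg ht

lemma passageTime_le_step (hq : IsNearestPointMap S q) (x y : EuclideanSpace ℝ (Fin d)) :
    passageTime α S q x y ≤ ‖q x - q y‖ ^ α :=
  csInf_le (bddBelow_pathTimes _ _) (step_mem_pathTimes (hq x).1 (hq y).1)

lemma passageTime_self (hq : IsNearestPointMap S q) (x : EuclideanSpace ℝ (Fin d)) :
    passageTime α S q x x = 0 := by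
  refine le_antisymm ?_ (passageTime_nonneg x x)
  refine csInf_le (bddBelow_pathTimes _ _) ⟨0, fun _ => q x, fun _ _ => (hq x).1, rfl, rfl, ?_⟩
  simp

lemma pathTimes_symm_subset (a b : EuclideanSpace ℝ (Fin d)) :
    pathTimes α S a b ⊆ pathTimes α S b a := by
  rintro t ⟨m, p, hp, h0, hm, rfl⟩
  refine ⟨m, fun i => p (m - i), fun i _ => hp _ (Nat.sub_le _ _), by simpa using hm,
    by simpa using h0, ?_⟩
  rw [← Finset.sum_range_reflect]
  refine Finset.sum_congr rfl fun i hi => ?_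
  have hi' := Finset.mem_range.1 hi
  rw [norm_sub_rev]
  congr 4 <;> omega

lemma passageTime_symm (x y : EuclideanSpace ℝ (Fin d)) :
    passageTime α S q x y = passageTime α S q y x := by
  unfold passageTime
  rw [Set.Subset.antisymm (pathTimes_symm_subset (α := α) (S := S) (q x) (q y))
    (pathTimes_symm_subset _ _)]

lemma add_mem_pathTimes {a b c : EuclideanSpace ℝ (Fin d)} {s t : ℝ}
    (hs : s ∈ pathTimes α S a b) (ht : t ∈ pathTimes α S b c) : s + t ∈ pathTimes α S a c := by
  obtain ⟨m, p, hp, h0, hm, rfl⟩ := hs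
  obtain ⟨m', p', hp', h0', hm', rfl⟩ := ht
  refine ⟨m + m', fun i => if i < m then p i else p' (i - m), ?_, ?_, ?_, ?_⟩
  · intro i hi
    dsimp only
    split_ifs with h
    · exact hp _ h.le
    · exact hp' _ (by omega)
  · dsimp only
    split_ifs with h
    · exact h0
    · have : m = 0 := by omega
      subst this
      rw [Nat.sub_zero, h0', ← hm, h0]
  · simp [hm']
  · rw [Finset.sum_range_add]
    congr 1
    · refine Finset.sum_congr rfl fun i hi => ?_
      have hi' := Finset.mem_range.1 hi
      dsimp only
      rw [if_pos hi']
      split_ifs with h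
      · rfl
      · have : i + 1 = m := by omega
        rw [this, hm, Nat.sub_self, h0']
    · refine Finset.sum_congr rfl fun i hi => ?_
      dsimp only
      rw [if_neg (by omega), if_neg (by omega)]
      congr 4 <;> omega

lemma passageTime_triangle (hq : IsNearestPointMap S q) (x y z : EuclideanSpace ℝ (Fin d)) :
    passageTime α S q x z ≤ passageTime α S q x y + passageTime α S q y z := by
  refine le_of_forall_pos_le_add fun ε hε => ?_
  obtain ⟨s, hs, hs'⟩ := exists_lt_of_csInf_lt ⟨_, step_mem_pathTimes (α := α) (hq x).1 (hq y).1⟩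
    (lt_add_of_pos_right (passageTime α S q x y) (half_pos hε))
  obtain ⟨t, ht, ht'⟩ := exists_lt_of_csInf_lt ⟨_, step_mem_pathTimes (α := α) (hq y).1 (hq z).1⟩
    (lt_add_of_pos_right (passageTime α S q y z) (half_pos hε))
  have := csInf_le (bddBelow_pathTimes _ _) (add_mem_pathTimes hs ht)
  unfold passageTime at *
  linarith

lemma passageTime_le_sum (hq : IsNearestPointMap S q) (z : ℕ → EuclideanSpace ℝ (Fin d)) (N : ℕ) :
    passageTime α S q (z 0) (z N) ≤ ∑ i ∈ Finset.range N, passageTime α S q (z i) (z (i + 1)) := by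
  induction N with
  | zero => simp [passageTime_self hq]
  | succ N ih =>
    rw [Finset.sum_range_succ]
    exact (passageTime_triangle hq _ (z N) _).trans (by linarith)

/-- If there is a point of the configuration within distance `ε` of every point of a segment, then
the passage time along the segment is at most linear. -/
lemma passageTime_le_of_dense (hα : 0 ≤ α) (hq : IsNearestPointMap S q) {ε : ℝ} (hε : 0 < ε)
    {x y : EuclideanSpace ℝ (Fin d)} (h : ∀ z ∈ segment ℝ x y, ‖z - q z‖ ≤ ε) :
    passageTime α S q x y ≤ (‖x - y‖ / ε + 1) * (3 * ε) ^ α := by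
  rcases eq_or_ne x y with rfl | hxy
  · rw [passageTime_self hq]; positivity
  have hpos : 0 < ‖x - y‖ := norm_pos_iff.2 (sub_ne_zero.2 hxy)
  set N := ⌈‖x - y‖ / ε⌉₊ with hN
  have hN0 : 0 < N := Nat.ceil_pos.2 (by positivity)
  have hN0' : (0 : ℝ) < N := by exact_mod_cast hN0
  have hNle : ‖x - y‖ / ε ≤ N := Nat.le_ceil _
  have hNlt : (N : ℝ) < ‖x - y‖ / ε + 1 := Nat.ceil_lt_add_one (by positivity)
  let z : ℕ → EuclideanSpace ℝ (Fin d) := fun i => AffineMap.lineMap x y ((i : ℝ) / N)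
  have hz0 : z 0 = x := by simp [z]
  have hzN : z N = y := by simp [z, div_self hN0'.ne']
  have hzs : ∀ i ≤ N, z i ∈ segment ℝ x y := by
    intro i hi
    rw [segment_eq_image_lineMap]
    refine ⟨(i : ℝ) / N, ⟨by positivity, ?_⟩, rfl⟩
    rw [div_le_one hN0']
    exact_mod_cast hi
  have hstep : ∀ i ∈ Finset.range N, passageTime α S q (z i) (z (i + 1)) ≤ (3 * ε) ^ α := by
    intro i hi
    have hi' := Finset.mem_range.1 hi
    refine (passageTime_le_step hq _ _).trans (Real.rpow_le_rpow (norm_nonneg _) ?_ hα)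
    have h1 := h _ (hzs i hi'.le)
    have h2 := h _ (hzs (i + 1) hi')
    have h3 : ‖z i - z (i + 1)‖ ≤ ε := by
      have : dist (z i) (z (i + 1)) = ‖x - y‖ / N := by
        simp only [z]
        rw [dist_lineMap_lineMap, Real.dist_eq, dist_eq_norm]
        have : ((i : ℝ) / N - ((i + 1 : ℕ) : ℝ) / N) = -(1 / N) := by push_cast; field_simp; ring
        rw [this, abs_neg, abs_of_pos (by positivity)]
        ring
      rw [← dist_eq_norm, this, div_le_iff₀ hN0']
      rwa [div_le_iff₀ hε, mul_comm] at hNle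
    calc ‖q (z i) - q (z (i + 1))‖
        = ‖(z i - z (i + 1)) - (z i - q (z i)) + (z (i + 1) - q (z (i + 1)))‖ := by congr 1; abel
      _ ≤ ‖(z i - z (i + 1)) - (z i - q (z i))‖ + ‖z (i + 1) - q (z (i + 1))‖ := norm_add_le _ _
      _ ≤ ‖z i - z (i + 1)‖ + ‖z i - q (z i)‖ + ‖z (i + 1) - q (z (i + 1))‖ := by
          gcongr; exact norm_sub_le _ _
      _ ≤ 3 * ε := by linarith
  calc passageTime α S q x y = passageTime α S q (z 0) (z N) := by rw [hz0, hzN]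
    _ ≤ ∑ i ∈ Finset.range N, passageTime α S q (z i) (z (i + 1)) := passageTime_le_sum hq z N
    _ ≤ ∑ i ∈ Finset.range N, (3 * ε) ^ α := Finset.sum_le_sum hstep
    _ = N * (3 * ε) ^ α := by simp
    _ ≤ _ := by gcongr

/-- The point `q y` is at least as close to `y` as `q x` is, so nothing has to be known about the
configuration near `y`. Integrability thereby reduces to the holes around one endpoint. -/
lemma norm_nearest_sub_le (hq : IsNearestPointMap S q) (x y : EuclideanSpace ℝ (Fin d)) :
    ‖q x - q y‖ ≤ 2 * ‖x - y‖ + 2 * ‖x - q x‖ := by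
  have h := (hq y).2 _ (hq x).1
  have h2 : ‖y - q x‖ ≤ ‖x - y‖ + ‖x - q x‖ := by
    rw [norm_sub_rev x y]
    calc ‖y - q x‖ = ‖(y - x) + (x - q x)‖ := by congr 1; abel
      _ ≤ _ := norm_add_le _ _
  have h3 : ‖q x - q y‖ ≤ ‖y - q x‖ + ‖y - q y‖ := by
    calc ‖q x - q y‖ = ‖(y - q y) - (y - q x)‖ := by congr 1; abel
      _ ≤ _ := norm_sub_le _ _
      _ = _ := add_comm _ _
  linarith

lemma passageTime_le_rpow (hα : 0 ≤ α) (hq : IsNearestPointMap S q)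
    (x y : EuclideanSpace ℝ (Fin d)) :
    passageTime α S q x y ≤ (2 * ‖x - y‖ + 2 * ‖x - q x‖) ^ α :=
  (passageTime_le_step hq x y).trans
    (Real.rpow_le_rpow (norm_nonneg _) (norm_nearest_sub_le hq x y) hα)

/-- A nearly optimal path makes a step across the zero set of a continuous function that changes
sign between the two ends. -/
lemma exists_crossing (hq : IsNearestPointMap S q) {f : EuclideanSpace ℝ (Fin d) → ℝ}
    (hf : Continuous f) {x y : EuclideanSpace ℝ (Fin d)} (hx : f (q x) ≤ 0) (hy : 0 < f (q y))
    {ε : ℝ} (hε : 0 < ε) :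
    ∃ p p' z : EuclideanSpace ℝ (Fin d), f p ≤ 0 ∧ z ∈ segment ℝ p p' ∧ f z = 0 ∧
      passageTime α S q x p + ‖p - p'‖ ^ α + passageTime α S q p' y
        ≤ passageTime α S q x y + ε := by
  obtain ⟨s, ⟨m, p, hp, h0, hm, rfl⟩, hs'⟩ :=
    exists_lt_of_csInf_lt ⟨_, step_mem_pathTimes (α := α) (hq x).1 (hq y).1⟩
      (lt_add_of_pos_right (passageTime α S q x y) hε)
  have hex : ∃ i, 0 < f (p i) := ⟨m, by rwa [hm]⟩
  classical
  have hfind := Nat.find_spec hex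
  have hmin := fun j (hj : j < Nat.find hex) => Nat.find_min hex hj
  have hle : Nat.find hex ≤ m := Nat.find_min' hex (by rwa [hm])
  obtain ⟨i, hi⟩ : ∃ i, Nat.find hex = i + 1 := by
    refine Nat.exists_eq_succ_of_ne_zero fun h => ?_
    rw [h, h0] at hfind
    linarith
  rw [hi] at hfind hle
  have hfi : f (p i) ≤ 0 := not_lt.1 (hmin i (by omega))
  obtain ⟨k, rfl⟩ := Nat.exists_eq_add_of_le hle
  obtain ⟨z, hz, hz0⟩ : ∃ z ∈ segment ℝ (p i) (p (i + 1)), f z = 0 := by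
    have hpre : IsPreconnected (segment ℝ (p i) (p (i + 1))) :=
      (convex_segment _ _).isPreconnected
    have := hpre.intermediate_value (left_mem_segment ℝ _ _) (right_mem_segment ℝ _ _)
      hf.continuousOn
    exact this ⟨hfi, hfind.le⟩
  refine ⟨p i, p (i + 1), z, hfi, hz, hz0, ?_⟩
  rw [Finset.sum_range_add, Finset.sum_range_succ] at hs'
  have h1 : passageTime α S q x (p i) ≤ ∑ j ∈ Finset.range i, ‖p j - p (j + 1)‖ ^ α := by
    refine csInf_le (bddBelow_pathTimes _ _) ⟨i, p, fun j hj => hp _ (by omega), h0, ?_, rfl⟩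
    exact (hq.eq_self (hp _ (by omega))).symm
  have h2 : passageTime α S q (p (i + 1)) y
      ≤ ∑ j ∈ Finset.range k, ‖p (i + 1 + j) - p (i + 1 + j + 1)‖ ^ α := by
    refine csInf_le (bddBelow_pathTimes _ _) ⟨k, fun j => p (i + 1 + j),
      fun j hj => hp _ (by omega), ?_, hm, rfl⟩
    exact (hq.eq_self (hp _ (by omega))).symm
  linarith

end Deterministic

/-! ### Events in terms of numbers of points, and uniqueness of their law -/

section Poisson

variable {d : ℕ} {Ω : Type*} [MeasurableSpace Ω] {P : Measure Ω}
  {Q Q' : Ω → Set (EuclideanSpace ℝ (Fin d))}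

/-- The configurations with prescribed numbers of points in finitely many bounded Borel sets. -/
def countCylinders (d : ℕ) : Set (Set (Set (EuclideanSpace ℝ (Fin d)))) :=
  {V | ∃ (m : ℕ) (A : Fin m → Set (EuclideanSpace ℝ (Fin d))) (W : Set (Fin m → ℕ)),
    (∀ i, MeasurableSet (A i) ∧ Bornology.IsBounded (A i)) ∧
      V = {S | (fun i => (S ∩ A i).ncard) ∈ W}}

/-- The `σ`-algebra on configurations that is generated by the numbers of points in bounded Borel
sets. -/
abbrev countSpace (d : ℕ) : MeasurableSpace (Set (EuclideanSpace ℝ (Fin d))) :=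
  MeasurableSpace.generateFrom (countCylinders d)

lemma isPiSystem_countCylinders (d : ℕ) : IsPiSystem (countCylinders d) := by
  rintro _ ⟨m, A, W, hA, rfl⟩ _ ⟨m', A', W', hA', rfl⟩ -
  refine ⟨m + m', Fin.append A A',
    {f | (fun i => f (Fin.castAdd m' i)) ∈ W ∧ (fun i => f (Fin.natAdd m i)) ∈ W'}, ?_, ?_⟩
  · intro i
    refine Fin.addCases (fun i => ?_) (fun i => ?_) i
    · simpa using hA i
    · simpa using hA' i
  · ext S
    simp

lemma measurableSet_count {A : Set (EuclideanSpace ℝ (Fin d))} (hA : MeasurableSet A)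
    (hb : Bornology.IsBounded A) (W : Set ℕ) :
    MeasurableSet[countSpace d] {S | (S ∩ A).ncard ∈ W} :=
  MeasurableSpace.measurableSet_generateFrom
    ⟨1, fun _ => A, {f | f 0 ∈ W}, fun _ => ⟨hA, hb⟩, rfl⟩

lemma IsRateOnePoisson.aemeasurable_count (hQ : IsRateOnePoisson Q P)
    {A : Set (EuclideanSpace ℝ (Fin d))} (hA : MeasurableSet A) (hb : Bornology.IsBounded A) :
    AEMeasurable (fun ω => (Q ω ∩ A).ncard) P :=
  (hQ.hasLaw_count A hA hb).aemeasurable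

lemma ncard_eq_sum_fibers {E κ : Type*} [Fintype κ] {s : Set E} (hs : s.Finite) (f : E → κ) :
    s.ncard = ∑ b, (s ∩ f ⁻¹' {b}).ncard := by
  classical
  lift s to Finset E using hs
  rw [Set.ncard_coe_finset, Finset.card_eq_sum_card_fiberwise (f := f) (t := Finset.univ)
    (fun _ _ => Finset.mem_coe.2 (Finset.mem_univ _))]
  refine Finset.sum_congr rfl fun b _ => ?_
  rw [← Set.ncard_coe_finset]
  congr 1
  ext x
  simp

/-- The numbers of points in finitely many bounded Borel sets are a function of independent Poisson
variables, which does not depend on the process. -/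
lemma exists_counts_eq_of_indep {m : ℕ} (A : Fin m → Set (EuclideanSpace ℝ (Fin d)))
    (hA : ∀ i, MeasurableSet (A i) ∧ Bornology.IsBounded (A i)) :
    ∃ (k : ℕ) (D : Fin k → Set (EuclideanSpace ℝ (Fin d))) (G : (Fin k → ℕ) → Fin m → ℕ),
      (∀ i, MeasurableSet (D i)) ∧ (∀ i, Bornology.IsBounded (D i)) ∧
      Pairwise (fun i j => Disjoint (D i) (D j)) ∧
      ∀ S : Set (EuclideanSpace ℝ (Fin d)), (∀ i, (S ∩ A i).Finite) →
        (fun i => (S ∩ A i).ncard) = G fun j => (S ∩ D j).ncard := by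
  classical
  let f : EuclideanSpace ℝ (Fin d) → Finset (Fin m) := fun x => Finset.univ.filter (x ∈ A ·)
  let e := (Fintype.equivFin (Finset (Fin m))).symm
  -- The atoms of the partition generated by the sets `A i` are indexed by the subsets of `Fin m`.
  -- The atom of the empty subset is unbounded and contributes to no count, so it is replaced by the
  -- empty set.
  let D' : Finset (Fin m) → Set (EuclideanSpace ℝ (Fin d)) :=
    fun B => if B.Nonempty then f ⁻¹' {B} else ∅
  have hDA : ∀ B, ∀ j ∈ B, D' B ⊆ A j := by
    intro B j hj x hx
    have hB : B.Nonempty := ⟨j, hj⟩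
    simp only [D', if_pos hB, Set.mem_preimage, Set.mem_singleton_iff] at hx
    rw [← hx] at hj
    exact (Finset.mem_filter.1 hj).2
  have hfB : ∀ B, f ⁻¹' {B} = (⋂ j ∈ B, A j) ∩ ⋂ j ∈ Bᶜ, (A j)ᶜ := by
    intro B
    ext x
    simp only [f, Set.mem_preimage, Set.mem_singleton_iff, Set.mem_inter_iff, Set.mem_iInter,
      Set.mem_compl_iff, Finset.mem_compl, Finset.ext_iff, Finset.mem_filter, Finset.mem_univ,
      true_and]
    exact ⟨fun h => ⟨fun j hj => (h j).2 hj, fun j hj hx => hj ((h j).1 hx)⟩,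
      fun h j => ⟨fun hx => by by_contra hj; exact h.2 j hj hx, fun hj => h.1 j hj⟩⟩
  refine ⟨_, fun i => D' (e i), fun n j => ∑ i, if j ∈ e i then n i else 0, ?_, ?_, ?_, ?_⟩
  · intro i
    dsimp only [D']
    split_ifs
    · rw [hfB]
      exact (Finset.measurableSet_biInter _ fun j _ => (hA j).1).inter
        (Finset.measurableSet_biInter _ fun j _ => (hA j).1.compl)
    · exact MeasurableSet.empty
  · intro i
    by_cases h : (e i).Nonempty
    · obtain ⟨j, hj⟩ := h
      exact (hA j).2.subset (hDA _ j hj)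
    · simp [D', if_neg h]
  · intro i j hij
    rw [Set.disjoint_left]
    intro x hx hx'
    have h1 : (e i).Nonempty := by
      by_contra h
      simp [D', if_neg h] at hx
    have h2 : (e j).Nonempty := by
      by_contra h
      simp [D', if_neg h] at hx'
    simp only [D', if_pos h1, if_pos h2, Set.mem_preimage, Set.mem_singleton_iff] at hx hx'
    exact hij (e.injective (hx.symm.trans hx'))
  · intro S hS
    ext j
    rw [ncard_eq_sum_fibers (hS j) f, ← e.sum_comp]
    refine Finset.sum_congr rfl fun i _ => ?_
    split_ifs with h
    · congr 1
      have hne : (e i).Nonempty := ⟨j, h⟩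
      ext x
      have := hDA (e i) j h
      simp only [D', if_pos hne, Set.subset_def] at this ⊢
      constructor
      · rintro ⟨⟨h1, h2⟩, h3⟩; exact ⟨h1, h3⟩
      · rintro ⟨h1, h3⟩; exact ⟨⟨h1, this x h3⟩, h3⟩
    · rw [Set.ncard_eq_zero ((hS j).subset Set.inter_subset_left)]
      ext x
      simp only [Set.mem_inter_iff, Set.mem_preimage, Set.mem_singleton_iff, Set.mem_empty_iff_false,
        iff_false, not_and]
      rintro ⟨_, hx⟩ hfx
      rw [← hfx] at h
      exact h (Finset.mem_filter.2 ⟨Finset.mem_univ _, hx⟩)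

lemma IsRateOnePoisson.map_counts [IsProbabilityMeasure P] (hQ : IsRateOnePoisson Q P) {k : ℕ}
    (D : Fin k → Set (EuclideanSpace ℝ (Fin d))) (hD : ∀ i, MeasurableSet (D i))
    (hb : ∀ i, Bornology.IsBounded (D i)) (hdis : Pairwise (fun i j => Disjoint (D i) (D j))) :
    P.map (fun ω i => (Q ω ∩ D i).ncard)
      = Measure.pi fun i => poissonMeasure (volume (D i)).toNNReal := by
  rw [(iIndepFun_iff_map_fun_eq_pi_map fun i => hQ.aemeasurable_count (hD i) (hb i)).1
    (hQ.indep_count k D hD hb hdis)]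
  congr 1
  ext1 i
  exact (hQ.hasLaw_count _ (hD i) (hb i)).map_eq

lemma IsRateOnePoisson.ae_finite (hQ : IsRateOnePoisson Q P)
    {A : Set (EuclideanSpace ℝ (Fin d))} (hb : Bornology.IsBounded A) :
    ∀ᵐ ω ∂P, (Q ω ∩ A).Finite :=
  hQ.locallyFinite.mono fun _ h => h A hb

/-- The sets `A i` may overlap, but their counts are a fixed function of the counts in disjoint
atoms. Those are independent Poisson variables, hence have a law that is the same for every process.
-/
lemma IsRateOnePoisson.cylinder [IsProbabilityMeasure P] (hQ : IsRateOnePoisson Q P) {m : ℕ}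
    {A : Fin m → Set (EuclideanSpace ℝ (Fin d))}
    (hA : ∀ i, MeasurableSet (A i) ∧ Bornology.IsBounded (A i)) (W : Set (Fin m → ℕ)) :
    NullMeasurableSet (Q ⁻¹' {S | (fun i => (S ∩ A i).ncard) ∈ W}) P ∧
      ∀ Q' : Ω → Set (EuclideanSpace ℝ (Fin d)), IsRateOnePoisson Q' P →
        P (Q ⁻¹' {S | (fun i => (S ∩ A i).ncard) ∈ W})
          = P (Q' ⁻¹' {S | (fun i => (S ∩ A i).ncard) ∈ W}) := by
  have hm : ∀ {Q : Ω → Set (EuclideanSpace ℝ (Fin d))}, IsRateOnePoisson Q P →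
      AEMeasurable (fun ω i => (Q ω ∩ A i).ncard) P := fun hQ =>
    aemeasurable_pi_iff.2 fun i => hQ.aemeasurable_count (hA i).1 (hA i).2
  have hW : MeasurableSet W := MeasurableSet.of_discrete
  refine ⟨(hm hQ).nullMeasurableSet_preimage hW, fun Q' hQ' => ?_⟩
  obtain ⟨k, D, G, hD, hDb, hdis, hG⟩ := exists_counts_eq_of_indep A hA
  have key : ∀ {Q : Ω → Set (EuclideanSpace ℝ (Fin d))}, IsRateOnePoisson Q P →
      P (Q ⁻¹' {S | (fun i => (S ∩ A i).ncard) ∈ W})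
        = (Measure.pi fun i => poissonMeasure (volume (D i)).toNNReal) (G ⁻¹' W) := by
    intro Q hQ
    have hmD : AEMeasurable (fun ω i => (Q ω ∩ D i).ncard) P :=
      aemeasurable_pi_iff.2 fun i => hQ.aemeasurable_count (hD i) (hDb i)
    rw [← hQ.map_counts D hD hDb hdis, Measure.map_apply_of_aemeasurable hmD
      MeasurableSet.of_discrete]
    refine measure_congr ?_
    filter_upwards [ae_all_iff.2 fun i => hQ.ae_finite (hA i).2] with ω hω
    change ((fun i => (Q ω ∩ A i).ncard) ∈ W) = (G (fun i => (Q ω ∩ D i).ncard) ∈ W)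
    rw [hG _ hω]
  rw [key hQ, key hQ']

/-- The probability of an event that depends on the numbers of points in bounded Borel sets is the
same for all Poisson processes of rate one. -/
lemma IsRateOnePoisson.countSpace_law [IsProbabilityMeasure P] (hQ : IsRateOnePoisson Q P)
    (hQ' : IsRateOnePoisson Q' P) {V : Set (Set (EuclideanSpace ℝ (Fin d)))}
    (hV : MeasurableSet[countSpace d] V) :
    NullMeasurableSet (Q ⁻¹' V) P ∧ NullMeasurableSet (Q' ⁻¹' V) P ∧
      P (Q ⁻¹' V) = P (Q' ⁻¹' V) := by
  induction V, hV using MeasurableSpace.induction_on_inter rfl (isPiSystem_countCylinders d) with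
  | empty => simp
  | basic t ht =>
    obtain ⟨m, A, W, hA, rfl⟩ := ht
    exact ⟨(hQ.cylinder hA W).1, (hQ'.cylinder hA W).1, (hQ.cylinder hA W).2 Q' hQ'⟩
  | compl t _ ih =>
    obtain ⟨h1, h2, h3⟩ := ih
    refine ⟨h1.compl, h2.compl, ?_⟩
    rw [Set.preimage_compl, Set.preimage_compl, measure_compl₀ h1 (measure_ne_top _ _),
      measure_compl₀ h2 (measure_ne_top _ _), h3]
  | iUnion f hdis _ ih =>
    have hd : ∀ R : Ω → Set (EuclideanSpace ℝ (Fin d)),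
        Pairwise (Function.onFun (AEDisjoint P) fun i => R ⁻¹' f i) := fun R i j hij =>
      ((hdis hij).preimage R).aedisjoint
    simp only [Set.preimage_iUnion]
    refine ⟨.iUnion fun i => (ih i).1, .iUnion fun i => (ih i).2.1, ?_⟩
    rw [measure_iUnion₀ (hd Q) fun i => (ih i).1, measure_iUnion₀ (hd Q') fun i => (ih i).2.1]
    exact tsum_congr fun i => (ih i).2.2

lemma IsRateOnePoisson.prob_void (hQ : IsRateOnePoisson Q P)
    {A : Set (EuclideanSpace ℝ (Fin d))} (hA : MeasurableSet A) (hb : Bornology.IsBounded A) :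
    P.real {ω | (Q ω ∩ A).ncard = 0} = Real.exp (-(volume A).toReal) := by
  have h := (hQ.hasLaw_count A hA hb).measure_eq (p := fun n => n = 0) MeasurableSet.of_discrete
  rw [measureReal_def, h]
  have := poissonMeasure_real_singleton (volume A).toNNReal 0
  simp only [pow_zero, mul_one, Nat.factorial_zero, Nat.cast_one, div_one] at this
  exact this

/-- The probability is `1 - (1 + r) exp(-r)`, and `exp(-r) ≥ 1 - r`. The quadratic order in `r` is
what makes ties negligible. -/
lemma poissonMeasure_real_two_le (r : NNReal) : (poissonMeasure r).real {n | 2 ≤ n} ≤ r ^ 2 := by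
  have h : {n : ℕ | 2 ≤ n} = ({0, 1} : Set ℕ)ᶜ := by
    ext n
    simp only [Set.mem_ofPred_eq, Set.mem_compl_iff, Set.mem_insert_iff, Set.mem_singleton_iff]
    omega
  rw [h, probReal_compl_eq_one_sub (MeasurableSet.of_discrete),
    Set.insert_eq, measureReal_union (by simp) (by simp), poissonMeasure_real_singleton,
    poissonMeasure_real_singleton]
  have h1 := Real.add_one_le_exp (-(r : ℝ))
  simp only [pow_zero, mul_one, Nat.factorial_zero, Nat.cast_one, div_one, pow_one,
    Nat.factorial_one]
  nlinarith [r.2]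

lemma IsRateOnePoisson.prob_two_le (hQ : IsRateOnePoisson Q P)
    {A : Set (EuclideanSpace ℝ (Fin d))} (hA : MeasurableSet A) (hb : Bornology.IsBounded A) :
    P.real {ω | 2 ≤ (Q ω ∩ A).ncard} ≤ (volume A).toReal ^ 2 := by
  have h := (hQ.hasLaw_count A hA hb).measure_eq (p := fun n => 2 ≤ n) MeasurableSet.of_discrete
  rw [measureReal_def, h]
  exact poissonMeasure_real_two_le _

end Poisson

/-! ### Almost sure uniqueness of the nearest point -/

section Ties

variable {d : ℕ} [NeZero d] {Ω : Type*} [MeasurableSpace Ω] {P : Measure Ω}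
  [IsProbabilityMeasure P] {Q : Ω → Set (EuclideanSpace ℝ (Fin d))}

/-- Measuring the radius by its `d`-th power makes the volume of a shell linear in the increment, so
equal increments give equal volumes. -/
lemma volume_rpow_shell (x : EuclideanSpace ℝ (Fin d)) {s t : ℝ} (hs : 0 ≤ s) (hst : s ≤ t) :
    (volume {p : EuclideanSpace ℝ (Fin d) | s ≤ ‖p - x‖ ^ d ∧ ‖p - x‖ ^ d < t}).toReal
      = (t - s) * (volume (Metric.ball (0 : EuclideanSpace ℝ (Fin d)) 1)).toReal := by
  have hd : (d : ℝ) ≠ 0 := by exact_mod_cast NeZero.ne d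
  have hball : ∀ u : ℝ, 0 ≤ u → {p : EuclideanSpace ℝ (Fin d) | ‖p - x‖ ^ d < u}
      = Metric.ball x (u ^ (1 / d : ℝ)) := by
    intro u hu
    ext p
    rw [Metric.mem_ball, dist_eq_norm]
    change ‖p - x‖ ^ d < u ↔ _
    conv_lhs => rw [← Real.rpow_natCast]
    rw [one_div, Real.lt_rpow_inv_iff_of_pos (norm_nonneg _) hu
      (by exact_mod_cast Nat.pos_of_ne_zero (NeZero.ne d))]
  have hvol : ∀ u : ℝ, 0 ≤ u → (volume {p : EuclideanSpace ℝ (Fin d) | ‖p - x‖ ^ d < u})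
      = ENNReal.ofReal u * volume (Metric.ball (0 : EuclideanSpace ℝ (Fin d)) 1) := by
    intro u hu
    rw [hball u hu, Measure.addHaar_ball _ _ (Real.rpow_nonneg hu _), finrank_euclideanSpace_fin,
      ← Real.rpow_natCast, ← Real.rpow_mul hu, one_div, inv_mul_cancel₀ hd, Real.rpow_one]
  have hdiff : {p : EuclideanSpace ℝ (Fin d) | s ≤ ‖p - x‖ ^ d ∧ ‖p - x‖ ^ d < t}
      = {p | ‖p - x‖ ^ d < t} \ {p | ‖p - x‖ ^ d < s} := by
    ext p
    simp only [Set.mem_ofPred_eq, Set.mem_sdiff, not_lt]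
    exact and_comm
  have hfin : volume (Metric.ball (0 : EuclideanSpace ℝ (Fin d)) 1) ≠ ⊤ := measure_ball_lt_top.ne
  have hsub : {p : EuclideanSpace ℝ (Fin d) | ‖p - x‖ ^ d < s} ⊆ {p | ‖p - x‖ ^ d < t} :=
    fun p hp => lt_of_lt_of_le hp hst
  rw [hdiff, measure_sdiff hsub ?_ ?_, hvol t (hs.trans hst), hvol s hs,
    ← ENNReal.sub_mul (fun _ _ => hfin), ← ENNReal.ofReal_sub _ hs, ENNReal.toReal_mul,
    ENNReal.toReal_ofReal (by linarith)]
  · exact (measurableSet_lt (by fun_prop) measurable_const).nullMeasurableSet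
  · rw [hvol s hs]
    exact ENNReal.mul_ne_top ENNReal.ofReal_ne_top hfin

lemma isBounded_rpow_shell (x : EuclideanSpace ℝ (Fin d)) (s t : ℝ) :
    Bornology.IsBounded {p : EuclideanSpace ℝ (Fin d) | s ≤ ‖p - x‖ ^ d ∧ ‖p - x‖ ^ d < t} := by
  refine (Metric.isBounded_closedBall (x := x) (r := max 1 t)).subset fun p hp => ?_
  rw [Metric.mem_closedBall, dist_eq_norm]
  by_contra h
  rw [not_le, max_lt_iff] at h
  have : ‖p - x‖ ≤ ‖p - x‖ ^ d := le_self_pow₀ h.1.le (NeZero.ne d)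
  linarith [hp.2]

/-- Almost surely no two points of the process are equally far from `x`. -/
lemma IsRateOnePoisson.ae_no_tie (hQ : IsRateOnePoisson Q P) (x : EuclideanSpace ℝ (Fin d)) :
    ∀ᵐ ω ∂P, ∀ p ∈ Q ω, ∀ p' ∈ Q ω, ‖p - x‖ = ‖p' - x‖ → p = p' := by
  set v := (volume (Metric.ball (0 : EuclideanSpace ℝ (Fin d)) 1)).toReal with hv
  let bad : ℕ → Set Ω := fun K => {ω | (∀ A : Set (EuclideanSpace ℝ (Fin d)),
    Bornology.IsBounded A → (Q ω ∩ A).Finite) ∧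
      ∃ p ∈ Q ω, ∃ p' ∈ Q ω, ‖p - x‖ = ‖p' - x‖ ∧ p ≠ p' ∧ ‖p - x‖ ^ d < K}
  have hbad : ∀ K, P (bad K) = 0 := by
    intro K
    -- Two points at equal distance lie in the same one of `M` shells of volume `K v / M`. The union
    -- bound gives `M (K v / M)²`, which vanishes as `M` grows.
    have hle : ∀ M : ℕ, 0 < M → P.real (bad K) ≤ (K * v) ^ 2 * (1 / M) := by
      intro M hM
      have hM' : (0 : ℝ) < M := by exact_mod_cast hM
      let A : ℕ → Set (EuclideanSpace ℝ (Fin d)) := fun i =>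
        {p | (i : ℝ) * (K / M) ≤ ‖p - x‖ ^ d ∧ ‖p - x‖ ^ d < (i + 1) * (K / M)}
      have hA : ∀ i, MeasurableSet (A i) := fun i => by
        have h1 : Measurable fun p : EuclideanSpace ℝ (Fin d) => ‖p - x‖ ^ d := by fun_prop
        exact (measurableSet_le measurable_const h1).inter (measurableSet_lt h1 measurable_const)
      have hsub : bad K ⊆ ⋃ i ∈ Finset.range M, {ω | 2 ≤ (Q ω ∩ A i).ncard} := by
        rintro ω ⟨hfin, p, hp, p', hp', hpp, hne, hK⟩
        have hK0 : (0 : ℝ) < K := lt_of_le_of_lt (by positivity) hK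
        have hq : 0 < (K : ℝ) / M := by positivity
        set i := ⌊‖p - x‖ ^ d / (K / M)⌋₊
        have h1 : (i : ℝ) ≤ ‖p - x‖ ^ d / (K / M) := Nat.floor_le (by positivity)
        have h2 : ‖p - x‖ ^ d / (K / M) < i + 1 := Nat.lt_floor_add_one _
        rw [le_div_iff₀ hq] at h1
        rw [div_lt_iff₀ hq] at h2
        have hi : i < M := by
          have : (i : ℝ) * (K / M) < M * (K / M) := by
            rw [mul_div_cancel₀ _ hM'.ne']
            linarith
          exact_mod_cast lt_of_mul_lt_mul_right this hq.le
        refine Set.mem_biUnion (Finset.mem_coe.2 (Finset.mem_range.2 hi)) ?_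
        have hsub : ({p, p'} : Set (EuclideanSpace ℝ (Fin d))) ⊆ Q ω ∩ A i := by
          rintro y (rfl | rfl)
          · exact ⟨hp, h1, h2⟩
          · refine ⟨hp', ?_, ?_⟩ <;> rw [← hpp] <;> assumption
        have := Set.ncard_le_ncard hsub (hfin _ (isBounded_rpow_shell x _ _))
        rwa [Set.ncard_pair hne] at this
      calc P.real (bad K) ≤ P.real (⋃ i ∈ Finset.range M, {ω | 2 ≤ (Q ω ∩ A i).ncard}) :=
            measureReal_mono hsub (measure_ne_top _ _)
        _ ≤ ∑ i ∈ Finset.range M, P.real {ω | 2 ≤ (Q ω ∩ A i).ncard} :=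
            measureReal_biUnion_finset_le _ _
        _ ≤ ∑ i ∈ Finset.range M, (K / M * v) ^ 2 := by
            refine Finset.sum_le_sum fun i _ => ?_
            refine (hQ.prob_two_le (hA i) (isBounded_rpow_shell x _ _)).trans_eq ?_
            rw [volume_rpow_shell x (by positivity) (by gcongr; linarith)]
            ring
        _ = (K * v) ^ 2 * (1 / M) := by
            rw [Finset.sum_const, Finset.card_range, nsmul_eq_mul]
            field_simp
    have hlim : Tendsto (fun M : ℕ => (K * v) ^ 2 * (1 / (M : ℝ))) atTop (nhds 0) := by
      have := tendsto_one_div_atTop_nhds_zero_nat (𝕜 := ℝ)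
      simpa using this.const_mul ((K * v) ^ 2)
    have h0 : P.real (bad K) ≤ 0 :=
      ge_of_tendsto hlim ((eventually_gt_atTop 0).mono fun M hM => hle M hM)
    exact (measureReal_eq_zero_iff (measure_ne_top _ _)).1 (le_antisymm h0 measureReal_nonneg)
  have hall : ∀ᵐ ω ∂P, ∀ K, ω ∉ bad K := ae_all_iff.2 fun K => measure_eq_zero_iff_ae_notMem.1 (hbad K)
  filter_upwards [hall, hQ.locallyFinite] with ω hω hfin p hp p' hp' hpp
  by_contra hne
  obtain ⟨K, hK⟩ := exists_nat_gt (‖p - x‖ ^ d)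
  exact hω K ⟨hfin, p, hp, p', hp', hpp, hne, hK⟩

end Ties

/-! ### Measurability of the passage times -/

section Measurability

variable {d : ℕ} {α : ℝ}

/-- If the closest point is unique, a neighbourhood of it is found with a ball around `x`. -/
lemma exists_radius {S : Set (EuclideanSpace ℝ (Fin d))}
    {q : EuclideanSpace ℝ (Fin d) → EuclideanSpace ℝ (Fin d)} (hq : IsNearestPointMap S q)
    (hfin : ∀ A : Set (EuclideanSpace ℝ (Fin d)), Bornology.IsBounded A → (S ∩ A).Finite)
    {x : EuclideanSpace ℝ (Fin d)} (htie : ∀ p ∈ S, ∀ p' ∈ S, ‖p - x‖ = ‖p' - x‖ → p = p') :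
    ∃ s : ℚ, S ∩ Metric.closedBall x s = {q x} := by
  have hf := hfin (Metric.closedBall x (‖x - q x‖ + 1)) Metric.isBounded_closedBall
  have hev : ∀ᶠ s : ℝ in nhdsWithin ‖x - q x‖ (Set.Ioi ‖x - q x‖),
      ∀ p ∈ (S ∩ Metric.closedBall x (‖x - q x‖ + 1)) \ {q x}, s < ‖p - x‖ := by
    rw [Filter.eventually_all_finite (hf.subset Set.sdiff_subset)]
    rintro p ⟨⟨hp, -⟩, hne⟩
    have : ‖x - q x‖ < ‖p - x‖ := by
      rw [norm_sub_rev p x]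
      refine lt_of_le_of_ne ((hq x).2 p hp) fun h => hne ?_
      rw [norm_sub_rev x p, norm_sub_rev x] at h
      exact (htie _ (hq x).1 _ hp h).symm
    exact (eventually_lt_nhds this).filter_mono nhdsWithin_le_nhds
  obtain ⟨r, hr, hr'⟩ := (mem_nhdsGT_iff_exists_Ioo_subset).1 hev
  obtain ⟨s, hs1, hs2⟩ := exists_rat_btwn (lt_min (Set.mem_Ioi.1 hr) (lt_add_one ‖x - q x‖))
  have hs := hr' ⟨hs1, hs2.trans_le (min_le_left _ _)⟩
  refine ⟨s, ?_⟩
  ext p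
  simp only [Set.mem_inter_iff, Metric.mem_closedBall, dist_eq_norm, Set.mem_singleton_iff]
  constructor
  · rintro ⟨hp, hps⟩
    by_contra hne
    have hp1 : ‖p - x‖ ≤ ‖x - q x‖ + 1 := hps.trans (hs2.le.trans (min_le_right _ _))
    have := hs p ⟨⟨hp, by rwa [Metric.mem_closedBall, dist_eq_norm]⟩, hne⟩
    linarith
  · rintro rfl
    exact ⟨(hq x).1, by rw [norm_sub_rev]; exact hs1.le⟩

/-- A description, in terms of numbers of points, of the configurations for which the passage time
from `x` to `y` is less than `a`. -/
def passageEvent (α : ℝ) (x y : EuclideanSpace ℝ (Fin d)) (a : ℝ) :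
    Set (Set (EuclideanSpace ℝ (Fin d))) :=
  ⋃ (m : ℕ), ⋃ (c : ℕ →₀ ℕ), ⋃ (ρ : ℚ), ⋃ (s : ℚ), ⋃ (s' : ℚ),
  ⋃ (_ : 0 < m ∧ 0 < ρ ∧ ∑ i ∈ Finset.range m,
      (‖TopologicalSpace.denseSeq (EuclideanSpace ℝ (Fin d)) (c i)
        - TopologicalSpace.denseSeq (EuclideanSpace ℝ (Fin d)) (c (i + 1))‖ + 2 * (ρ : ℝ)) ^ α < a),
  ((⋂ i : Fin (m + 1), {S | (S ∩ Metric.ball (TopologicalSpace.denseSeq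
      (EuclideanSpace ℝ (Fin d)) (c i)) ρ).ncard ∈ ({0} : Set ℕ)ᶜ}) ∩
    ({S | (S ∩ (Metric.closedBall x s ∩ Metric.ball (TopologicalSpace.denseSeq
      (EuclideanSpace ℝ (Fin d)) (c 0)) ρ)).ncard ∈ ({0} : Set ℕ)ᶜ} ∩
    {S | (S ∩ (Metric.closedBall x s \ Metric.ball (TopologicalSpace.denseSeq
      (EuclideanSpace ℝ (Fin d)) (c 0)) ρ)).ncard ∈ ({0} : Set ℕ)})) ∩
    ({S | (S ∩ (Metric.closedBall y s' ∩ Metric.ball (TopologicalSpace.denseSeq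
      (EuclideanSpace ℝ (Fin d)) (c m)) ρ)).ncard ∈ ({0} : Set ℕ)ᶜ} ∩
    {S | (S ∩ (Metric.closedBall y s' \ Metric.ball (TopologicalSpace.denseSeq
      (EuclideanSpace ℝ (Fin d)) (c m)) ρ)).ncard ∈ ({0} : Set ℕ)})

/-- All unions in `passageEvent` are countable. This is the reason for rational radii, for centres
from a dense sequence, and for a finitely supported sequence of indices. -/
lemma measurableSet_passageEvent (x y : EuclideanSpace ℝ (Fin d)) (a : ℝ) :
    MeasurableSet[countSpace d] (passageEvent α x y a) := by
  have hb : ∀ (z w : EuclideanSpace ℝ (Fin d)) (s ρ : ℝ) (W : Set ℕ),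
      MeasurableSet[countSpace d] {S | (S ∩ (Metric.closedBall z s ∩ Metric.ball w ρ)).ncard ∈ W} :=
    fun z w s ρ W => measurableSet_count (measurableSet_closedBall.inter measurableSet_ball)
      (Metric.isBounded_closedBall.subset Set.inter_subset_left) W
  have hb' : ∀ (z w : EuclideanSpace ℝ (Fin d)) (s ρ : ℝ) (W : Set ℕ),
      MeasurableSet[countSpace d] {S | (S ∩ (Metric.closedBall z s \ Metric.ball w ρ)).ncard ∈ W} :=
    fun z w s ρ W => measurableSet_count (measurableSet_closedBall.diff measurableSet_ball)
      (Metric.isBounded_closedBall.subset Set.sdiff_subset) W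
  have hb'' : ∀ (w : EuclideanSpace ℝ (Fin d)) (ρ : ℝ) (W : Set ℕ),
      MeasurableSet[countSpace d] {S | (S ∩ (Metric.ball w ρ)).ncard ∈ W} :=
    fun w ρ W => measurableSet_count measurableSet_ball Metric.isBounded_ball W
  unfold passageEvent
  refine MeasurableSet.iUnion fun m => MeasurableSet.iUnion fun c => MeasurableSet.iUnion fun ρ =>
    MeasurableSet.iUnion fun s => MeasurableSet.iUnion fun s' => MeasurableSet.iUnion fun _ => ?_
  exact ((MeasurableSet.iInter fun i => hb'' _ _ _).inter ((hb _ _ _ _ _).inter (hb' _ _ _ _ _))).inter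
    ((hb _ _ _ _ _).inter (hb' _ _ _ _ _))

lemma nearest_mem_of_counts {S : Set (EuclideanSpace ℝ (Fin d))}
    {q : EuclideanSpace ℝ (Fin d) → EuclideanSpace ℝ (Fin d)} (hq : IsNearestPointMap S q)
    (hfin : ∀ A : Set (EuclideanSpace ℝ (Fin d)), Bornology.IsBounded A → (S ∩ A).Finite)
    {x : EuclideanSpace ℝ (Fin d)} {s : ℝ} {B : Set (EuclideanSpace ℝ (Fin d))}
    (h1 : (S ∩ (Metric.closedBall x s ∩ B)).ncard ≠ 0)
    (h2 : (S ∩ (Metric.closedBall x s \ B)).ncard = 0) : q x ∈ B := by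
  obtain ⟨p, hp, hps, -⟩ := Set.nonempty_of_ncard_ne_zero h1
  rw [Set.ncard_eq_zero (hfin _ (Metric.isBounded_closedBall.subset Set.sdiff_subset))] at h2
  by_contra hB
  have : q x ∈ S ∩ (Metric.closedBall x s \ B) := by
    refine ⟨(hq x).1, ?_, hB⟩
    rw [Metric.mem_closedBall, dist_eq_norm] at hps ⊢
    rw [norm_sub_rev] at hps ⊢
    exact ((hq x).2 p hp).trans hps
  rw [h2] at this
  exact this

/-- One point of the configuration is chosen in each ball. The counts around `x` and `y` force `q x`
and `q y` into the first and last ball, and moving each end of a step from the centre costs at most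
`ρ`. Uniqueness of the nearest points is not needed in this direction. -/
lemma passageTime_lt_of_mem_passageEvent (hα : 0 < α) {S : Set (EuclideanSpace ℝ (Fin d))}
    {q : EuclideanSpace ℝ (Fin d) → EuclideanSpace ℝ (Fin d)} (hq : IsNearestPointMap S q)
    (hfin : ∀ A : Set (EuclideanSpace ℝ (Fin d)), Bornology.IsBounded A → (S ∩ A).Finite)
    {x y : EuclideanSpace ℝ (Fin d)} {a : ℝ} (hS : S ∈ passageEvent α x y a) :
    passageTime α S q x y < a := by
  simp only [passageEvent, Set.mem_iUnion] at hS
  obtain ⟨m, c, ρ, s, s', ⟨hm, hρ, hsum⟩, ⟨hballs, hx1, hx2⟩, hy1, hy2⟩ := hS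
  have hqx := nearest_mem_of_counts hq hfin hx1 hx2
  have hqy := nearest_mem_of_counts hq hfin hy1 hy2
  have hex : ∀ i : ℕ, i ≤ m → ∃ p ∈ S, p ∈ Metric.ball (TopologicalSpace.denseSeq
      (EuclideanSpace ℝ (Fin d)) (c i)) (ρ : ℝ) := by
    intro i hi
    have := Set.mem_iInter.1 hballs ⟨i, Nat.lt_succ_of_le hi⟩
    obtain ⟨p, hp, hp'⟩ := Set.nonempty_of_ncard_ne_zero this
    exact ⟨p, hp, hp'⟩
  choose! p hpS hpB using hex
  -- The condition `0 < m` in `passageEvent` keeps the two prescribed ends apart.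
  let p' : ℕ → EuclideanSpace ℝ (Fin d) := fun i => if i = 0 then q x else if i = m then q y else p i
  have hp'S : ∀ i ≤ m, p' i ∈ S := by
    intro i hi
    dsimp only [p']
    split_ifs
    · exact (hq x).1
    · exact (hq y).1
    · exact hpS i hi
  have hp'B : ∀ i ≤ m, ‖p' i - TopologicalSpace.denseSeq (EuclideanSpace ℝ (Fin d)) (c i)‖ ≤ ρ := by
    intro i hi
    rw [← dist_eq_norm]
    dsimp only [p']
    split_ifs with h h'
    · subst h; exact (Metric.mem_ball.1 hqx).le
    · subst h'; exact (Metric.mem_ball.1 hqy).le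
    · exact (Metric.mem_ball.1 (hpB i hi)).le
  refine lt_of_le_of_lt (csInf_le (bddBelow_pathTimes _ _)
    ⟨m, p', hp'S, by simp [p'], by simp [p', hm.ne'], rfl⟩) (lt_of_le_of_lt ?_ hsum)
  refine Finset.sum_le_sum fun i hi => Real.rpow_le_rpow (norm_nonneg _) ?_ hα.le
  have hi' := Finset.mem_range.1 hi
  have h1 := hp'B i hi'.le
  have h2 := hp'B (i + 1) hi'
  set u := TopologicalSpace.denseSeq (EuclideanSpace ℝ (Fin d)) (c i)
  set v := TopologicalSpace.denseSeq (EuclideanSpace ℝ (Fin d)) (c (i + 1))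
  calc ‖p' i - p' (i + 1)‖ = ‖(p' i - u) + (u - v) - (p' (i + 1) - v)‖ := by congr 1; abel
    _ ≤ ‖p' i - u‖ + ‖u - v‖ + ‖p' (i + 1) - v‖ :=
        (norm_sub_le _ _).trans (by gcongr; exact norm_add_le _ _)
    _ ≤ _ := by linarith

/-- The strict inequality leaves room to thicken a path by small rational balls. Uniqueness of the
nearest points provides closed balls around `x` and `y` that contain only `q x` and `q y`. -/
lemma mem_passageEvent_of_passageTime_lt (hα : 0 < α) {S : Set (EuclideanSpace ℝ (Fin d))}
    {q : EuclideanSpace ℝ (Fin d) → EuclideanSpace ℝ (Fin d)} (hq : IsNearestPointMap S q)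
    (hfin : ∀ A : Set (EuclideanSpace ℝ (Fin d)), Bornology.IsBounded A → (S ∩ A).Finite)
    {x y : EuclideanSpace ℝ (Fin d)} {a : ℝ}
    (hx : ∀ p ∈ S, ∀ p' ∈ S, ‖p - x‖ = ‖p' - x‖ → p = p')
    (hy : ∀ p ∈ S, ∀ p' ∈ S, ‖p - y‖ = ‖p' - y‖ → p = p')
    (ht : passageTime α S q x y < a) : S ∈ passageEvent α x y a := by
  obtain ⟨t, ⟨m, p, hp, h0, hm, rfl⟩, ht'⟩ :
      ∃ t, (∃ (m : ℕ) (p : ℕ → EuclideanSpace ℝ (Fin d)), (∀ i ≤ m + 1, p i ∈ S) ∧ p 0 = q x ∧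
        p (m + 1) = q y ∧ t = ∑ i ∈ Finset.range (m + 1), ‖p i - p (i + 1)‖ ^ α) ∧ t < a := by
    obtain ⟨t, ⟨m, p, hp, h0, hm, rfl⟩, ht'⟩ :=
      exists_lt_of_csInf_lt ⟨_, step_mem_pathTimes (α := α) (hq x).1 (hq y).1⟩ ht
    -- The last point is repeated, so that the path has at least one step; the additional step is
    -- free because `0 ^ α = 0`.
    refine ⟨_, ⟨m, fun i => p (min i m), fun i _ => hp _ (min_le_right _ _), by simpa using h0,
      by simpa using hm, rfl⟩, ?_⟩
    rw [Finset.sum_range_succ]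
    simp only [min_self, le_add_iff_nonneg_right, zero_le, min_eq_right, sub_self, norm_zero,
      Real.zero_rpow hα.ne', add_zero]
    refine lt_of_eq_of_lt (Finset.sum_congr rfl fun i hi => ?_) ht'
    have := Finset.mem_range.1 hi
    rw [min_eq_left (by omega), min_eq_left (by omega)]
  -- Of the `4 ρ`, one half comes from replacing points by centres and the other half is the
  -- allowance built into `passageEvent`.
  have hcont : Tendsto (fun ρ : ℝ => ∑ i ∈ Finset.range (m + 1), (‖p i - p (i + 1)‖ + 4 * ρ) ^ α)
      (nhdsWithin 0 (Set.Ioi 0))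
      (nhds (∑ i ∈ Finset.range (m + 1), (‖p i - p (i + 1)‖ + 4 * 0) ^ α)) := by
    refine Tendsto.mono_left (tendsto_finsetSum _ fun i _ => ?_) nhdsWithin_le_nhds
    exact (((continuous_const.add (continuous_const.mul continuous_id)).rpow_const
      fun _ => Or.inr hα.le).tendsto 0)
  simp only [mul_zero, add_zero] at hcont
  obtain ⟨r, hr, hr'⟩ := (mem_nhdsGT_iff_exists_Ioo_subset).1 (hcont.eventually (eventually_lt_nhds ht'))
  obtain ⟨ρ, hρ0, hρ1⟩ := exists_rat_btwn (Set.mem_Ioi.1 hr)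
  have hρ := hr' ⟨hρ0, hρ1⟩
  have hdense : ∀ z : EuclideanSpace ℝ (Fin d), ∃ k : ℕ,
      dist z (TopologicalSpace.denseSeq (EuclideanSpace ℝ (Fin d)) k) < ρ := fun z => by
    obtain ⟨k, hk⟩ := (TopologicalSpace.denseRange_denseSeq
      (EuclideanSpace ℝ (Fin d))).exists_dist_lt z hρ0
    exact ⟨k, hk⟩
  choose k hk using hdense
  let c : ℕ →₀ ℕ := Finsupp.onFinset (Finset.range (m + 2))
    (fun i => if i < m + 2 then k (p i) else 0) (by intro i hi; by_contra h; simp_all)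
  have hc : ∀ i ≤ m + 1, dist (p i)
      (TopologicalSpace.denseSeq (EuclideanSpace ℝ (Fin d)) (c i)) < ρ := by
    intro i hi
    have : c i = k (p i) := by simp [c, Nat.lt_succ_of_le hi]
    rw [this]
    exact hk _
  obtain ⟨s, hs⟩ := exists_radius hq hfin hx
  obtain ⟨s', hs'⟩ := exists_radius hq hfin hy
  have hqx : q x ∈ S ∩ Metric.closedBall x (s : ℝ) := by rw [hs]; rfl
  have hqy : q y ∈ S ∩ Metric.closedBall y (s' : ℝ) := by rw [hs']; rfl
  have hne : ∀ {A : Set (EuclideanSpace ℝ (Fin d))} {z}, Bornology.IsBounded A → z ∈ S ∩ A →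
      (S ∩ A).ncard ∈ ({0} : Set ℕ)ᶜ := fun hA hz h =>
    (Set.ncard_ne_zero_of_mem hz (hfin _ hA)) h
  have hemp : ∀ {A B : Set (EuclideanSpace ℝ (Fin d))} {z}, S ∩ A = {z} → z ∈ B →
      (S ∩ (A \ B)).ncard ∈ ({0} : Set ℕ) := by
    intro A B z hA hz
    have : S ∩ (A \ B) = ∅ := by
      rw [← Set.inter_sdiff_assoc, hA]
      exact Set.sdiff_eq_empty.2 (Set.singleton_subset_iff.2 hz)
    rw [this]
    simp
  have hc0 : q x ∈ Metric.ball (TopologicalSpace.denseSeq (EuclideanSpace ℝ (Fin d)) (c 0)) (ρ : ℝ) := by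
    rw [← h0]; exact hc 0 (by omega)
  have hcm : q y ∈ Metric.ball (TopologicalSpace.denseSeq (EuclideanSpace ℝ (Fin d)) (c (m + 1)))
      (ρ : ℝ) := by
    rw [← hm]; exact hc (m + 1) le_rfl
  simp only [passageEvent, Set.mem_iUnion]
  refine ⟨m + 1, c, ρ, s, s', ⟨Nat.succ_pos _, by exact_mod_cast hρ0, ?_⟩,
    ⟨Set.mem_iInter.2 fun i => ?_, ?_, ?_⟩, ?_, ?_⟩
  · refine lt_of_le_of_lt (Finset.sum_le_sum fun i hi => ?_) hρ
    have hi' := Finset.mem_range.1 hi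
    have h1 := hc i hi'.le
    have h2 := hc (i + 1) hi'
    rw [dist_eq_norm] at h1 h2
    set u := TopologicalSpace.denseSeq (EuclideanSpace ℝ (Fin d)) (c i)
    set v := TopologicalSpace.denseSeq (EuclideanSpace ℝ (Fin d)) (c (i + 1))
    refine Real.rpow_le_rpow (by positivity) ?_ hα.le
    have : ‖u - v‖ ≤ ‖p i - p (i + 1)‖ + ‖p i - u‖ + ‖p (i + 1) - v‖ := by
      calc ‖u - v‖ = ‖(p i - p (i + 1)) - (p i - u) + (p (i + 1) - v)‖ := by congr 1; abel
        _ ≤ _ := (norm_add_le _ _).trans (by gcongr; exact norm_sub_le _ _)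
    linarith
  · have hi : (i : ℕ) ≤ m + 1 := Nat.lt_succ_iff.1 i.2
    exact hne Metric.isBounded_ball ⟨hp _ hi, hc _ hi⟩
  · exact hne (Metric.isBounded_closedBall.subset Set.inter_subset_left) ⟨hqx.1, hqx.2, hc0⟩
  · exact hemp hs hc0
  · exact hne (Metric.isBounded_closedBall.subset Set.inter_subset_left) ⟨hqy.1, hqy.2, hcm⟩
  · exact hemp hs' hcm

end Measurability

/-! ### Invariance under isometries -/

section Isometry

variable {d : ℕ} {α : ℝ} {Ω : Type*} [MeasurableSpace Ω] {P : Measure Ω}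
  {Q : Ω → Set (EuclideanSpace ℝ (Fin d))}
  {q : Ω → EuclideanSpace ℝ (Fin d) → EuclideanSpace ℝ (Fin d)}

lemma IsRateOnePoisson.preimage (hQ : IsRateOnePoisson Q P)
    (φ : EuclideanSpace ℝ (Fin d) ≃ᵢ EuclideanSpace ℝ (Fin d)) (hφ : MeasurePreserving φ) :
    IsRateOnePoisson (fun ω => φ ⁻¹' Q ω) P := by
  have himg : ∀ A : Set (EuclideanSpace ℝ (Fin d)), φ '' A = φ.symm ⁻¹' A := fun A =>
    φ.toEquiv.image_eq_preimage_symm A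
  have hcount : ∀ (S A : Set (EuclideanSpace ℝ (Fin d))), φ '' (φ ⁻¹' S ∩ A) = S ∩ φ '' A :=
    fun S A => by rw [Set.inter_comm, Set.image_inter_preimage, Set.inter_comm]
  have hn : ∀ (S A : Set (EuclideanSpace ℝ (Fin d))),
      (φ ⁻¹' S ∩ A).ncard = (S ∩ φ '' A).ncard := fun S A => by
    rw [← hcount, Set.ncard_image_of_injective _ φ.injective]
  have hm : ∀ A : Set (EuclideanSpace ℝ (Fin d)), MeasurableSet A → MeasurableSet (φ '' A) :=
    fun A hA => by
      rw [himg]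
      exact φ.symm.continuous.measurable hA
  have hb : ∀ A : Set (EuclideanSpace ℝ (Fin d)), Bornology.IsBounded A →
      Bornology.IsBounded (φ '' A) := fun A hA => φ.isometry.lipschitz.isBounded_image hA
  have hv : ∀ A : Set (EuclideanSpace ℝ (Fin d)), MeasurableSet A → volume (φ '' A) = volume A := by
    intro A hA
    rw [← hφ.measure_preimage (hm A hA).nullMeasurableSet, Set.preimage_image_eq _ φ.injective]
  refine ⟨?_, ?_, ?_⟩
  · filter_upwards [hQ.locallyFinite] with ω hω A hA
    exact Set.Finite.of_finite_image (by rw [hcount]; exact hω _ (hb A hA)) φ.injective.injOn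
  · intro A hA hAb
    simp only [hn]
    rw [← hv A hA]
    exact hQ.hasLaw_count _ (hm A hA) (hb A hAb)
  · intro m A hA hAb hdis
    simp only [hn]
    exact hQ.indep_count m _ (fun i => hm _ (hA i)) (fun i => hb _ (hAb i))
      fun i j hij => (Set.disjoint_image_iff φ.injective).2 (hdis hij)

lemma IsNearestPointMap.preimage {S : Set (EuclideanSpace ℝ (Fin d))}
    {q : EuclideanSpace ℝ (Fin d) → EuclideanSpace ℝ (Fin d)} (hq : IsNearestPointMap S q)
    (φ : EuclideanSpace ℝ (Fin d) ≃ᵢ EuclideanSpace ℝ (Fin d)) :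
    IsNearestPointMap (φ ⁻¹' S) (fun x => φ.symm (q (φ x))) := by
  refine fun x => ⟨by simpa using (hq (φ x)).1, fun p hp => ?_⟩
  have := (hq (φ x)).2 _ hp
  rw [← dist_eq_norm, ← dist_eq_norm, φ.dist_eq] at this
  rwa [← dist_eq_norm, ← dist_eq_norm, ← φ.dist_eq, φ.apply_symm_apply]

lemma pathTimes_preimage_subset {S : Set (EuclideanSpace ℝ (Fin d))}
    (φ : EuclideanSpace ℝ (Fin d) ≃ᵢ EuclideanSpace ℝ (Fin d))
    (a b : EuclideanSpace ℝ (Fin d)) :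
    pathTimes α (φ ⁻¹' S) a b ⊆ pathTimes α S (φ a) (φ b) := by
  rintro t ⟨m, p, hp, h0, hm, rfl⟩
  refine ⟨m, fun i => φ (p i), fun i hi => hp i hi, by simp [h0], by simp [hm], ?_⟩
  refine Finset.sum_congr rfl fun i _ => ?_
  rw [← dist_eq_norm, ← dist_eq_norm, φ.dist_eq]

lemma passageTime_preimage {S : Set (EuclideanSpace ℝ (Fin d))}
    {q : EuclideanSpace ℝ (Fin d) → EuclideanSpace ℝ (Fin d)}
    (φ : EuclideanSpace ℝ (Fin d) ≃ᵢ EuclideanSpace ℝ (Fin d)) (x y : EuclideanSpace ℝ (Fin d)) :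
    passageTime α (φ ⁻¹' S) (fun x => φ.symm (q (φ x))) x y
      = passageTime α S q (φ x) (φ y) := by
  unfold passageTime
  congr 1
  refine Set.Subset.antisymm ?_ ?_
  · simpa using pathTimes_preimage_subset (α := α) (S := S) φ (φ.symm (q (φ x))) (φ.symm (q (φ y)))
  · have := pathTimes_preimage_subset (α := α) (S := φ ⁻¹' S) φ.symm (q (φ x)) (q (φ y))
    rw [← Set.preimage_comp, φ.self_comp_symm] at this
    simpa using this

/-- The reflection that exchanges the vectors `x - y` and `x' - y'` of equal length is followed by a
translation. -/
lemma exists_isometry {x y x' y' : EuclideanSpace ℝ (Fin d)} (h : ‖x - y‖ = ‖x' - y'‖) :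
    ∃ φ : EuclideanSpace ℝ (Fin d) ≃ᵢ EuclideanSpace ℝ (Fin d),
      MeasurePreserving φ ∧ φ x = x' ∧ φ y = y' := by
  let L := Submodule.reflection (ℝ ∙ ((x - y) - (x' - y')))ᗮ
  have hL : L (x - y) = x' - y' := Submodule.reflection_sub h
  let φ : EuclideanSpace ℝ (Fin d) ≃ᵢ EuclideanSpace ℝ (Fin d) :=
    L.toIsometryEquiv.trans (IsometryEquiv.addRight (y' - L y))
  refine ⟨φ, ?_, ?_, ?_⟩
  · exact (measurePreserving_add_right volume (y' - L y)).comp L.measurePreserving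
  · change L x + (y' - L y) = x'
    rw [map_sub] at hL
    calc L x + (y' - L y) = (L x - L y) + y' := by abel
      _ = x' := by rw [hL]; abel
  · change L y + (y' - L y) = y'
    abel

end Isometry

/-! ### The law of the passage time -/

section Law

variable {d : ℕ} [NeZero d] {α : ℝ} {Ω : Type*} [MeasurableSpace Ω] {P : Measure Ω}
  [IsProbabilityMeasure P] {Q Q' : Ω → Set (EuclideanSpace ℝ (Fin d))}
  {q q' : Ω → EuclideanSpace ℝ (Fin d) → EuclideanSpace ℝ (Fin d)}

/-- For fixed `x` and `y` there are almost surely no ties, so the event is determined by counts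
alone. Hence neither the tie-breaking nor the realisation of the process affects the law. -/
lemma passageTime_lt_ae_eq (hα : 0 < α) (hQ : IsRateOnePoisson Q P)
    (hq : ∀ᵐ ω ∂P, IsNearestPointMap (Q ω) (q ω)) (x y : EuclideanSpace ℝ (Fin d)) (a : ℝ) :
    {ω | passageTime α (Q ω) (q ω) x y < a} =ᵐ[P] Q ⁻¹' passageEvent α x y a := by
  filter_upwards [hq, hQ.locallyFinite, hQ.ae_no_tie x, hQ.ae_no_tie y] with ω h1 h2 h3 h4
  exact propext ⟨mem_passageEvent_of_passageTime_lt hα h1 h2 h3 h4,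
    passageTime_lt_of_mem_passageEvent hα h1 h2⟩

lemma aemeasurable_passageTime (hα : 0 < α) (hQ : IsRateOnePoisson Q P)
    (hq : ∀ᵐ ω ∂P, IsNearestPointMap (Q ω) (q ω)) (x y : EuclideanSpace ℝ (Fin d)) :
    AEMeasurable (fun ω => passageTime α (Q ω) (q ω) x y) P := by
  have : NullMeasurable (fun ω => passageTime α (Q ω) (q ω) x y) P := by
    refine measurable_of_Iio (α := ℝ) (δ := NullMeasurableSpace Ω P) fun a => ?_
    exact ((hQ.countSpace_law hQ (measurableSet_passageEvent (α := α) x y a)).1).congr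
      (passageTime_lt_ae_eq hα hQ hq x y a).symm
  exact this.aemeasurable

lemma map_passageTime_eq (hα : 0 < α) (hQ : IsRateOnePoisson Q P)
    (hq : ∀ᵐ ω ∂P, IsNearestPointMap (Q ω) (q ω)) (hQ' : IsRateOnePoisson Q' P)
    (hq' : ∀ᵐ ω ∂P, IsNearestPointMap (Q' ω) (q' ω)) (x y : EuclideanSpace ℝ (Fin d)) :
    P.map (fun ω => passageTime α (Q ω) (q ω) x y)
      = P.map (fun ω => passageTime α (Q' ω) (q' ω) x y) := by
  have h1 := aemeasurable_passageTime hα hQ hq x y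
  have h2 := aemeasurable_passageTime hα hQ' hq' x y
  have := Measure.isProbabilityMeasure_map h1
  have := Measure.isProbabilityMeasure_map h2
  refine Measure.ext_of_Ici _ _ fun a => ?_
  rw [← Set.compl_Iio, prob_compl_eq_one_sub measurableSet_Iio,
    prob_compl_eq_one_sub measurableSet_Iio]
  congr 1
  rw [Measure.map_apply_of_aemeasurable h1 measurableSet_Iio,
    Measure.map_apply_of_aemeasurable h2 measurableSet_Iio]
  exact (measure_congr (passageTime_lt_ae_eq hα hQ hq x y a)).trans
    ((hQ.countSpace_law hQ' (measurableSet_passageEvent x y a)).2.2.trans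
      (measure_congr (passageTime_lt_ae_eq hα hQ' hq' x y a)).symm)

/-- The law of the passage time between two points depends only on their distance. -/
lemma identDistrib_passageTime (hα : 0 < α) (hQ : IsRateOnePoisson Q P)
    (hq : ∀ᵐ ω ∂P, IsNearestPointMap (Q ω) (q ω)) {x y x' y' : EuclideanSpace ℝ (Fin d)}
    (h : ‖x - y‖ = ‖x' - y'‖) :
    IdentDistrib (fun ω => passageTime α (Q ω) (q ω) x y)
      (fun ω => passageTime α (Q ω) (q ω) x' y') P P := by
  refine ⟨aemeasurable_passageTime hα hQ hq x y, aemeasurable_passageTime hα hQ hq x' y', ?_⟩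
  obtain ⟨φ, hφ, rfl, rfl⟩ := exists_isometry h
  simp only [← passageTime_preimage φ]
  exact map_passageTime_eq hα hQ hq (hQ.preimage φ hφ) (hq.mono fun ω h => h.preimage φ) x y

end Law

/-! ### Comparison of powers and stretched exponentials -/

section Asymptotics

lemma eventually_mul_rpow_le (C : ℝ) {a b : ℝ} (hab : a < b) :
    ∀ᶠ n : ℝ in atTop, C * n ^ a ≤ n ^ b := by
  have h := (tendsto_rpow_atTop (sub_pos.2 hab)).eventually_ge_atTop C
  filter_upwards [h, eventually_gt_atTop 0] with n hn hn0
  calc C * n ^ a ≤ n ^ (b - a) * n ^ a := by gcongr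
    _ = n ^ b := by rw [← Real.rpow_add hn0]; congr 1; ring

lemma eventually_poly_mul_exp_le (C K : ℝ) {c a b : ℝ} (hc : 0 < c) (hb : 0 < b) (hab : b < a) :
    ∀ᶠ n : ℝ in atTop, C * n ^ K * Real.exp (-c * n ^ a) ≤ Real.exp (-n ^ b) := by
  have h1 : ∀ᶠ n : ℝ in atTop, (2 / c) * n ^ b ≤ n ^ a := eventually_mul_rpow_le _ hab
  have h2 : Tendsto (fun x : ℝ => x ^ ((|K| + 1) / a) * Real.exp (-(c / 2) * x)) atTop (nhds 0) :=
    tendsto_rpow_mul_exp_neg_mul_atTop_nhds_zero _ _ (half_pos hc)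
  have h3 := h2.comp (tendsto_rpow_atTop (hb.trans hab))
  have h4 := h3.eventually (eventually_lt_nhds (show (0 : ℝ) < 1 by norm_num))
  filter_upwards [h1, h4, eventually_ge_atTop 1, eventually_ge_atTop C] with n hn1 hn4 hn hC
  have hn0 : (0 : ℝ) < n := by linarith
  have ha : 0 < a := hb.trans hab
  simp only [Function.comp] at hn4
  rw [← Real.rpow_mul hn0.le, mul_div_cancel₀ _ ha.ne'] at hn4
  have h5 : C * n ^ K ≤ n ^ (|K| + 1) := by
    rw [Real.rpow_add hn0, Real.rpow_one, mul_comm (n ^ |K|)]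
    have := Real.rpow_le_rpow_of_exponent_le hn (le_abs_self K)
    gcongr
  calc C * n ^ K * Real.exp (-c * n ^ a) ≤ n ^ (|K| + 1) * Real.exp (-c * n ^ a) := by gcongr
    _ = (n ^ (|K| + 1) * Real.exp (-(c / 2) * n ^ a)) * Real.exp (-(c / 2) * n ^ a) := by
        rw [mul_assoc, ← Real.exp_add]; congr 2; ring
    _ ≤ 1 * Real.exp (-(c / 2) * n ^ a) := by gcongr
    _ ≤ Real.exp (-n ^ b) := by
        rw [one_mul]
        apply Real.exp_le_exp.2
        have : (c / 2) * ((2 / c) * n ^ b) ≤ (c / 2) * n ^ a := by gcongr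
        rw [← mul_assoc, div_mul_div_comm, mul_comm c 2, div_self (by positivity), one_mul] at this
        linarith

end Asymptotics

/-! ### Grids, and the decomposition along the first axis -/

section Coordinates

variable {d : ℕ}

lemma norm_le_of_forall_abs_le {x : EuclideanSpace ℝ (Fin d)} {δ : ℝ} (h : ∀ i, |x i| ≤ δ) :
    ‖x‖ ≤ d * δ := by
  rcases Nat.eq_zero_or_pos d with rfl | hd
  · simp [EuclideanSpace.norm_eq]
  have hδ : 0 ≤ δ := (abs_nonneg _).trans (h ⟨0, hd⟩)
  have hd1 : (1 : ℝ) ≤ d := by exact_mod_cast hd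
  rw [EuclideanSpace.norm_eq]
  refine Real.sqrt_le_iff.2 ⟨by positivity, ?_⟩
  calc ∑ i, ‖x i‖ ^ 2 ≤ ∑ _i : Fin d, δ ^ 2 := Finset.sum_le_sum fun i _ => by
        rw [Real.norm_eq_abs]
        exact pow_le_pow_left₀ (abs_nonneg _) (h i) 2
    _ = d * δ ^ 2 := by simp
    _ ≤ (d * δ) ^ 2 := by nlinarith [sq_nonneg δ, mul_nonneg (sub_nonneg.2 hd1) (sq_nonneg δ)]

lemma abs_apply_le_norm (x : EuclideanSpace ℝ (Fin d)) (i : Fin d) : |x i| ≤ ‖x‖ := by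
  rw [← Real.norm_eq_abs]
  exact PiLp.norm_apply_le x i

/-- The points of a rectangular grid. -/
noncomputable def gridPoint (u : EuclideanSpace ℝ (Fin d)) (τ : Fin d → ℝ) (k : Fin d → ℤ) :
    EuclideanSpace ℝ (Fin d) := WithLp.toLp 2 fun i => u i + τ i * k i

lemma gridPoint_apply (u : EuclideanSpace ℝ (Fin d)) (τ : Fin d → ℝ) (k : Fin d → ℤ) (i : Fin d) :
    gridPoint u τ k i = u i + τ i * k i := rfl

/-- The index set of a finite grid. -/
noncomputable def gridBox (d : ℕ) (R : ℕ) : Finset (Fin d → ℤ) :=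
  Fintype.piFinset fun _ => Finset.Icc (-(R : ℤ)) R

lemma mem_gridBox {R : ℕ} {k : Fin d → ℤ} : k ∈ gridBox d R ↔ ∀ i, |k i| ≤ R := by
  simp only [gridBox, Fintype.mem_piFinset, Finset.mem_Icc, abs_le]

lemma card_gridBox (R : ℕ) : (gridBox d R).card = (2 * R + 1) ^ d := by
  simp only [gridBox, Fintype.card_piFinset_const, Int.card_Icc]
  congr 1
  omega

lemma exists_gridPoint (u x : EuclideanSpace ℝ (Fin d)) {τ : Fin d → ℝ} (hτ : ∀ i, 0 < τ i) :
    ∃ k : Fin d → ℤ, (∀ i, |x i - gridPoint u τ k i| ≤ τ i / 2) ∧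
      ∀ i, |(k i : ℝ)| ≤ |x i - u i| / τ i + 1 / 2 := by
  refine ⟨fun i => round ((x i - u i) / τ i), fun i => ?_, fun i => ?_⟩
  · have h := abs_sub_round ((x i - u i) / τ i)
    rw [gridPoint_apply]
    have : x i - (u i + τ i * (round ((x i - u i) / τ i) : ℝ))
        = τ i * ((x i - u i) / τ i - round ((x i - u i) / τ i)) := by
      have := (hτ i).ne'
      field_simp
      ring
    rw [this, abs_mul, abs_of_pos (hτ i)]
    nlinarith [hτ i]
  · have h := abs_sub_round ((x i - u i) / τ i)
    have habs : |x i - u i| / τ i = |(x i - u i) / τ i| := by rw [abs_div, abs_of_pos (hτ i)]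
    rw [habs]
    have := abs_sub_abs_le_abs_sub ((round ((x i - u i) / τ i) : ℤ) : ℝ) ((x i - u i) / τ i)
    rw [abs_sub_comm] at this
    linarith

/-- The unit grid around `a` is `d`-dense. -/
lemma exists_unitGrid (a : EuclideanSpace ℝ (Fin d)) {R : ℝ}
    {x : EuclideanSpace ℝ (Fin d)} (hx : ‖x - a‖ ≤ R) :
    ∃ k ∈ gridBox d (⌈R⌉₊ + 1), ‖x - gridPoint a (fun _ => 1) k‖ ≤ d := by
  obtain ⟨k, h1, h2⟩ := exists_gridPoint a x (τ := fun _ => 1) fun _ => one_pos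
  refine ⟨k, mem_gridBox.2 fun i => ?_, ?_⟩
  · have h3 := h2 i
    have h4 := abs_apply_le_norm (x - a) i
    rw [PiLp.sub_apply] at h4
    have h5 : |(k i : ℝ)| ≤ (⌈R⌉₊ + 1 : ℕ) := by
      push_cast
      have := Nat.le_ceil R
      linarith
    exact_mod_cast h5
  · have := norm_le_of_forall_abs_le (x := x - gridPoint a (fun _ => 1) k) (δ := 1)
      fun i => by
        have := h1 i
        rw [PiLp.sub_apply]
        linarith
    simpa using this

variable [NeZero d]

/-- The distance to the first coordinate axis. -/
noncomputable def perp (x : EuclideanSpace ℝ (Fin d)) : ℝ := ‖x - axisPoint d (x 0)‖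

lemma axisPoint_apply_zero (s : ℝ) : axisPoint d s 0 = s := by simp [axisPoint]

lemma axisPoint_apply_ne {i : Fin d} (hi : i ≠ 0) (s : ℝ) : axisPoint d s i = 0 := by
  simp [axisPoint, hi]

lemma axisPoint_zero : axisPoint d 0 = 0 := by simp [axisPoint]

lemma axisPoint_add (s t : ℝ) : axisPoint d (s + t) = axisPoint d s + axisPoint d t := by
  ext i
  by_cases hi : i = 0
  · subst hi; simp [axisPoint_apply_zero]
  · simp [axisPoint_apply_ne hi]

lemma axisPoint_sub (s t : ℝ) : axisPoint d (s - t) = axisPoint d s - axisPoint d t := by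
  rw [eq_sub_iff_add_eq, ← axisPoint_add, sub_add_cancel]

lemma norm_axisPoint (s : ℝ) : ‖axisPoint d s‖ = |s| := by simp [axisPoint]

lemma perp_nonneg (x : EuclideanSpace ℝ (Fin d)) : 0 ≤ perp x := norm_nonneg _

lemma perp_add_le (x y : EuclideanSpace ℝ (Fin d)) : perp (x + y) ≤ perp x + perp y := by
  unfold perp
  rw [PiLp.add_apply, axisPoint_add, add_sub_add_comm]
  exact norm_add_le _ _

lemma perp_sub_le (x y : EuclideanSpace ℝ (Fin d)) : perp (x - y) ≤ perp x + perp y := by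
  unfold perp
  rw [PiLp.sub_apply, axisPoint_sub, sub_sub_sub_comm]
  exact norm_sub_le _ _

lemma perp_neg (x : EuclideanSpace ℝ (Fin d)) : perp (-x) = perp x := by
  have h1 := perp_sub_le (0 : EuclideanSpace ℝ (Fin d)) x
  have h2 := perp_sub_le (0 : EuclideanSpace ℝ (Fin d)) (-x)
  have h0 : perp (0 : EuclideanSpace ℝ (Fin d)) = 0 := by simp [perp, axisPoint_zero]
  rw [zero_sub, h0] at h1 h2
  rw [neg_neg] at h2
  linarith

lemma perp_axisPoint (s : ℝ) : perp (axisPoint d s) = 0 := by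
  simp [perp, axisPoint_apply_zero]

lemma norm_sq_eq (x : EuclideanSpace ℝ (Fin d)) : ‖x‖ ^ 2 = x 0 ^ 2 + perp x ^ 2 := by
  unfold perp
  rw [EuclideanSpace.norm_sq_eq, EuclideanSpace.norm_sq_eq,
    ← Finset.add_sum_erase _ _ (Finset.mem_univ (0 : Fin d)),
    ← Finset.add_sum_erase Finset.univ (fun i => ‖(x - axisPoint d (x 0)) i‖ ^ 2)
      (Finset.mem_univ (0 : Fin d))]
  have : ∀ i ∈ Finset.univ.erase (0 : Fin d), ‖x i‖ ^ 2 = ‖(x - axisPoint d (x 0)) i‖ ^ 2 := by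
    intro i hi
    rw [PiLp.sub_apply, axisPoint_apply_ne (Finset.ne_of_mem_erase hi), sub_zero]
  rw [Finset.sum_congr rfl this]
  simp [axisPoint_apply_zero]

lemma abs_apply_le_perp (x : EuclideanSpace ℝ (Fin d)) {i : Fin d} (hi : i ≠ 0) :
    |x i| ≤ perp x := by
  have := abs_apply_le_norm (x - axisPoint d (x 0)) i
  rwa [PiLp.sub_apply, axisPoint_apply_ne hi, sub_zero] at this

lemma perp_le_of_forall_abs_le {x : EuclideanSpace ℝ (Fin d)} {δ : ℝ} (hδ : 0 ≤ δ)
    (h : ∀ i, i ≠ 0 → |x i| ≤ δ) : perp x ≤ d * δ := by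
  refine norm_le_of_forall_abs_le fun i => ?_
  by_cases hi : i = 0
  · subst hi; simpa [axisPoint_apply_zero] using hδ
  · rw [PiLp.sub_apply, axisPoint_apply_ne hi, sub_zero]
    exact h i hi

lemma norm_le_abs_add_perp (x : EuclideanSpace ℝ (Fin d)) : ‖x‖ ≤ |x 0| + perp x := by
  have h := norm_add_le (axisPoint d (x 0)) (x - axisPoint d (x 0))
  rw [add_sub_cancel, norm_axisPoint] at h
  exact h

/-- A point at a small angle to the axis is hardly further away than its first coordinate. -/
lemma norm_sub_apply_zero_le {x : EuclideanSpace ℝ (Fin d)} (hx : 0 < x 0) :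
    ‖x‖ - x 0 ≤ perp x ^ 2 / (2 * x 0) := by
  rw [le_div_iff₀ (by positivity)]
  nlinarith [norm_sq_eq x, sq_nonneg (‖x‖ - x 0)]

end Coordinates

/-! ### Holes, integrability and almost linear passage times -/

section Holes

variable {d : ℕ} [NeZero d] {α : ℝ} {Ω : Type*} [MeasurableSpace Ω] {P : Measure Ω}
  {Q : Ω → Set (EuclideanSpace ℝ (Fin d))}
  {q : Ω → EuclideanSpace ℝ (Fin d) → EuclideanSpace ℝ (Fin d)}

/-- The volume of the unit ball. -/
noncomputable def unitVolume (d : ℕ) : ℝ :=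
  (volume (Metric.ball (0 : EuclideanSpace ℝ (Fin d)) 1)).toReal

lemma unitVolume_pos : 0 < unitVolume d :=
  ENNReal.toReal_pos (Metric.measure_ball_pos _ _ one_pos).ne' measure_ball_lt_top.ne

lemma IsRateOnePoisson.prob_void_ball (hQ : IsRateOnePoisson Q P) (x : EuclideanSpace ℝ (Fin d))
    {s : ℝ} (hs : 0 ≤ s) :
    P.real {ω | (Q ω ∩ Metric.closedBall x s).ncard = 0} = Real.exp (-(unitVolume d * s ^ d)) := by
  rw [hQ.prob_void measurableSet_closedBall Metric.isBounded_closedBall,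
    Measure.addHaar_closedBall _ _ hs, finrank_euclideanSpace_fin, ENNReal.toReal_mul,
    ENNReal.toReal_ofReal (by positivity), mul_comm]
  rfl

lemma IsNearestPointMap.ncard_eq_zero {S : Set (EuclideanSpace ℝ (Fin d))}
    {q : EuclideanSpace ℝ (Fin d) → EuclideanSpace ℝ (Fin d)} (hq : IsNearestPointMap S q)
    {x : EuclideanSpace ℝ (Fin d)} {s : ℝ} (hs : s < ‖x - q x‖) :
    (S ∩ Metric.closedBall x s).ncard = 0 := by
  have : S ∩ Metric.closedBall x s = ∅ := by
    ext p
    simp only [Set.mem_inter_iff, Metric.mem_closedBall, Set.mem_empty_iff_false, iff_false, not_and,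
      not_le]
    intro hp
    rw [dist_eq_norm, norm_sub_rev]
    exact hs.trans_le ((hq x).2 p hp)
  rw [this, Set.ncard_empty]

/-- The distance from `x` to `q x` is rounded up to an integer `j`. A positive `j` certifies an
empty ball of radius `j - 1`, an event with explicit probability. -/
lemma passageTime_le_rpow_of_void (hα : 0 ≤ α) {S : Set (EuclideanSpace ℝ (Fin d))}
    {q : EuclideanSpace ℝ (Fin d) → EuclideanSpace ℝ (Fin d)} (hq : IsNearestPointMap S q)
    {D : ℝ} {x y : EuclideanSpace ℝ (Fin d)} (hD : ‖x - y‖ ≤ D) :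
    ∃ j : ℕ, passageTime α S q x y ≤ (2 * D + 2 * j) ^ α ∧
      (j = 0 ∨ ∃ i : ℕ, j = i + 1 ∧ (S ∩ Metric.closedBall x i).ncard = 0) := by
  have hD0 : 0 ≤ D := (norm_nonneg _).trans hD
  refine ⟨⌈‖x - q x‖⌉₊, (passageTime_le_rpow hα hq x y).trans (Real.rpow_le_rpow (by positivity)
    (by have := Nat.le_ceil ‖x - q x‖; linarith) hα), ?_⟩
  rcases Nat.eq_zero_or_pos ⌈‖x - q x‖⌉₊ with h | h
  · exact Or.inl h
  · refine Or.inr ⟨⌈‖x - q x‖⌉₊ - 1, by omega, hq.ncard_eq_zero ?_⟩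
    exact Nat.lt_ceil.1 (by omega)

lemma summable_rpow_mul_exp (D : ℝ) (hD : 0 ≤ D) (hα : 0 ≤ α) {v : ℝ} (hv : 0 < v) :
    Summable fun i : ℕ => (2 * D + 2 * (i + 1 : ℕ)) ^ α * Real.exp (-(v * (i : ℝ) ^ d)) := by
  obtain ⟨N, hN⟩ := exists_nat_ge α
  have h1 := (Real.summable_pow_mul_exp_neg_nat_mul N hv)
  have h2 := ((summable_nat_add_iff 1).2 h1).mul_left ((2 * D + 2) ^ α * Real.exp v)
  refine Summable.of_nonneg_of_le (fun i => by positivity) (fun i => ?_) h2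
  have h3 : (2 * D + 2 * ((i + 1 : ℕ) : ℝ)) ^ α ≤ (2 * D + 2) ^ α * ((i + 1 : ℕ) : ℝ) ^ N := by
    have hi : (1 : ℝ) ≤ ((i + 1 : ℕ) : ℝ) := by push_cast; linarith [Nat.cast_nonneg (α := ℝ) i]
    calc (2 * D + 2 * ((i + 1 : ℕ) : ℝ)) ^ α ≤ ((2 * D + 2) * ((i + 1 : ℕ) : ℝ)) ^ α :=
          Real.rpow_le_rpow (by positivity) (by nlinarith) hα
      _ = (2 * D + 2) ^ α * ((i + 1 : ℕ) : ℝ) ^ α := Real.mul_rpow (by positivity) (by positivity)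
      _ ≤ _ := by
          gcongr
          rw [← Real.rpow_natCast]
          exact Real.rpow_le_rpow_of_exponent_le hi hN
  have h4 : Real.exp (-(v * (i : ℝ) ^ d)) ≤ Real.exp v * Real.exp (-v * ((i + 1 : ℕ) : ℝ)) := by
    rw [← Real.exp_add]
    apply Real.exp_le_exp.2
    have : (i : ℝ) ≤ (i : ℝ) ^ d := by
      rcases Nat.eq_zero_or_pos i with rfl | hi
      · simp
      · exact le_self_pow₀ (by exact_mod_cast hi) (NeZero.ne d)
    push_cast
    nlinarith
  calc _ ≤ ((2 * D + 2) ^ α * ((i + 1 : ℕ) : ℝ) ^ N)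
        * (Real.exp v * Real.exp (-v * ((i + 1 : ℕ) : ℝ))) := by gcongr
    _ = _ := by ring

/-- The passage times between points at bounded distance are uniformly integrable. -/
lemma integrable_passageTime [IsProbabilityMeasure P] (hα : 0 < α) (hQ : IsRateOnePoisson Q P)
    (hq : ∀ᵐ ω ∂P, IsNearestPointMap (Q ω) (q ω)) {D : ℝ} (hD : 0 ≤ D) :
    ∃ A : ℝ, ∀ x y : EuclideanSpace ℝ (Fin d), ‖x - y‖ ≤ D →
      Integrable (fun ω => passageTime α (Q ω) (q ω) x y) P ∧
        ∫ ω, passageTime α (Q ω) (q ω) x y ∂P ≤ A := by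
  have hs := summable_rpow_mul_exp (d := d) D hD hα.le (unitVolume_pos (d := d))
  refine ⟨(2 * D) ^ α + ∑' i : ℕ, (2 * D + 2 * (i + 1 : ℕ)) ^ α
    * Real.exp (-(unitVolume d * (i : ℝ) ^ d)), fun x y hxy => ?_⟩
  have hmeas := aemeasurable_passageTime hα hQ hq x y
  have hV : ∀ i : ℕ, NullMeasurableSet {ω | (Q ω ∩ Metric.closedBall x i).ncard = 0} P := fun i =>
    (hQ.aemeasurable_count measurableSet_closedBall
      Metric.isBounded_closedBall).nullMeasurableSet_preimage (s := {0}) (measurableSet_singleton 0)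
  have hle : ∫⁻ ω, ENNReal.ofReal (passageTime α (Q ω) (q ω) x y) ∂P
      ≤ ENNReal.ofReal ((2 * D) ^ α + ∑' i : ℕ, (2 * D + 2 * (i + 1 : ℕ)) ^ α
        * Real.exp (-(unitVolume d * (i : ℝ) ^ d))) := by
    calc ∫⁻ ω, ENNReal.ofReal (passageTime α (Q ω) (q ω) x y) ∂P
        ≤ ∫⁻ ω, (ENNReal.ofReal ((2 * D) ^ α) + ∑' i : ℕ,
          {ω | (Q ω ∩ Metric.closedBall x i).ncard = 0}.indicator
            (fun _ => ENNReal.ofReal ((2 * D + 2 * (i + 1 : ℕ)) ^ α)) ω) ∂P := by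
          refine lintegral_mono_ae ?_
          filter_upwards [hq] with ω hω
          obtain ⟨j, hj, rfl | ⟨i, rfl, hi⟩⟩ := passageTime_le_rpow_of_void hα.le hω hxy
          · simp only [Nat.cast_zero, mul_zero, add_zero] at hj
            exact (ENNReal.ofReal_le_ofReal hj).trans le_self_add
          · refine (ENNReal.ofReal_le_ofReal hj).trans (le_trans ?_ le_add_self)
            refine le_trans ?_ (ENNReal.le_tsum i)
            have hi' : ω ∈ {ω | (Q ω ∩ Metric.closedBall x i).ncard = 0} := hi
            rw [Set.indicator_of_mem hi']
      _ = ENNReal.ofReal ((2 * D) ^ α) + ∑' i : ℕ, ENNReal.ofReal ((2 * D + 2 * (i + 1 : ℕ)) ^ α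
            * Real.exp (-(unitVolume d * (i : ℝ) ^ d))) := by
          rw [lintegral_add_left measurable_const, lintegral_const, measure_univ, mul_one,
            lintegral_tsum fun i => aemeasurable_const.indicator₀ (hV i)]
          congr 1
          refine tsum_congr fun i => ?_
          rw [lintegral_indicator_const₀ (hV i), ENNReal.ofReal_mul (by positivity),
            ← hQ.prob_void_ball x (Nat.cast_nonneg i), ofReal_measureReal]
      _ = _ := by
          rw [← ENNReal.ofReal_tsum_of_nonneg (fun i => by positivity) hs,
            ← ENNReal.ofReal_add (by positivity) (tsum_nonneg fun i => by positivity)]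
  have hnn : 0 ≤ᵐ[P] fun ω => passageTime α (Q ω) (q ω) x y :=
    Eventually.of_forall fun ω => passageTime_nonneg _ _
  refine ⟨⟨hmeas.aestronglyMeasurable, ?_⟩, ?_⟩
  · rw [hasFiniteIntegral_iff_ofReal hnn]
    exact hle.trans_lt ENNReal.ofReal_lt_top
  · rw [integral_eq_lintegral_of_nonneg_ae hnn hmeas.aestronglyMeasurable]
    refine ENNReal.toReal_le_of_le_ofReal ?_ hle
    exact add_nonneg (by positivity) (tsum_nonneg fun i => by positivity)

/-- Large holes near `a` are unlikely. -/
lemma prob_hole_le [IsProbabilityMeasure P] (hQ : IsRateOnePoisson Q P)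
    (hq : ∀ᵐ ω ∂P, IsNearestPointMap (Q ω) (q ω)) (a : EuclideanSpace ℝ (Fin d)) {R s : ℝ}
    (hs : 0 ≤ s) :
    P.real {ω | ∃ x, ‖x - a‖ ≤ R ∧ s + d < ‖x - q ω x‖}
      ≤ (2 * (⌈R⌉₊ + 1 : ℕ) + 1) ^ d * Real.exp (-(unitVolume d * s ^ d)) := by
  have hsub : ∀ᵐ ω ∂P, ω ∈ {ω | ∃ x, ‖x - a‖ ≤ R ∧ s + d < ‖x - q ω x‖} →
      ω ∈ ⋃ k ∈ gridBox d (⌈R⌉₊ + 1),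
        {ω | (Q ω ∩ Metric.closedBall (gridPoint a (fun _ => 1) k) s).ncard = 0} := by
    filter_upwards [hq] with ω hω
    rintro ⟨x, hx, hxs⟩
    obtain ⟨k, hk, hxk⟩ := exists_unitGrid a hx
    refine Set.mem_biUnion (Finset.mem_coe.2 hk) (hω.ncard_eq_zero ?_)
    set w := gridPoint a (fun _ => 1) k
    have h1 := (hω x).2 _ (hω w).1
    have h2 : ‖x - q ω w‖ ≤ ‖x - w‖ + ‖w - q ω w‖ := by
      calc ‖x - q ω w‖ = ‖(x - w) + (w - q ω w)‖ := by congr 1; abel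
        _ ≤ _ := norm_add_le _ _
    linarith
  have h1 : P.real {ω | ∃ x, ‖x - a‖ ≤ R ∧ s + d < ‖x - q ω x‖}
      ≤ P.real (⋃ k ∈ gridBox d (⌈R⌉₊ + 1),
        {ω | (Q ω ∩ Metric.closedBall (gridPoint a (fun _ => 1) k) s).ncard = 0}) :=
    ENNReal.toReal_mono (measure_ne_top _ _) (measure_mono_ae hsub)
  refine h1.trans ((measureReal_biUnion_finset_le _ _).trans ?_)
  rw [Finset.sum_congr rfl fun k _ => hQ.prob_void_ball (gridPoint a (fun _ => 1) k) hs,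
    Finset.sum_const, card_gridBox, nsmul_eq_mul]
  push_cast
  exact le_rfl

/-- A ball of radius `n²` is covered by polynomially many unit-grid points, each with a void of
radius `n^(σ/2)` around it only with stretched exponentially small probability. Lowering the
exponent to `σ/4` absorbs the number of points and the constants. -/
lemma prob_hole_eventually_le [IsProbabilityMeasure P] (hQ : IsRateOnePoisson Q P)
    (hq : ∀ᵐ ω ∂P, IsNearestPointMap (Q ω) (q ω)) {σ : ℝ} (hσ : 0 < σ) :
    ∀ᶠ n : ℝ in atTop, ∀ a : EuclideanSpace ℝ (Fin d),
      P.real {ω | ∃ x, ‖x - a‖ ≤ n ^ (2 : ℝ) ∧ n ^ σ < ‖x - q ω x‖} ≤ Real.exp (-n ^ (σ / 4)) := by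
  have h1 := eventually_poly_mul_exp_le (7 ^ d) (2 * d) (c := unitVolume d) (a := σ / 2) (b := σ / 4)
    unitVolume_pos (by positivity) (by linarith)
  have h2 := eventually_mul_rpow_le (1 + d) (a := σ / 2) (b := σ) (by linarith)
  filter_upwards [h1, h2, eventually_ge_atTop 1] with n hn1 hn2 hn a
  have hn0 : (0 : ℝ) < n := by linarith
  have hpow : (1 : ℝ) ≤ n ^ (σ / 2) := Real.one_le_rpow hn (by positivity)
  have hsub : {ω | ∃ x, ‖x - a‖ ≤ n ^ (2 : ℝ) ∧ n ^ σ < ‖x - q ω x‖}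
      ⊆ {ω | ∃ x, ‖x - a‖ ≤ n ^ (2 : ℝ) ∧ n ^ (σ / 2) + d < ‖x - q ω x‖} := by
    rintro ω ⟨x, hx, hx'⟩
    exact ⟨x, hx, lt_of_le_of_lt (by nlinarith [Nat.cast_nonneg (α := ℝ) d]) hx'⟩
  refine (measureReal_mono hsub (measure_ne_top _ _)).trans
    ((prob_hole_le hQ hq a (by positivity)).trans (le_trans ?_ hn1))
  gcongr
  · have h3 : ((⌈n ^ (2 : ℝ)⌉₊ + 1 : ℕ) : ℝ) ≤ n ^ (2 : ℝ) + 2 := by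
      push_cast
      have := Nat.ceil_lt_add_one (a := n ^ (2 : ℝ)) (by positivity)
      linarith
    have h4 : (1 : ℝ) ≤ n ^ (2 : ℝ) := Real.one_le_rpow hn (by norm_num)
    calc (2 * ((⌈n ^ (2 : ℝ)⌉₊ + 1 : ℕ) : ℝ) + 1) ^ d ≤ (7 * n ^ (2 : ℝ)) ^ d := by
          gcongr
          linarith
      _ = 7 ^ d * n ^ (2 * d : ℝ) := by
          rw [mul_pow, ← Real.rpow_natCast (n ^ (2 : ℝ)), ← Real.rpow_mul hn0.le]
  · rw [← neg_mul]
    have := le_self_pow₀ hpow (NeZero.ne d)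
    nlinarith [unitVolume_pos (d := d)]

/-- If there are no holes of radius `n ^ s` in a ball, the passage times in this ball are
almost linear. -/
lemma passageTime_le_of_no_hole (hα : 1 < α) {σ : ℝ} (hσ : 0 < σ) :
    ∀ᶠ n : ℝ in atTop, ∀ (a : EuclideanSpace ℝ (Fin d)) (S : Set (EuclideanSpace ℝ (Fin d)))
      (q : EuclideanSpace ℝ (Fin d) → EuclideanSpace ℝ (Fin d)), IsNearestPointMap S q →
      (∀ x, ‖x - a‖ ≤ n ^ (2 : ℝ) → ‖x - q x‖ ≤ n ^ (σ / (2 * α))) →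
      ∀ x y, ‖x - a‖ ≤ n ^ (2 : ℝ) → ‖y - a‖ ≤ n ^ (2 : ℝ) →
        passageTime α S q x y ≤ n ^ σ * (‖x - y‖ + 1) := by
  filter_upwards [eventually_ge_atTop 1, eventually_mul_rpow_le (3 ^ α) (show σ / 2 < σ by linarith)]
    with n hn hn2 a S q hq h x y hx hy
  have hn0 : (0 : ℝ) < n := by linarith
  have hα0 : 0 < α := by linarith
  have hε : 1 ≤ n ^ (σ / (2 * α)) := Real.one_le_rpow hn (by positivity)
  have hseg : ∀ z ∈ segment ℝ x y, ‖z - q z‖ ≤ n ^ (σ / (2 * α)) := by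
    intro z hz
    refine h z ?_
    have := (convex_closedBall a (n ^ (2 : ℝ))).segment_subset (by simpa [dist_eq_norm] using hx)
      (by simpa [dist_eq_norm] using hy) hz
    simpa [dist_eq_norm] using this
  refine (passageTime_le_of_dense hα0.le hq (by linarith) hseg).trans ?_
  -- The hole size `n^(σ/(2α))` is chosen so that a step costs `3^α n^(σ/2)`, which leaves `n^(σ/2)`
  -- to absorb the constant.
  have h1 : (3 * n ^ (σ / (2 * α))) ^ α ≤ n ^ σ := by
    rw [Real.mul_rpow (by norm_num) (by positivity), ← Real.rpow_mul hn0.le]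
    convert hn2 using 3
    field_simp
  have h2 : ‖x - y‖ / n ^ (σ / (2 * α)) ≤ ‖x - y‖ := div_le_self (norm_nonneg _) hε
  calc _ ≤ (‖x - y‖ + 1) * n ^ σ := by gcongr
    _ = _ := mul_comm _ _

lemma prob_not_linear_le [IsProbabilityMeasure P] (hα : 1 < α) (hQ : IsRateOnePoisson Q P)
    (hq : ∀ᵐ ω ∂P, IsNearestPointMap (Q ω) (q ω)) {σ : ℝ} (hσ : 0 < σ) :
    ∃ σ' : ℝ, 0 < σ' ∧ ∀ᶠ n : ℝ in atTop, ∀ a : EuclideanSpace ℝ (Fin d),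
      P.real {ω | ∃ x y, ‖x - a‖ ≤ n ^ (2 : ℝ) ∧ ‖y - a‖ ≤ n ^ (2 : ℝ) ∧
        n ^ σ * (‖x - y‖ + 1) < passageTime α (Q ω) (q ω) x y} ≤ Real.exp (-n ^ σ') := by
  have hpos : 0 < σ / (2 * α) := by positivity
  refine ⟨σ / (2 * α) / 4, by positivity, ?_⟩
  filter_upwards [passageTime_le_of_no_hole (d := d) hα hσ, prob_hole_eventually_le hQ hq hpos]
    with n h1 h2 a
  refine le_trans (ENNReal.toReal_mono (measure_ne_top _ _) (measure_mono_ae ?_)) (h2 a)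
  filter_upwards [hq] with ω hω
  rintro ⟨x, y, hx, hy, hxy⟩
  by_contra hno
  refine absurd (h1 a (Q ω) (q ω) hω (fun z hz => ?_) x y hx hy) (not_le.2 hxy)
  by_contra hz'
  exact hno ⟨z, hz, not_le.1 hz'⟩

/-- A superlinear step cost beats an almost linear one, up to a small error. -/
lemma step_cost_le (hα : 1 < α) {r l σ σ₂ : ℝ} (hr1 : 1 ≤ r) (hl0 : 0 ≤ l) (hσ : 0 < σ)
    (hσ₂0 : 0 < σ₂) (hσ₂σ : σ₂ * (1 + 1 / (α - 1)) ≤ σ / 2) (h4 : 4 * r ^ (σ / 2) ≤ r ^ σ) :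
    r ^ σ₂ * (l + 2) ≤ l ^ α + (r ^ σ - 1) := by
  have hα0 : 0 < α - 1 := by linarith
  have hr0 : 0 < r := by linarith
  have hone : 1 ≤ r ^ (σ / 2) := Real.one_le_rpow hr1 (by positivity)
  have hσle : r ^ σ₂ ≤ r ^ (σ / 2) := by
    refine Real.rpow_le_rpow_of_exponent_le hr1 (le_trans ?_ hσ₂σ)
    have : 0 < 1 / (α - 1) := by positivity
    nlinarith
  -- For a long step the power `l^α` dominates `r^σ₂ l`. A short step has `l ≤ r^(σ₂/(α-1))`, and
  -- the choice of `σ₂` makes `r^σ₂ l` at most `r^(σ/2)`.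
  rcases le_total (r ^ σ₂) (l ^ (α - 1)) with h | h
  · have hl1 : 0 < l := by
      rcases hl0.lt_or_eq with h' | h'
      · exact h'
      · rw [← h', Real.zero_rpow hα0.ne'] at h
        linarith [Real.rpow_pos_of_pos hr0 σ₂]
    have : r ^ σ₂ * l ≤ l ^ α := by
      calc r ^ σ₂ * l ≤ l ^ (α - 1) * l := by gcongr
        _ = l ^ α := by rw [← Real.rpow_add_one hl1.ne']; congr 1; ring
    nlinarith
  · have hl2 : l ≤ r ^ (σ₂ / (α - 1)) := by
      rw [Real.le_rpow_inv_iff_of_pos hl0 (by positivity) hα0 |>.symm, ← Real.rpow_mul hr0.le] at h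
      exact h
    have h6 : r ^ σ₂ * l ≤ r ^ (σ / 2) := by
      calc r ^ σ₂ * l ≤ r ^ σ₂ * r ^ (σ₂ / (α - 1)) := by gcongr
        _ = r ^ (σ₂ * (1 + 1 / (α - 1))) := by rw [← Real.rpow_add hr0]; congr 1; ring
        _ ≤ _ := Real.rpow_le_rpow_of_exponent_le hr1 hσ₂σ
    have : 0 ≤ l ^ α := Real.rpow_nonneg hl0 _
    nlinarith

/-- With high probability, paths to a point on the other side of a hyperplane can be made to pass
through a point of the hyperplane, or of a large sphere, at a small cost. -/
lemma prob_not_crossing_le [IsProbabilityMeasure P] (hα : 1 < α) (hQ : IsRateOnePoisson Q P)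
    (hq : ∀ᵐ ω ∂P, IsNearestPointMap (Q ω) (q ω)) {K σ : ℝ} (hK : 3 ≤ K) (hσ : 0 < σ) :
    ∀ᶠ r : ℝ in atTop,
      P.real {ω | passageTime α (Q ω) (q ω) 0 (axisPoint d (2 * r)) ≤ K * r ∧
        ¬ ∃ z : EuclideanSpace ℝ (Fin d), ((z 0 = r ∧ ‖z‖ ≤ K * r) ∨ ‖z‖ = K * r) ∧
          passageTime α (Q ω) (q ω) 0 z + passageTime α (Q ω) (q ω) z (axisPoint d (2 * r))
            ≤ passageTime α (Q ω) (q ω) 0 (axisPoint d (2 * r)) + r ^ σ} ≤ 1 / 16 := by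
  have hα0 : 0 < α - 1 := by linarith
  set σ₂ := min (σ / (2 * (1 + 1 / (α - 1)))) 1 with hσ₂
  have hσ₂0 : 0 < σ₂ := lt_min (by positivity) one_pos
  have hσ₂1 : σ₂ ≤ 1 := min_le_right _ _
  have hσ₂σ : σ₂ * (1 + 1 / (α - 1)) ≤ σ / 2 := by
    have h : σ₂ ≤ σ / (2 * (1 + 1 / (α - 1))) := min_le_left _ _
    have hp : 0 < 1 + 1 / (α - 1) := by positivity
    calc σ₂ * (1 + 1 / (α - 1)) ≤ σ / (2 * (1 + 1 / (α - 1))) * (1 + 1 / (α - 1)) := by gcongr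
      _ = σ / 2 := by field_simp
  have hpos : 0 < σ₂ / (2 * α) := by positivity
  have hlt1 : σ₂ / (2 * α) < 1 := by rw [div_lt_one (by positivity)]; linarith
  have hsmall : ∀ᶠ r : ℝ in atTop, Real.exp (-r ^ (σ₂ / (2 * α) / 4)) ≤ 1 / 16 := by
    have := Real.tendsto_exp_neg_atTop_nhds_zero.comp
      (tendsto_rpow_atTop (show 0 < σ₂ / (2 * α) / 4 by positivity))
    exact this.eventually (eventually_le_nhds (by norm_num))
  filter_upwards [passageTime_le_of_no_hole (d := d) hα hσ₂0, prob_hole_eventually_le hQ hq hpos, hsmall,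
    eventually_ge_atTop (4 * K), eventually_mul_rpow_le 4 (show σ / 2 < σ by linarith),
    eventually_mul_rpow_le 2 hlt1] with r h1 h2 h3 hr h4 h5
  have hr1 : 1 ≤ r := by linarith
  have hr0 : 0 < r := by linarith
  rw [Real.rpow_one] at h5
  refine le_trans (ENNReal.toReal_mono (measure_ne_top _ _) (measure_mono_ae ?_)) ((h2 0).trans h3)
  filter_upwards [hq] with ω hω
  rintro ⟨hT, hno⟩
  by_contra hhole
  have hR : ∀ x : EuclideanSpace ℝ (Fin d), ‖x - 0‖ ≤ r ^ (2 : ℝ) → ‖x - q ω x‖ ≤ r ^ (σ₂ / (2 * α)) := by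
    intro x hx
    by_contra hx'
    exact hhole ⟨x, hx, not_le.1 hx'⟩
  have hlin := h1 0 (Q ω) (q ω) hω hR
  refine hno ?_
  have hrsq : r ^ (2 : ℝ) = r * r := by rw [Real.rpow_two, sq]
  -- The zero set of `f` is the boundary of the region cut off from the ball of radius `K r` by the
  -- hyperplane, so a sign change of `f` gives one of the two alternatives for `z`.
  let f : EuclideanSpace ℝ (Fin d) → ℝ := fun x => max (x 0 - r) (‖x‖ - K * r)
  have hf : Continuous f := by fun_prop
  have hq0 := hR 0 (by rw [sub_zero, norm_zero]; positivity)
  rw [zero_sub, norm_neg] at hq0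
  have hy : ‖axisPoint d (2 * r) - 0‖ ≤ r ^ (2 : ℝ) := by
    rw [sub_zero, norm_axisPoint, abs_of_pos (by positivity), hrsq]
    nlinarith
  have hqy := hR _ hy
  have hfx : f (q ω 0) ≤ 0 := by
    refine max_le ?_ ?_
    · have := (le_abs_self _).trans (abs_apply_le_norm (q ω 0) 0)
      linarith
    · nlinarith
  have hfy : 0 < f (q ω (axisPoint d (2 * r))) := by
    refine lt_max_of_lt_left ?_
    have := (le_abs_self _).trans
      (abs_apply_le_norm (axisPoint d (2 * r) - q ω (axisPoint d (2 * r))) 0)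
    rw [PiLp.sub_apply, axisPoint_apply_zero] at this
    linarith
  -- The error `1` of the near-optimal path is the `-1` in `step_cost_le`. The step from `p` to `p'`
  -- is replaced by the detour through `z`, whose two parts cost at most `r^σ₂ (l + 2)` together.
  obtain ⟨p, p', z, hp, hz, hfz, hsum⟩ := exists_crossing (α := α) hω hf hfx hfy one_pos
  have hzmem : (z 0 = r ∧ ‖z‖ ≤ K * r) ∨ ‖z‖ = K * r := by
    rcases max_choice (z 0 - r) (‖z‖ - K * r) with h | h
    · left
      have h0 : z 0 - r = 0 := h ▸ hfz
      have := le_max_right (z 0 - r) (‖z‖ - K * r)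
      change max (z 0 - r) (‖z‖ - K * r) = 0 at hfz
      exact ⟨by linarith, by linarith⟩
    · right
      have h0 : ‖z‖ - K * r = 0 := h ▸ hfz
      linarith
  refine ⟨z, hzmem, ?_⟩
  have hzK : ‖z‖ ≤ K * r := by
    rcases hzmem with h | h
    · exact h.2
    · exact h.le
  have hpK : ‖p‖ ≤ K * r := by
    have := (le_max_right _ _).trans hp
    linarith
  set l := ‖p - p'‖ with hl
  have hl0 : 0 ≤ l := norm_nonneg _
  have hlα : l ^ α ≤ K * r + 1 := by
    have := passageTime_nonneg (α := α) (S := Q ω) (q := q ω) 0 p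
    have := passageTime_nonneg (α := α) (S := Q ω) (q := q ω) p' (axisPoint d (2 * r))
    linarith
  have hlK : l ≤ K * r + 1 := by
    rcases le_total l 1 with h | h
    · nlinarith
    · refine le_trans ?_ hlα
      calc l = l ^ (1 : ℝ) := (Real.rpow_one l).symm
        _ ≤ l ^ α := Real.rpow_le_rpow_of_exponent_le h hα.le
  have hp'K : ‖p' - 0‖ ≤ r ^ (2 : ℝ) := by
    have : ‖p'‖ ≤ ‖p‖ + l := by
      calc ‖p'‖ = ‖p - (p - p')‖ := by congr 1; abel
        _ ≤ _ := norm_sub_le _ _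
    rw [sub_zero, hrsq]
    nlinarith
  have hpB : ‖p - 0‖ ≤ r ^ (2 : ℝ) := by rw [sub_zero, hrsq]; nlinarith
  have hzB : ‖z - 0‖ ≤ r ^ (2 : ℝ) := by rw [sub_zero, hrsq]; nlinarith
  have hdist : ‖p - z‖ + ‖z - p'‖ = l := by
    have := dist_add_dist_of_mem_segment hz
    rwa [dist_eq_norm, dist_eq_norm, dist_eq_norm] at this
  have e1 := hlin p z hpB hzB
  have e2 := hlin z p' hzB hp'K
  have e3 := passageTime_triangle (α := α) hω 0 p z
  have e4 := passageTime_triangle (α := α) hω z p' (axisPoint d (2 * r))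
  have hcost := step_cost_le hα hr1 hl0 hσ hσ₂0 hσ₂σ h4
  have e5 : r ^ σ₂ * (‖p - z‖ + 1) + r ^ σ₂ * (‖z - p'‖ + 1) = r ^ σ₂ * (l + 2) := by
    rw [← hdist]; ring
  linarith

end Holes

/-! ### Erasing loops -/

section LoopErasure

/-- Loops can be erased from a sequence without increasing its cost. -/
lemma exists_loopErasure {V : Type*} {c : V → V → ℝ} (hc : ∀ a b, 0 ≤ c a b) (m : ℕ)
    (v : ℕ → V) : ∃ (k : ℕ) (u : ℕ → V), u 0 = v 0 ∧ u k = v m ∧ Set.InjOn u (Set.Iic k) ∧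
      (∀ i ≤ k, ∃ j ≤ m, u i = v j) ∧
      ∑ i ∈ Finset.range k, c (u i) (u (i + 1)) ≤ ∑ i ∈ Finset.range m, c (v i) (v (i + 1)) := by
  induction m generalizing v with
  | zero =>
    refine ⟨0, v, rfl, rfl, ?_, fun i hi => ⟨i, hi, rfl⟩, le_rfl⟩
    intro i hi j hj _
    simp only [Set.mem_Iic, Nat.le_zero] at hi hj
    rw [hi, hj]
  | succ m ih =>
    obtain ⟨k, u, h0, hk, hinj, hmem, hsum⟩ := ih fun i => v (i + 1)
    rw [Finset.sum_range_succ' _ m]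
    -- If the erased tail returns to the starting point, everything before that return is dropped;
    -- otherwise the starting point is put in front.
    by_cases hex : ∃ i ≤ k, u i = v 0
    · obtain ⟨i, hik, hi⟩ := hex
      refine ⟨k - i, fun j => u (i + j), by simpa using hi, ?_, ?_, ?_, ?_⟩
      · dsimp only
        rw [Nat.add_sub_cancel' hik, hk]
      · intro a ha b hb hab
        simp only [Set.mem_Iic] at ha hb
        have := hinj (Set.mem_Iic.2 (by omega)) (Set.mem_Iic.2 (by omega)) hab
        omega
      · intro j hj
        obtain ⟨l, hl, hl'⟩ := hmem (i + j) (by omega)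
        exact ⟨l + 1, by omega, hl'⟩
      · have : ∑ j ∈ Finset.range (k - i), c (u (i + j)) (u (i + j + 1))
            ≤ ∑ j ∈ Finset.range k, c (u j) (u (j + 1)) := by
          conv_rhs => rw [← Nat.add_sub_cancel' hik, Finset.sum_range_add]
          exact le_add_of_nonneg_left (Finset.sum_nonneg fun _ _ => hc _ _)
        have h2 := hc (v 0) (v (0 + 1))
        refine this.trans (hsum.trans ?_)
        linarith
    · push Not at hex
      refine ⟨k + 1, fun j => Nat.casesOn j (v 0) u, rfl, hk, ?_, ?_, ?_⟩
      · rintro (_ | a) ha (_ | b) hb hab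
        · rfl
        · exact absurd hab.symm (hex b (Nat.le_of_succ_le_succ hb))
        · exact absurd hab (hex a (Nat.le_of_succ_le_succ ha))
        · rw [hinj (Set.mem_Iic.2 (Nat.le_of_succ_le_succ ha))
            (Set.mem_Iic.2 (Nat.le_of_succ_le_succ hb)) hab]
      · rintro (_ | j) hj
        · exact ⟨0, Nat.zero_le _, rfl⟩
        · obtain ⟨l, hl, hl'⟩ := hmem j (Nat.le_of_succ_le_succ hj)
          exact ⟨l + 1, by omega, hl'⟩
      · rw [Finset.sum_range_succ' _ k]
        dsimp only
        rw [h0]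
        exact add_le_add_left hsum _

lemma tsum_pi_prod {V : Type*} (g : V → ENNReal) (k : ℕ) :
    ∑' w : Fin k → V, ∏ i, g (w i) = (∑' v, g v) ^ k := by
  induction k with
  | zero => simp
  | succ k ih =>
    rw [← (Fin.consEquiv fun _ : Fin (k + 1) => V).tsum_eq, ENNReal.tsum_prod']
    simp only [Fin.consEquiv_apply, Fin.prod_univ_succ, Fin.cons_zero, Fin.cons_succ,
      ENNReal.tsum_mul_left, ih, ENNReal.tsum_mul_right]
    rw [pow_succ']

end LoopErasure

/-! ### Steps between small cubes and their exponential weights -/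

section Cubes

variable {d : ℕ} [NeZero d] {α : ℝ}

/-- The cube of side `ε` with index `v`. -/
def cube (ε : ℝ) (v : Fin d → ℤ) : Set (EuclideanSpace ℝ (Fin d)) :=
  {p | ∀ i, p i ∈ Set.Ico (ε * v i) (ε * v i + ε)}

/-- The index of the cube that contains a point. -/
noncomputable def cubeIndex (ε : ℝ) (p : EuclideanSpace ℝ (Fin d)) : Fin d → ℤ :=
  fun i => ⌊p i / ε⌋

lemma mem_cube_iff {ε : ℝ} (hε : 0 < ε) {p : EuclideanSpace ℝ (Fin d)} {v : Fin d → ℤ} :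
    p ∈ cube ε v ↔ cubeIndex ε p = v := by
  rw [funext_iff]
  refine forall_congr' fun i => ?_
  rw [cubeIndex, Int.floor_eq_iff, le_div_iff₀ hε, div_lt_iff₀ hε, Set.mem_Ico]
  constructor <;> rintro ⟨h1, h2⟩ <;> constructor <;> linarith

lemma cube_eq (ε : ℝ) (v : Fin d → ℤ) :
    cube ε v = WithLp.ofLp ⁻¹' (Set.univ.pi fun i => Set.Ico (ε * v i) (ε * v i + ε)) := by
  ext p
  simp [cube]

lemma measurableSet_cube (ε : ℝ) (v : Fin d → ℤ) : MeasurableSet (cube ε v) := by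
  rw [cube_eq]
  exact (MeasurableSet.univ_pi fun i => measurableSet_Ico).preimage (PiLp.continuous_ofLp 2 _).measurable

lemma volume_cube {ε : ℝ} (hε : 0 < ε) (v : Fin d → ℤ) :
    volume (cube ε v) = ENNReal.ofReal (ε ^ d) := by
  rw [cube_eq, (PiLp.volume_preserving_ofLp (Fin d)).measure_preimage
    (MeasurableSet.univ_pi fun i => measurableSet_Ico).nullMeasurableSet, volume_pi_pi]
  simp [ENNReal.ofReal_pow hε.le]

lemma isBounded_cube {ε : ℝ} (hε : 0 < ε) (v : Fin d → ℤ) : Bornology.IsBounded (cube ε v) := by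
  refine (Metric.isBounded_closedBall (x := (0 : EuclideanSpace ℝ (Fin d)))
    (r := d * (ε * ‖v‖ + ε))).subset fun p hp => ?_
  rw [mem_closedBall_zero_iff]
  refine norm_le_of_forall_abs_le fun i => ?_
  have h := hp i
  have h2 : |(v i : ℝ)| ≤ ‖v‖ := by
    have := norm_le_pi_norm v i
    rwa [Int.norm_eq_abs] at this
  rw [abs_le] at h2 ⊢
  constructor <;> nlinarith [h.1, h.2]

lemma disjoint_cube {ε : ℝ} (hε : 0 < ε) {v w : Fin d → ℤ} (h : v ≠ w) :
    Disjoint (cube ε v) (cube ε w) := by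
  rw [Set.disjoint_left]
  intro p hp hp'
  exact h (((mem_cube_iff hε).1 hp).symm.trans ((mem_cube_iff hε).1 hp'))

lemma abs_sub_cubeIndex_le {ε : ℝ} (hε : 0 < ε) (p p' : EuclideanSpace ℝ (Fin d)) (i : Fin d) :
    |(cubeIndex ε p i - cubeIndex ε p' i : ℝ)| ≤ |p i - p' i| / ε + 1 ∧
      |p i - p' i| / ε - 1 ≤ |(cubeIndex ε p i - cubeIndex ε p' i : ℝ)| := by
  have h1 := Int.floor_le (p i / ε)
  have h2 := Int.lt_floor_add_one (p i / ε)
  have h3 := Int.floor_le (p' i / ε)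
  have h4 := Int.lt_floor_add_one (p' i / ε)
  have h5 : |p i - p' i| / ε = |p i / ε - p' i / ε| := by
    rw [← sub_div, abs_div, abs_of_pos hε]
  rw [h5]
  unfold cubeIndex
  constructor
  · rw [← sub_le_iff_le_add]
    refine le_trans ?_ (le_refl _)
    have := abs_sub_abs_le_abs_sub ((⌊p i / ε⌋ : ℝ) - ⌊p' i / ε⌋) (p i / ε - p' i / ε)
    have h6 : |((⌊p i / ε⌋ : ℝ) - ⌊p' i / ε⌋) - (p i / ε - p' i / ε)| ≤ 1 := by
      rw [abs_le]; constructor <;> linarith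
    linarith
  · have := abs_sub_abs_le_abs_sub (p i / ε - p' i / ε) ((⌊p i / ε⌋ : ℝ) - ⌊p' i / ε⌋)
    have h6 : |(p i / ε - p' i / ε) - ((⌊p i / ε⌋ : ℝ) - ⌊p' i / ε⌋)| ≤ 1 := by
      rw [abs_le]; constructor <;> linarith
    linarith

/-- A lower bound for the passage time of a step between two cubes. -/
noncomputable def cubeCost (α ε : ℝ) (v w : Fin d → ℤ) : ℝ :=
  if 2 ≤ ‖w - v‖ then ε ^ α * ‖w - v‖ / 2 else 0

lemma cubeCost_nonneg {ε : ℝ} (hε : 0 < ε) (v w : Fin d → ℤ) : 0 ≤ cubeCost α ε v w := by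
  unfold cubeCost
  split_ifs
  · positivity
  · exact le_rfl

lemma norm_sub_cubeIndex_le {ε : ℝ} (hε : 0 < ε) (p p' : EuclideanSpace ℝ (Fin d)) :
    ‖cubeIndex ε p' - cubeIndex ε p‖ ≤ ‖p - p'‖ / ε + 1 := by
  refine (pi_norm_le_iff_of_nonneg (by positivity)).2 fun i => ?_
  have h1 := (abs_sub_cubeIndex_le hε p' p i).1
  have h2 := abs_apply_le_norm (p' - p) i
  rw [PiLp.sub_apply, norm_sub_rev] at h2
  rw [Pi.sub_apply, Int.norm_eq_abs]
  push_cast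
  refine h1.trans ?_
  gcongr

/-- An index increment `n ≥ 2` forces a length of at least `ε (n - 1)`, and `n / 2 ≤ n - 1 ≤ (n -
1)^α`. Increments below `2` may come from arbitrarily short steps and are not charged. -/
lemma cubeCost_le (hα : 1 ≤ α) {ε : ℝ} (hε : 0 < ε) (p p' : EuclideanSpace ℝ (Fin d)) :
    cubeCost α ε (cubeIndex ε p) (cubeIndex ε p') ≤ ‖p - p'‖ ^ α := by
  unfold cubeCost
  split_ifs with h
  · have h1 := norm_sub_cubeIndex_le hε p p'
    set n := ‖cubeIndex ε p' - cubeIndex ε p‖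
    have h2 : ε * (n - 1) ≤ ‖p - p'‖ := by
      rw [← sub_le_iff_le_add, le_div_iff₀ hε] at h1
      linarith
    calc ε ^ α * n / 2 ≤ ε ^ α * (n - 1) := by
          have := Real.rpow_pos_of_pos hε α
          nlinarith
      _ ≤ ε ^ α * (n - 1) ^ α := by
          gcongr
          calc n - 1 = (n - 1) ^ (1 : ℝ) := (Real.rpow_one _).symm
            _ ≤ (n - 1) ^ α := Real.rpow_le_rpow_of_exponent_le (by linarith) hα
      _ = (ε * (n - 1)) ^ α := (Real.mul_rpow hε.le (by linarith)).symm
      _ ≤ _ := Real.rpow_le_rpow (by nlinarith) h2 (by linarith)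
  · positivity

/-- The exponential weight of a step. -/
noncomputable def cubeWeight (α ε θ : ℝ) (w : Fin d → ℤ) : ENNReal :=
  ENNReal.ofReal (ε ^ d * Real.exp (‖w‖ - θ * cubeCost α ε 0 w))

lemma tsum_exp_neg_norm_ne_top : ∑' w : Fin d → ℤ, ENNReal.ofReal (Real.exp (-‖w‖)) ≠ ⊤ := by
  have hd : (0 : ℝ) < d := by exact_mod_cast Nat.pos_of_ne_zero (NeZero.ne d)
  have h1 : ∀ w : Fin d → ℤ, ENNReal.ofReal (Real.exp (-‖w‖))
      ≤ ∏ i, ENNReal.ofReal (Real.exp (-(|(w i : ℝ)| / d))) := by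
    intro w
    rw [← ENNReal.ofReal_prod_of_nonneg fun i _ => (Real.exp_pos _).le, ← Real.exp_sum]
    refine ENNReal.ofReal_le_ofReal (Real.exp_le_exp.2 ?_)
    rw [Finset.sum_neg_distrib, ← Finset.sum_div, neg_le_neg_iff, div_le_iff₀ hd]
    calc ∑ i, |(w i : ℝ)| ≤ ∑ _i : Fin d, ‖w‖ := Finset.sum_le_sum fun i _ => by
          have := norm_le_pi_norm w i
          rwa [Int.norm_eq_abs] at this
      _ = ‖w‖ * d := by simp [mul_comm]
  refine ne_top_of_le_ne_top ?_ (ENNReal.tsum_le_tsum h1)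
  rw [tsum_pi_prod fun n : ℤ => ENNReal.ofReal (Real.exp (-(|(n : ℝ)| / d)))]
  refine ENNReal.pow_ne_top ?_
  have hs : Summable fun n : ℤ => Real.exp (-(|(n : ℝ)| / d)) := by
    have h2 : Summable fun n : ℕ => Real.exp (-(|((n : ℤ) : ℝ)| / d)) := by
      have := Real.summable_pow_mul_exp_neg_nat_mul 0 (r := 1 / d) (by positivity)
      refine this.congr fun n => ?_
      simp only [pow_zero, one_mul, Int.cast_natCast, Nat.abs_cast]
      congr 1
      ring
    refine Summable.of_nat_of_neg h2 ?_
    simpa using h2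
  rw [← ENNReal.ofReal_tsum_of_nonneg (fun n => (Real.exp_pos _).le) hs]
  exact ENNReal.ofReal_ne_top

/-- For a fine grid and a large penalty the total weight of the steps is small. -/
lemma exists_tsum_cubeWeight_le : ∃ ε θ : ℝ, 0 < ε ∧ ε ≤ 1 ∧ 0 < θ ∧
    ∑' w : Fin d → ℤ, cubeWeight α ε θ w ≤ 1 / 2 := by
  set G := (∑' w : Fin d → ℤ, ENNReal.ofReal (Real.exp (-‖w‖))).toReal with hG
  have hG' : ENNReal.ofReal G = ∑' w : Fin d → ℤ, ENNReal.ofReal (Real.exp (-‖w‖)) :=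
    ENNReal.ofReal_toReal tsum_exp_neg_norm_ne_top
  have hG0 : 0 ≤ G := ENNReal.toReal_nonneg
  -- Increments of norm at most `1` are free of cost, and a small `ε` brings their total weight to
  -- at most `1/4`. All other increments are brought to `1/4` by the penalty `θ`, chosen afterwards.
  set ε : ℝ := min 1 (1 / (4 * Real.exp 2 * (G + 1))) with hε
  have he2 := Real.exp_pos 2
  have hε0 : 0 < ε := lt_min one_pos (by positivity)
  have hε1 : ε ≤ 1 := min_le_left _ _
  have hεd : ε ^ d ≤ 1 / (4 * Real.exp 2 * (G + 1)) :=
    (pow_le_of_le_one hε0.le hε1 (NeZero.ne d)).trans (min_le_right _ _)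
  obtain ⟨l, hl⟩ : ∃ l : ℝ, 0 ≤ l ∧ Real.exp (-l) * G ≤ 1 / 4 := by
    refine ⟨4 * G, by positivity, ?_⟩
    have := Real.add_one_le_exp (4 * G)
    rw [Real.exp_neg, inv_mul_le_iff₀ (Real.exp_pos _)]
    linarith
  have hεα := Real.rpow_pos_of_pos hε0 α
  refine ⟨ε, (2 * l + 4) / ε ^ α, hε0, hε1, by have := hl.1; positivity, ?_⟩
  have hb : ∀ w : Fin d → ℤ, cubeWeight α ε ((2 * l + 4) / ε ^ α) w
      ≤ ENNReal.ofReal (ε ^ d * Real.exp 2 + Real.exp (-l)) * ENNReal.ofReal (Real.exp (-‖w‖)) := by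
    intro w
    rw [← ENNReal.ofReal_mul (by positivity)]
    refine ENNReal.ofReal_le_ofReal ?_
    unfold cubeCost
    rw [sub_zero, add_mul]
    split_ifs with h
    · have h1 : (2 * l + 4) / ε ^ α * (ε ^ α * ‖w‖ / 2) = (l + 2) * ‖w‖ := by
        field_simp
        ring
      rw [h1]
      have h2 : ε ^ d * Real.exp (‖w‖ - (l + 2) * ‖w‖) ≤ Real.exp (-l) * Real.exp (-‖w‖) := by
        rw [← Real.exp_add]
        calc ε ^ d * Real.exp (‖w‖ - (l + 2) * ‖w‖) ≤ 1 * Real.exp (‖w‖ - (l + 2) * ‖w‖) := by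
              gcongr
              exact pow_le_one₀ hε0.le hε1
          _ ≤ _ := by
              rw [one_mul]
              apply Real.exp_le_exp.2
              nlinarith [hl.1]
      have : 0 ≤ ε ^ d * Real.exp 2 * Real.exp (-‖w‖) := by positivity
      linarith
    · rw [mul_zero, sub_zero]
      have h2 : ‖w‖ ≤ 1 := by
        refine (pi_norm_le_iff_of_nonneg zero_le_one).2 fun i => ?_
        have h3 : ‖w i‖ < 2 := lt_of_le_of_lt (norm_le_pi_norm w i) (not_le.1 h)
        rw [Int.norm_eq_abs] at h3 ⊢
        have h4 : |w i| < 2 := by exact_mod_cast h3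
        have h5 : |w i| ≤ 1 := by omega
        exact_mod_cast h5
      have h3 : ε ^ d * Real.exp ‖w‖ ≤ ε ^ d * Real.exp 2 * Real.exp (-‖w‖) := by
        rw [mul_assoc, ← Real.exp_add]
        gcongr
        linarith
      have : 0 ≤ Real.exp (-l) * Real.exp (-‖w‖) := by positivity
      linarith
  refine (ENNReal.tsum_le_tsum hb).trans ?_
  rw [ENNReal.tsum_mul_left, ← hG', ← ENNReal.ofReal_mul (by positivity)]
  have : (1 / 2 : ENNReal) = ENNReal.ofReal (1 / 2) := by
    rw [ENNReal.ofReal_div_of_pos (by norm_num)]; simp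
  rw [this]
  refine ENNReal.ofReal_le_ofReal ?_
  have h4 : ε ^ d * Real.exp 2 * G ≤ 1 / 4 := by
    calc ε ^ d * Real.exp 2 * G ≤ 1 / (4 * Real.exp 2 * (G + 1)) * Real.exp 2 * G := by gcongr
      _ = (1 / 4) * (G / (G + 1)) := by field_simp
      _ ≤ (1 / 4) * 1 := by
          gcongr
          exact div_le_one_of_le₀ (by linarith) (by linarith)
      _ = 1 / 4 := mul_one _
  linarith [hl.2]

end Cubes

/-! ### Positivity of the speed -/

section Speed

variable {d : ℕ} [NeZero d] {α : ℝ} {Ω : Type*} [MeasurableSpace Ω] {P : Measure Ω}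
  {Q : Ω → Set (EuclideanSpace ℝ (Fin d))}
  {q : Ω → EuclideanSpace ℝ (Fin d) → EuclideanSpace ℝ (Fin d)}

/-- The probability that distinct cubes are all occupied. -/
lemma IsRateOnePoisson.prob_cubes_le (hQ : IsRateOnePoisson Q P) {ε : ℝ} (hε : 0 < ε) {m : ℕ}
    (u : Fin m → Fin d → ℤ) (hu : Function.Injective u) :
    P {ω | ∀ i, (Q ω ∩ cube ε (u i)).ncard ≠ 0} ≤ ENNReal.ofReal (ε ^ d) ^ m := by
  have hind := hQ.indep_count m (fun i => cube ε (u i)) (fun i => measurableSet_cube _ _)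
    (fun i => isBounded_cube hε _) fun i j hij => disjoint_cube hε fun h => hij (hu h)
  have h := hind.measure_inter_preimage_eq_mul Finset.univ (sets := fun _ => {0}ᶜ)
    fun i _ => MeasurableSet.of_discrete
  have hset : {ω | ∀ i, (Q ω ∩ cube ε (u i)).ncard ≠ 0}
      = ⋂ i ∈ (Finset.univ : Finset (Fin m)),
        (fun ω => (Q ω ∩ cube ε (u i)).ncard) ⁻¹' ({0}ᶜ : Set ℕ) := by
    ext ω
    simp
  rw [hset, h]
  calc ∏ i : Fin m, P ((fun ω => (Q ω ∩ cube ε (u i)).ncard) ⁻¹' ({0}ᶜ : Set ℕ))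
      ≤ ∏ _i : Fin m, ENNReal.ofReal (ε ^ d) := by
        refine Finset.prod_le_prod' fun i _ => ?_
        have hl := hQ.hasLaw_count _ (measurableSet_cube ε (u i)) (isBounded_cube hε _)
        rw [← Measure.map_apply_of_aemeasurable hl.aemeasurable MeasurableSet.of_discrete, hl.map_eq,
          volume_cube hε,
          prob_compl_eq_one_sub (MeasurableSet.of_discrete), poissonMeasure_singleton]
        have h1 := Real.add_one_le_exp (-(ε ^ d))
        have h2 : (0 : ℝ) < ε ^ d := by positivity
        have h3 : ((ENNReal.ofReal (ε ^ d)).toNNReal : ℝ) = ε ^ d := Real.coe_toNNReal _ h2.le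
        simp only [pow_zero, mul_one, Nat.factorial_zero, Nat.cast_one, div_one, h3]
        rw [← ENNReal.ofReal_one, ← ENNReal.ofReal_sub _ (Real.exp_pos _).le]
        exact ENNReal.ofReal_le_ofReal (by linarith)
    _ = _ := by simp

/-- The sequence of cubes with given start and increments. -/
def cubePath {k : ℕ} (v₀ : Fin d → ℤ) (w : Fin k → Fin d → ℤ) (i : ℕ) : Fin d → ℤ :=
  v₀ + ∑ j ∈ Finset.univ.filter (fun j : Fin k => (j : ℕ) < i), w j

/-- A path of few steps between far away points gives a chain of distinct occupied cubes. -/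
lemma exists_cubePath (hα : 1 ≤ α) {S : Set (EuclideanSpace ℝ (Fin d))}
    (hfin : ∀ A : Set (EuclideanSpace ℝ (Fin d)), Bornology.IsBounded A → (S ∩ A).Finite)
    {ε : ℝ} (hε : 0 < ε) {a b : EuclideanSpace ℝ (Fin d)} {t : ℝ} (ht : t ∈ pathTimes α S a b) :
    ∃ (k : ℕ) (w : Fin k → Fin d → ℤ),
      Function.Injective (fun i : Fin (k + 1) => cubePath (cubeIndex ε a) w i) ∧
      (∀ i : Fin (k + 1), (S ∩ cube ε (cubePath (cubeIndex ε a) w i)).ncard ≠ 0) ∧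
      ∑ i, w i = cubeIndex ε b - cubeIndex ε a ∧ ∑ i, cubeCost α ε 0 (w i) ≤ t := by
  obtain ⟨m, p, hp, rfl, rfl, rfl⟩ := ht
  obtain ⟨k, u, h0, hk, hinj, hmem, hsum⟩ :=
    exists_loopErasure (cubeCost_nonneg (α := α) hε) m fun i => cubeIndex ε (p i)
  have hpath : ∀ i ≤ k, cubePath (cubeIndex ε (p 0)) (fun j : Fin k => u (j + 1) - u j) i = u i := by
    intro i hi
    have : ∑ j ∈ Finset.univ.filter (fun j : Fin k => (j : ℕ) < i), (u (j + 1) - u j)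
        = ∑ j ∈ Finset.range i, (u (j + 1) - u j) := by
      rw [Finset.sum_filter]
      rw [Fin.sum_univ_eq_sum_range (fun j => if j < i then u (j + 1) - u j else 0) k,
        ← Finset.sum_filter]
      congr 1
      ext j
      simp only [Finset.mem_filter, Finset.mem_range]
      omega
    rw [cubePath, this, Finset.sum_range_sub, h0]
    abel
  refine ⟨k, fun j => u (j + 1) - u j, ?_, ?_, ?_, ?_⟩
  · intro i j hij
    have hi := Nat.lt_succ_iff.1 i.2
    have hj := Nat.lt_succ_iff.1 j.2
    dsimp only at hij
    rw [hpath i hi, hpath j hj] at hij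
    exact Fin.ext (hinj hi hj hij)
  · intro i
    have hi := Nat.lt_succ_iff.1 i.2
    rw [hpath i hi]
    obtain ⟨j, hj, hij⟩ := hmem i hi
    exact Set.ncard_ne_zero_of_mem ⟨hp j hj, (mem_cube_iff hε).2 hij.symm⟩
      (hfin _ (isBounded_cube hε _))
  · rw [Fin.sum_univ_eq_sum_range (fun j => u (j + 1) - u j) k, Finset.sum_range_sub, h0, hk]
  · rw [Fin.sum_univ_eq_sum_range (fun j => cubeCost α ε 0 (u (j + 1) - u j)) k]
    refine le_trans (le_of_eq ?_) (hsum.trans ?_)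
    · refine Finset.sum_congr rfl fun j _ => ?_
      simp [cubeCost]
    · exact Finset.sum_le_sum fun j _ => cubeCost_le hα hε _ _

/-- First moment bound for chains of occupied cubes. -/
lemma IsRateOnePoisson.prob_chain_le (hQ : IsRateOnePoisson Q P) {ε θ : ℝ} (hε : 0 < ε)
    (hε1 : ε ≤ 1) (hθ : 0 < θ)
    (hw : ∑' w : Fin d → ℤ, cubeWeight α ε θ w ≤ 1 / 2) (v₀ : Fin d → ℤ) (t L : ℝ) :
    P {ω | ∃ (k : ℕ) (w : Fin k → Fin d → ℤ),
      Function.Injective (fun i : Fin (k + 1) => cubePath v₀ w i) ∧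
      (∀ i : Fin (k + 1), (Q ω ∩ cube ε (cubePath v₀ w i)).ncard ≠ 0) ∧
      L ≤ ‖∑ i, w i‖ ∧ ∑ i, cubeCost α ε 0 (w i) ≤ t} ≤ 2 * ENNReal.ofReal (Real.exp (θ * t - L)) := by
  have hterm : ∀ (k : ℕ) (w : Fin k → Fin d → ℤ),
      P {ω | Function.Injective (fun i : Fin (k + 1) => cubePath v₀ w i) ∧
        (∀ i : Fin (k + 1), (Q ω ∩ cube ε (cubePath v₀ w i)).ncard ≠ 0) ∧
        L ≤ ‖∑ i, w i‖ ∧ ∑ i, cubeCost α ε 0 (w i) ≤ t}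
      ≤ ENNReal.ofReal (Real.exp (θ * t - L)) * ∏ i, cubeWeight α ε θ (w i) := by
    intro k w
    by_cases h : Function.Injective (fun i : Fin (k + 1) => cubePath v₀ w i) ∧
      L ≤ ‖∑ i, w i‖ ∧ ∑ i, cubeCost α ε 0 (w i) ≤ t
    · refine (measure_mono fun ω hω => hω.2.1).trans ((hQ.prob_cubes_le hε _ h.1).trans ?_)
      unfold cubeWeight
      rw [← ENNReal.ofReal_prod_of_nonneg fun i _ => by positivity, ← ENNReal.ofReal_mul
        (Real.exp_pos _).le, ← ENNReal.ofReal_pow (by positivity), Finset.prod_mul_distrib,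
        ← Real.exp_sum]
      refine ENNReal.ofReal_le_ofReal ?_
      have h1 : (ε ^ d) ^ (k + 1) ≤ (ε ^ d) ^ k :=
        pow_le_pow_of_le_one (by positivity) (pow_le_one₀ hε.le hε1) (Nat.le_succ k)
      -- Exponential Chebyshev inequality: a displacement of at least `L` at a cost of at most `t`
      -- makes this product at least one.
      have h2 : 1 ≤ Real.exp (θ * t - L) * Real.exp (∑ i, (‖w i‖ - θ * cubeCost α ε 0 (w i))) := by
        rw [← Real.exp_add, ← Real.exp_zero]
        apply Real.exp_le_exp.2
        rw [Finset.sum_sub_distrib, ← Finset.mul_sum]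
        have h3 := norm_sum_le Finset.univ w
        have h4 := mul_le_mul_of_nonneg_left h.2.2 hθ.le
        linarith [h.2.1]
      simp only [Finset.prod_const, Finset.card_univ, Fintype.card_fin]
      calc (ε ^ d) ^ (k + 1) ≤ (ε ^ d) ^ k * 1 := by linarith
        _ ≤ (ε ^ d) ^ k * (Real.exp (θ * t - L)
            * Real.exp (∑ i, (‖w i‖ - θ * cubeCost α ε 0 (w i)))) := by gcongr
        _ = _ := by ring
    · have : {ω | Function.Injective (fun i : Fin (k + 1) => cubePath v₀ w i) ∧
        (∀ i : Fin (k + 1), (Q ω ∩ cube ε (cubePath v₀ w i)).ncard ≠ 0) ∧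
        L ≤ ‖∑ i, w i‖ ∧ ∑ i, cubeCost α ε 0 (w i) ≤ t} = ∅ := by
        ext ω
        simp only [Set.mem_ofPred_eq, Set.mem_empty_iff_false, iff_false]
        exact fun hω => h ⟨hω.1, hω.2.2⟩
      rw [this]
      simp
  have hsub : {ω | ∃ (k : ℕ) (w : Fin k → Fin d → ℤ),
      Function.Injective (fun i : Fin (k + 1) => cubePath v₀ w i) ∧
      (∀ i : Fin (k + 1), (Q ω ∩ cube ε (cubePath v₀ w i)).ncard ≠ 0) ∧
      L ≤ ‖∑ i, w i‖ ∧ ∑ i, cubeCost α ε 0 (w i) ≤ t}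
      ⊆ ⋃ (k : ℕ), ⋃ (w : Fin k → Fin d → ℤ),
        {ω | Function.Injective (fun i : Fin (k + 1) => cubePath v₀ w i) ∧
        (∀ i : Fin (k + 1), (Q ω ∩ cube ε (cubePath v₀ w i)).ncard ≠ 0) ∧
        L ≤ ‖∑ i, w i‖ ∧ ∑ i, cubeCost α ε 0 (w i) ≤ t} := by
    rintro ω ⟨k, w, h⟩
    exact Set.mem_iUnion.2 ⟨k, Set.mem_iUnion.2 ⟨w, h⟩⟩
  refine (measure_mono hsub).trans ((measure_iUnion_le _).trans ?_)
  calc _ ≤ ∑' k : ℕ, ∑' w : Fin k → Fin d → ℤ,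
        ENNReal.ofReal (Real.exp (θ * t - L)) * ∏ i, cubeWeight α ε θ (w i) :=
      ENNReal.tsum_le_tsum fun k => (measure_iUnion_le _).trans
        (ENNReal.tsum_le_tsum fun w => hterm k w)
    _ = ENNReal.ofReal (Real.exp (θ * t - L)) * ∑' k : ℕ, (∑' w : Fin d → ℤ, cubeWeight α ε θ w) ^ k := by
      simp only [ENNReal.tsum_mul_left, tsum_pi_prod]
    _ ≤ ENNReal.ofReal (Real.exp (θ * t - L)) * ∑' k : ℕ, (1 / 2 : ENNReal) ^ k := by gcongr
    _ = _ := by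
      rw [ENNReal.tsum_geometric, one_div, ENNReal.one_sub_inv_two, inv_inv, mul_comm]

/-- The passage time grows at least linearly. -/
lemma prob_passageTime_lt_le [IsProbabilityMeasure P] (hα : 1 ≤ α) (hQ : IsRateOnePoisson Q P)
    (hq : ∀ᵐ ω ∂P, IsNearestPointMap (Q ω) (q ω)) :
    ∃ c : ℝ, 0 < c ∧ ∀ᶠ s : ℝ in atTop,
      P.real {ω | passageTime α (Q ω) (q ω) 0 (axisPoint d s) < c * s} ≤ 1 / 2 := by
  obtain ⟨ε, θ, hε, hε1, hθ, hw⟩ := exists_tsum_cubeWeight_le (d := d) (α := α)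
  obtain ⟨R, hR0, hR⟩ : ∃ R : ℝ, 0 < R ∧ ∀ a : EuclideanSpace ℝ (Fin d),
      P.real {ω | ∃ x, ‖x - a‖ ≤ R ∧ R < ‖x - q ω x‖} ≤ 1 / 8 := by
    have h1 := prob_hole_eventually_le (d := d) hQ hq (σ := 1) one_pos
    have h2 : ∀ᶠ r : ℝ in atTop, Real.exp (-r ^ ((1 : ℝ) / 4)) ≤ 1 / 8 :=
      (Real.tendsto_exp_neg_atTop_nhds_zero.comp (tendsto_rpow_atTop
        (show (0 : ℝ) < 1 / 4 by norm_num))).eventually (eventually_le_nhds (by norm_num))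
    obtain ⟨R, h1, h2, h3⟩ := (h1.and (h2.and (eventually_ge_atTop 1))).exists
    refine ⟨R, by linarith, fun a => le_trans (measureReal_mono ?_ (measure_ne_top _ _)) ((h1 a).trans h2)⟩
    rintro ω ⟨x, hx, hx'⟩
    refine ⟨x, hx.trans ?_, by rwa [Real.rpow_one]⟩
    rw [Real.rpow_two]
    nlinarith
  set B := gridBox d (⌈R / ε + 1⌉₊) with hB
  set C := (2 * R / ε + 1) with hC
  -- With this speed the penalty `θ t` equals `s / (2 ε)`, half of the displacement `s / ε` that is
  -- needed in units of cubes, so the chain bound decays exponentially in `s`.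
  refine ⟨1 / (2 * ε * θ), by positivity, ?_⟩
  have hsmall : ∀ᶠ s : ℝ in atTop,
      (B.card : ℝ) * (2 * Real.exp (θ * (1 / (2 * ε * θ) * s) - (s / ε - C))) ≤ 1 / 4 := by
    have h1 : Tendsto (fun s : ℝ => (B.card : ℝ) * (2 * Real.exp C * Real.exp (-(s / (2 * ε)))))
        atTop (nhds ((B.card : ℝ) * (2 * Real.exp C * 0))) := by
      refine Tendsto.const_mul _ (Tendsto.const_mul _ ?_)
      exact Real.tendsto_exp_neg_atTop_nhds_zero.comp (tendsto_id.atTop_div_const (by positivity))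
    rw [mul_zero, mul_zero] at h1
    filter_upwards [h1.eventually (eventually_le_nhds (show (0 : ℝ) < 1 / 4 by norm_num))] with s hs
    refine le_trans (le_of_eq ?_) hs
    rw [mul_assoc 2 (Real.exp C), ← Real.exp_add]
    congr 3
    field_simp
    ring
  filter_upwards [hsmall] with s hs
  have hsub : ∀ᵐ ω ∂P, ω ∈ {ω | passageTime α (Q ω) (q ω) 0 (axisPoint d s) < 1 / (2 * ε * θ) * s} →
      ω ∈ {ω | ∃ x, ‖x - 0‖ ≤ R ∧ R < ‖x - q ω x‖}
        ∪ {ω | ∃ x, ‖x - axisPoint d s‖ ≤ R ∧ R < ‖x - q ω x‖}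
        ∪ ⋃ v₀ ∈ B, {ω | ∃ (k : ℕ) (w : Fin k → Fin d → ℤ),
          Function.Injective (fun i : Fin (k + 1) => cubePath v₀ w i) ∧
          (∀ i : Fin (k + 1), (Q ω ∩ cube ε (cubePath v₀ w i)).ncard ≠ 0) ∧
          s / ε - C ≤ ‖∑ i, w i‖ ∧ ∑ i, cubeCost α ε 0 (w i) ≤ 1 / (2 * ε * θ) * s} := by
    filter_upwards [hq, hQ.locallyFinite] with ω hω hfin hT
    by_cases h1 : ∃ x, ‖x - 0‖ ≤ R ∧ R < ‖x - q ω x‖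
    · exact Or.inl (Or.inl h1)
    by_cases h2 : ∃ x, ‖x - axisPoint d s‖ ≤ R ∧ R < ‖x - q ω x‖
    · exact Or.inl (Or.inr h2)
    right
    push Not at h1 h2
    have h1' := h1 0 (by simpa using hR0.le)
    have h2' := h2 (axisPoint d s) (by simpa using hR0.le)
    rw [zero_sub, norm_neg] at h1'
    obtain ⟨t, ht, hts⟩ := exists_lt_of_csInf_lt
      ⟨_, step_mem_pathTimes (α := α) (hω 0).1 (hω (axisPoint d s)).1⟩ hT
    obtain ⟨k, w, hinj, hocc, hsum, hcost⟩ := exists_cubePath hα hfin hε ht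
    refine Set.mem_biUnion (x := cubeIndex ε (q ω 0)) ?_ ⟨k, w, hinj, hocc, ?_, hcost.trans hts.le⟩
    · refine Finset.mem_coe.2 (mem_gridBox.2 fun i => ?_)
      have h3 := (abs_sub_cubeIndex_le hε (q ω 0) 0 i).1
      have h4 := abs_apply_le_norm (q ω 0) i
      have h5 : cubeIndex ε (0 : EuclideanSpace ℝ (Fin d)) i = 0 := by simp [cubeIndex]
      rw [h5, PiLp.zero_apply, sub_zero, Int.cast_zero, sub_zero] at h3
      have h6 : |(cubeIndex ε (q ω 0) i : ℝ)| ≤ (⌈R / ε + 1⌉₊ : ℝ) := by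
        refine h3.trans (le_trans ?_ (Nat.le_ceil _))
        gcongr
        linarith
      exact_mod_cast h6
    · rw [hsum]
      have h3 := (abs_sub_cubeIndex_le hε (q ω (axisPoint d s)) (q ω 0) 0).2
      have h4 := norm_le_pi_norm (cubeIndex ε (q ω (axisPoint d s)) - cubeIndex ε (q ω 0)) 0
      rw [Pi.sub_apply, Int.norm_eq_abs] at h4
      push_cast at h4
      refine le_trans ?_ (h3.trans h4)
      have h5 := abs_apply_le_norm (q ω 0) 0
      have h6 := abs_apply_le_norm (axisPoint d s - q ω (axisPoint d s)) 0
      rw [PiLp.sub_apply, axisPoint_apply_zero] at h6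
      have h7 : s - 2 * R ≤ |q ω (axisPoint d s) 0 - q ω 0 0| := by
        refine le_trans ?_ (le_abs_self _)
        have h8 := (abs_le.1 (h5.trans h1')).2
        have h9 := (abs_le.1 (h6.trans h2')).2
        linarith
      rw [hC]
      have : (s - 2 * R) / ε ≤ |q ω (axisPoint d s) 0 - q ω 0 0| / ε := by gcongr
      rw [sub_div] at this
      linarith
  refine (ENNReal.toReal_mono (measure_ne_top _ _) (measure_mono_ae hsub)).trans ?_
  change P.real _ ≤ _
  refine (measureReal_union_le _ _).trans ?_
  have e1 := (measureReal_union_le {ω | ∃ x, ‖x - 0‖ ≤ R ∧ R < ‖x - q ω x‖}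
    {ω | ∃ x, ‖x - axisPoint d s‖ ≤ R ∧ R < ‖x - q ω x‖} (μ := P))
  have e2 := hR 0
  have e3 := hR (axisPoint d s)
  have e4 : P.real (⋃ v₀ ∈ B, {ω | ∃ (k : ℕ) (w : Fin k → Fin d → ℤ),
      Function.Injective (fun i : Fin (k + 1) => cubePath v₀ w i) ∧
      (∀ i : Fin (k + 1), (Q ω ∩ cube ε (cubePath v₀ w i)).ncard ≠ 0) ∧
      s / ε - C ≤ ‖∑ i, w i‖ ∧ ∑ i, cubeCost α ε 0 (w i) ≤ 1 / (2 * ε * θ) * s}) ≤ 1 / 4 := by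
    refine (measureReal_biUnion_finset_le _ _).trans (le_trans ?_ hs)
    rw [← nsmul_eq_mul, ← Finset.sum_const]
    refine Finset.sum_le_sum fun v₀ _ => ?_
    refine ENNReal.toReal_le_of_le_ofReal (by positivity) ?_
    rw [ENNReal.ofReal_mul (by norm_num), ENNReal.ofReal_ofNat]
    exact hQ.prob_chain_le hε hε1 hθ hw v₀ _ _
  linarith

end Speed

/-! ### The abstract model of passage times and their mean -/

/-- The properties of the passage times that are used for the fluctuation bounds. -/
structure IsPassageModel {d : ℕ} {Ω : Type*} [MeasurableSpace Ω] (P : Measure Ω)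
    (T : Ω → EuclideanSpace ℝ (Fin d) → EuclideanSpace ℝ (Fin d) → ℝ) (h ψ : ℝ → ℝ)
    (C₀ C₁ κ₁ κ₂ : ℝ) : Prop where
  metric : ∀ᵐ ω ∂P, (∀ x y, 0 ≤ T ω x y) ∧ (∀ x y, T ω x y = T ω y x) ∧
    ∀ x y z, T ω x z ≤ T ω x y + T ω y z
  conc : ∀ x y : EuclideanSpace ℝ (Fin d), 1 ≤ ‖x - y‖ → ∀ l : ℝ, 0 ≤ l → l ≤ C₀ * ‖x - y‖ ^ κ₂ →
    P.real {ω | l * ψ ‖x - y‖ < |T ω x y - h ‖x - y‖|} ≤ C₁ * Real.exp (-C₀ * l ^ κ₁)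
  linear : ∀ σ : ℝ, 0 < σ → ∃ σ' : ℝ, 0 < σ' ∧ ∀ᶠ n : ℝ in atTop,
    ∀ a : EuclideanSpace ℝ (Fin d),
      P.real {ω | ∃ x y, ‖x - a‖ ≤ n ^ (2 : ℝ) ∧ ‖y - a‖ ≤ n ^ (2 : ℝ) ∧
        n ^ σ * (‖x - y‖ + 1) < T ω x y} ≤ Real.exp (-n ^ σ')

/-- Reflection in a point. -/
lemma IsPassageModel.reflect {d : ℕ} {Ω : Type*} [MeasurableSpace Ω] {P : Measure Ω}
    {T : Ω → EuclideanSpace ℝ (Fin d) → EuclideanSpace ℝ (Fin d) → ℝ} {h ψ : ℝ → ℝ}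
    {C₀ C₁ κ₁ κ₂ : ℝ} [IsProbabilityMeasure P] (hT : IsPassageModel P T h ψ C₀ C₁ κ₁ κ₂)
    (b : EuclideanSpace ℝ (Fin d)) :
    IsPassageModel P (fun ω x y => T ω (b - x) (b - y)) h ψ C₀ C₁ κ₁ κ₂ := by
  refine ⟨?_, ?_, ?_⟩
  · filter_upwards [hT.metric] with ω hω
    exact ⟨fun x y => hω.1 _ _, fun x y => hω.2.1 _ _, fun x y z => hω.2.2 _ _ _⟩
  · intro x y hxy l hl hl'
    have : ‖(b - x) - (b - y)‖ = ‖x - y‖ := by rw [sub_sub_sub_cancel_left, norm_sub_rev]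
    have h1 := hT.conc (b - x) (b - y)
    rw [this] at h1
    exact h1 hxy l hl hl'
  · intro σ hσ
    obtain ⟨σ', hσ', h1⟩ := hT.linear σ hσ
    refine ⟨σ', hσ', h1.mono fun n hn a => le_trans (measureReal_mono ?_ (measure_ne_top _ _)) (hn (b - a))⟩
    rintro ω ⟨x, y, hx, hy, hxy⟩
    refine ⟨b - x, b - y, ?_, ?_, ?_⟩
    · rwa [sub_sub_sub_cancel_left, norm_sub_rev]
    · rwa [sub_sub_sub_cancel_left, norm_sub_rev]
    · rwa [sub_sub_sub_cancel_left, norm_sub_rev y x]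

/-- The properties of the mean passage time as a function of the distance. -/
structure IsMeanTime (h : ℝ → ℝ) (μ A : ℝ) : Prop where
  subadd : ∀ s t : ℝ, 0 ≤ s → 0 ≤ t → h (s + t) ≤ h s + h t
  upper : ∀ s : ℝ, 0 ≤ s → h s ≤ A * (s + 1)
  speed_pos : 0 < μ
  lower : ∀ s : ℝ, 0 ≤ s → μ * s ≤ h s
  limit : ∀ η : ℝ, 0 < η → ∃ s₁ : ℝ, ∀ s : ℝ, s₁ ≤ s → h s ≤ (μ + η) * s

lemma subadditive_nat_mul_le {h : ℝ → ℝ} (hsub : ∀ s t : ℝ, 0 ≤ s → 0 ≤ t → h (s + t) ≤ h s + h t)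
    {s x : ℝ} (hs : 0 ≤ s) (hx : 0 ≤ x) (k : ℕ) : h (k * s + x) ≤ k * h s + h x := by
  induction k with
  | zero => simp
  | succ k ih =>
    have := hsub s (k * s + x) hs (by positivity)
    have e : ((k + 1 : ℕ) : ℝ) * s + x = s + (k * s + x) := by push_cast; ring
    rw [e]
    push_cast
    linarith

/-- Fekete's argument with `μ = inf h s / s`. Comparing `h (k s)` with `k h s` carries the lower
bound `c` from large distances to all, so `μ ≥ c > 0`. The bound on `[0, 1]` controls the remainders
after division. -/
lemma exists_isMeanTime {h : ℝ → ℝ} {A c : ℝ} (hnn : ∀ s, 0 ≤ h s)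
    (hsub : ∀ s t : ℝ, 0 ≤ s → 0 ≤ t → h (s + t) ≤ h s + h t)
    (hA : ∀ s, 0 ≤ s → s ≤ 1 → h s ≤ A) (hc : 0 < c) (hlow : ∀ᶠ s : ℝ in atTop, c * s ≤ h s) :
    ∃ μ, IsMeanTime h μ A := by
  have hA0 : 0 ≤ A := (hnn 0).trans (hA 0 le_rfl zero_le_one)
  have hup : ∀ s : ℝ, 0 ≤ s → h s ≤ A * (s + 1) := by
    intro s hs
    have h1 := subadditive_nat_mul_le hsub zero_le_one (sub_nonneg.2 (Nat.floor_le hs)) ⌊s⌋₊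
    rw [mul_one, add_sub_cancel] at h1
    have h2 := hA 1 zero_le_one le_rfl
    have h3 := hA (s - ⌊s⌋₊) (sub_nonneg.2 (Nat.floor_le hs))
      (by have := Nat.lt_floor_add_one s; linarith)
    have h4 := Nat.floor_le hs
    have h5 : (⌊s⌋₊ : ℝ) * h 1 ≤ s * A := mul_le_mul h4 h2 (hnn 1) hs
    linarith
  have hck : ∀ s : ℝ, 0 < s → c ≤ h s / s := by
    intro s hs
    obtain ⟨s₁, hs₁⟩ := eventually_atTop.1 hlow
    obtain ⟨k, hk⟩ := exists_nat_gt (max (s₁ / s) 0)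
    have hk0 : (0 : ℝ) < k := (le_max_right _ _).trans_lt hk
    have h1 : s₁ ≤ k * s := by
      have := (le_max_left _ _).trans hk.le
      rwa [div_le_iff₀ hs] at this
    have h2 := hs₁ _ h1
    obtain ⟨k', rfl⟩ : ∃ k', k = k' + 1 := ⟨k - 1, by
      have : 0 < k := by exact_mod_cast hk0
      omega⟩
    have h3 := subadditive_nat_mul_le hsub hs.le hs.le k'
    push_cast at h1 h2 hk0
    have e : (k' : ℝ) * s + s = (k' + 1) * s := by ring
    rw [e] at h3
    rw [le_div_iff₀ hs]
    have h4 : ((k' : ℝ) + 1) * (c * s) ≤ (k' + 1) * h s := by linarith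
    exact le_of_mul_le_mul_left h4 hk0
  set Sset : Set ℝ := (fun s => h s / s) '' Set.Ioi 0
  have hne : Sset.Nonempty := ⟨_, 1, Set.mem_Ioi.2 one_pos, rfl⟩
  have hbdd : BddBelow Sset := ⟨c, by rintro _ ⟨s, hs, rfl⟩; exact hck s hs⟩
  have hμ : c ≤ sInf Sset := le_csInf hne (by rintro _ ⟨s, hs, rfl⟩; exact hck s hs)
  refine ⟨sInf Sset, hsub, hup, hc.trans_le hμ, ?_, ?_⟩
  · intro s hs
    rcases hs.lt_or_eq with h0 | h0
    · have := csInf_le hbdd ⟨s, h0, rfl⟩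
      rwa [le_div_iff₀ h0] at this
    · rw [← h0, mul_zero]
      exact hnn 0
  · intro η hη
    obtain ⟨_, ⟨s₂, hs₂, rfl⟩, hlt⟩ := exists_lt_of_csInf_lt hne
      (lt_add_of_pos_right (sInf Sset) (half_pos hη))
    have hs₂' : (0 : ℝ) < s₂ := hs₂
    rw [div_lt_iff₀ hs₂'] at hlt
    refine ⟨max 0 (A * (s₂ + 1) / (η / 2)), fun s hs => ?_⟩
    have hs0 : 0 ≤ s := (le_max_left _ _).trans hs
    have hsA : A * (s₂ + 1) ≤ s * (η / 2) := by
      have := (le_max_right _ _).trans hs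
      rwa [div_le_iff₀ (half_pos hη)] at this
    set k := ⌊s / s₂⌋₊
    have hk1 : (k : ℝ) * s₂ ≤ s := by
      have := Nat.floor_le (div_nonneg hs0 hs₂'.le)
      rwa [le_div_iff₀ hs₂'] at this
    have hk2 : s - k * s₂ ≤ s₂ := by
      have := (Nat.lt_floor_add_one (s / s₂)).le
      rw [div_le_iff₀ hs₂'] at this
      linarith
    have h1 := subadditive_nat_mul_le hsub hs₂'.le (sub_nonneg.2 hk1) k
    rw [add_sub_cancel] at h1
    have h2 := hup (s - k * s₂) (sub_nonneg.2 hk1)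
    have h3 : A * (s - k * s₂ + 1) ≤ A * (s₂ + 1) := by gcongr
    have h4 : (k : ℝ) * h s₂ ≤ k * ((sInf Sset + η / 2) * s₂) := by gcongr
    have h5 : (sInf Sset + η / 2) * (k * s₂) ≤ (sInf Sset + η / 2) * s :=
      mul_le_mul_of_nonneg_left hk1 (by linarith)
    nlinarith

section Model

variable {d : ℕ} [NeZero d] {α : ℝ} {Ω : Type*} [MeasurableSpace Ω] {P : Measure Ω}
  [IsProbabilityMeasure P] {Q : Ω → Set (EuclideanSpace ℝ (Fin d))}
  {q : Ω → EuclideanSpace ℝ (Fin d) → EuclideanSpace ℝ (Fin d)} {ψ : ℝ → ℝ} {C₀ C₁ κ₁ κ₂ : ℝ}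

/-- The mean passage time over a distance `s`. -/
noncomputable def meanTime (P : Measure Ω) (α : ℝ) (Q : Ω → Set (EuclideanSpace ℝ (Fin d)))
    (q : Ω → EuclideanSpace ℝ (Fin d) → EuclideanSpace ℝ (Fin d)) (s : ℝ) : ℝ :=
  ∫ ω, passageTime α (Q ω) (q ω) 0 (axisPoint d s) ∂P

lemma norm_zero_sub_axisPoint {s : ℝ} (hs : 0 ≤ s) : ‖(0 : EuclideanSpace ℝ (Fin d)) - axisPoint d s‖ = s := by
  rw [zero_sub, norm_neg, norm_axisPoint, abs_of_nonneg hs]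

lemma integral_passageTime_eq (hα : 0 < α) (hQ : IsRateOnePoisson Q P)
    (hq : ∀ᵐ ω ∂P, IsNearestPointMap (Q ω) (q ω)) (x y : EuclideanSpace ℝ (Fin d)) :
    ∫ ω, passageTime α (Q ω) (q ω) x y ∂P = meanTime P α Q q ‖x - y‖ :=
  (identDistrib_passageTime hα hQ hq (norm_zero_sub_axisPoint (norm_nonneg (x - y))).symm).integral_eq

lemma integrable_passageTime' (hα : 0 < α) (hQ : IsRateOnePoisson Q P)
    (hq : ∀ᵐ ω ∂P, IsNearestPointMap (Q ω) (q ω)) (x y : EuclideanSpace ℝ (Fin d)) :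
    Integrable (fun ω => passageTime α (Q ω) (q ω) x y) P :=
  ((integrable_passageTime hα hQ hq (norm_nonneg (x - y))).choose_spec x y le_rfl).1

lemma exists_isMeanTime_meanTime (hα : 1 < α) (hQ : IsRateOnePoisson Q P)
    (hq : ∀ᵐ ω ∂P, IsNearestPointMap (Q ω) (q ω)) :
    ∃ μ A, IsMeanTime (meanTime P α Q q) μ A := by
  have hα0 : 0 < α := by linarith
  obtain ⟨A, hA⟩ := integrable_passageTime hα0 hQ hq zero_le_one
  obtain ⟨c, hc, hlow⟩ := prob_passageTime_lt_le hα.le hQ hq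
  have hnn : ∀ s, 0 ≤ meanTime P α Q q s := fun s =>
    integral_nonneg fun ω => passageTime_nonneg _ _
  suffices h : ∃ μ, IsMeanTime (meanTime P α Q q) μ A from ⟨h.choose, A, h.choose_spec⟩
  -- The factor `1/2` comes from Markov's inequality, since the passage time is at least `c s` with
  -- probability at least `1/2`.
  refine exists_isMeanTime (c := c / 2) hnn ?_ ?_ (half_pos hc) ?_
  · intro s t hs ht
    have h1 := integrable_passageTime' hα0 hQ hq 0 (axisPoint d s)
    have h2 := integrable_passageTime' hα0 hQ hq (axisPoint d s) (axisPoint d (s + t))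
    have h3 := integrable_passageTime' hα0 hQ hq 0 (axisPoint d (s + t))
    have h4 : ‖axisPoint d s - axisPoint d (s + t)‖ = t := by
      rw [← axisPoint_sub, norm_axisPoint, sub_add_cancel_left, abs_neg, abs_of_nonneg ht]
    have h5 := integral_passageTime_eq hα0 hQ hq (axisPoint d s) (axisPoint d (s + t))
    rw [h4] at h5
    rw [← h5]
    unfold meanTime
    rw [← integral_add h1 h2]
    refine integral_mono_ae h3 (h1.add h2) ?_
    filter_upwards [hq] with ω hω
    exact passageTime_triangle hω _ _ _
  · intro s hs hs1
    exact (hA 0 (axisPoint d s) (by rwa [norm_zero_sub_axisPoint hs])).2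
  · filter_upwards [hlow, eventually_ge_atTop 0] with s hs hs0
    have hint := integrable_passageTime' hα0 hQ hq 0 (axisPoint d s)
    have hm := hint.aestronglyMeasurable.aemeasurable
    have hge : 1 / 2 ≤ P.real {ω | c * s ≤ passageTime α (Q ω) (q ω) 0 (axisPoint d s)} := by
      have h1 := measureReal_union_le (μ := P) {ω | passageTime α (Q ω) (q ω) 0 (axisPoint d s) < c * s}
        {ω | c * s ≤ passageTime α (Q ω) (q ω) 0 (axisPoint d s)}
      have h2 : {ω | passageTime α (Q ω) (q ω) 0 (axisPoint d s) < c * s} ∪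
        {ω | c * s ≤ passageTime α (Q ω) (q ω) 0 (axisPoint d s)} = Set.univ := by
        ext ω
        simp [lt_or_ge]
      rw [h2, probReal_univ] at h1
      linarith
    have hmk := mul_meas_ge_le_integral_of_nonneg
      (Eventually.of_forall fun ω => passageTime_nonneg (α := α) (S := Q ω) (q := q ω) 0 (axisPoint d s))
      hint (c * s)
    unfold meanTime
    have : 0 ≤ c * s := by positivity
    nlinarith

lemma isPassageModel_passageTime (hα : 1 < α) (hQ : IsRateOnePoisson Q P)
    (hq : ∀ᵐ ω ∂P, IsNearestPointMap (Q ω) (q ω))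
    (hconc : ConcentratesOnScale P (fun ω => passageTime α (Q ω) (q ω)) ψ C₀ C₁ κ₁ κ₂) :
    IsPassageModel P (fun ω => passageTime α (Q ω) (q ω)) (meanTime P α Q q) ψ C₀ C₁ κ₁ κ₂ := by
  refine ⟨?_, ?_, ?_⟩
  · filter_upwards [hq] with ω hω
    exact ⟨fun x y => passageTime_nonneg x y, fun x y => passageTime_symm x y,
      fun x y z => passageTime_triangle hω x y z⟩
  · intro x y hxy l hl hl'
    refine le_trans (le_of_eq ?_) (hconc ‖x - y‖ hxy l hl hl')
    have hid := identDistrib_passageTime (by linarith : 0 < α) hQ hq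
      (norm_zero_sub_axisPoint (norm_nonneg (x - y))).symm
    have := hid.measure_mem_eq (s := {t | l * ψ ‖x - y‖ < |t - meanTime P α Q q ‖x - y‖|})
      (measurableSet_lt measurable_const (by fun_prop))
    exact congrArg ENNReal.toReal this
  · intro σ hσ
    exact prob_not_linear_le hα hQ hq hσ

end Model

/-! ### Power scales and regular scale functions -/

/-- Functions that grow like a power, with exponent between `κ` and `1 - κ` on all scales. -/
structure IsPowerScale (Φ : ℝ → ℝ) (κ s₀ : ℝ) : Prop where
  pos : ∀ s, s₀ ≤ s → 0 < Φ s
  lower : ∀ y n, s₀ ≤ y → y ≤ n → (n / y) ^ κ * Φ y ≤ Φ n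
  upper : ∀ y n, s₀ ≤ y → y ≤ n → Φ n ≤ (n / y) ^ (1 - κ) * Φ y

section PowerScale

variable {Φ : ℝ → ℝ} {κ s₀ : ℝ}

lemma IsPowerScale.mono (hΦ : IsPowerScale Φ κ s₀) (hκ : 0 ≤ κ) (hs₀ : 1 ≤ s₀) {y n : ℝ}
    (hy : s₀ ≤ y) (hyn : y ≤ n) : Φ y ≤ Φ n := by
  refine le_trans ?_ (hΦ.lower y n hy hyn)
  have h1 : 1 ≤ (n / y) ^ κ := Real.one_le_rpow ((one_le_div (by linarith)).2 hyn) hκ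
  nlinarith [hΦ.pos y hy]

lemma IsPowerScale.le_mul (hΦ : IsPowerScale Φ κ s₀) (hκ : 0 ≤ κ) (hs₀ : 1 ≤ s₀) {c y n : ℝ}
    (hy : s₀ ≤ y) (hyn : y ≤ n) (hn : n ≤ c * y) : Φ n ≤ c * Φ y := by
  have hy0 : 0 < y := by linarith
  have h1 : 1 ≤ n / y := (one_le_div hy0).2 hyn
  have h2 : n / y ≤ c := (div_le_iff₀ hy0).2 hn
  refine (hΦ.upper y n hy hyn).trans ?_
  have h3 : (n / y) ^ (1 - κ) ≤ (n / y) ^ (1 : ℝ) :=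
    Real.rpow_le_rpow_of_exponent_le h1 (by linarith)
  rw [Real.rpow_one] at h3
  have := hΦ.pos y hy
  gcongr
  linarith

lemma IsPowerScale.mul (hΦ : IsPowerScale Φ κ s₀) (hs₀ : 1 ≤ s₀) {θ : ℝ → ℝ} {β κ' : ℝ}
    (hκκ' : κ' ≤ κ) (hβ : β ≤ κ - κ')
    (hθ : ∀ s, s₀ ≤ s → 0 < θ s) (hθ1 : ∀ y n, s₀ ≤ y → y ≤ n → θ y ≤ θ n)
    (hθ2 : ∀ y n, s₀ ≤ y → y ≤ n → θ n ≤ (n / y) ^ β * θ y) :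
    IsPowerScale (fun s => Φ s * θ s) κ' s₀ := by
  refine ⟨fun s hs => mul_pos (hΦ.pos s hs) (hθ s hs), fun y n hy hyn => ?_, fun y n hy hyn => ?_⟩
  · have h1 : 1 ≤ n / y := (one_le_div (by linarith)).2 hyn
    have h2 := hΦ.lower y n hy hyn
    have h3 := hθ1 y n hy hyn
    have h4 : (n / y) ^ κ' ≤ (n / y) ^ κ := Real.rpow_le_rpow_of_exponent_le h1 hκκ'
    have := hΦ.pos y hy
    have := hΦ.pos n (hy.trans hyn)
    have := hθ y hy
    calc (n / y) ^ κ' * (Φ y * θ y) = ((n / y) ^ κ' * Φ y) * θ y := by ring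
      _ ≤ ((n / y) ^ κ * Φ y) * θ y := by gcongr
      _ ≤ Φ n * θ n := by gcongr
  · have h0 : 0 < n / y := div_pos (by linarith) (by linarith)
    have h1 : 1 ≤ n / y := (one_le_div (by linarith)).2 hyn
    have h2 := hΦ.upper y n hy hyn
    have h3 := hθ2 y n hy hyn
    have h4 : (n / y) ^ (1 - κ) * (n / y) ^ β ≤ (n / y) ^ (1 - κ') := by
      rw [← Real.rpow_add h0]
      exact Real.rpow_le_rpow_of_exponent_le h1 (by linarith)
    have := hΦ.pos y hy
    have := hΦ.pos n (hy.trans hyn)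
    have := hθ y hy
    have := hθ n (hy.trans hyn)
    calc Φ n * θ n ≤ ((n / y) ^ (1 - κ) * Φ y) * ((n / y) ^ β * θ y) := by gcongr
      _ = ((n / y) ^ (1 - κ) * (n / y) ^ β) * (Φ y * θ y) := by ring
      _ ≤ _ := by gcongr

lemma IsPowerScale.rpow_le (hΦ : IsPowerScale Φ κ s₀) (hs₀ : 1 ≤ s₀) {n : ℝ} (hn : s₀ ≤ n) :
    (Φ s₀ / s₀ ^ κ) * n ^ κ ≤ Φ n := by
  have := hΦ.lower s₀ n le_rfl hn
  rw [Real.div_rpow (by linarith) (by linarith)] at this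
  calc _ = n ^ κ / s₀ ^ κ * Φ s₀ := by ring
    _ ≤ _ := this

lemma IsPowerScale.le_rpow (hΦ : IsPowerScale Φ κ s₀) (hs₀ : 1 ≤ s₀) {n : ℝ} (hn : s₀ ≤ n) :
    Φ n ≤ (Φ s₀ / s₀ ^ (1 - κ)) * n ^ (1 - κ) := by
  have := hΦ.upper s₀ n le_rfl hn
  rw [Real.div_rpow (by linarith) (by linarith)] at this
  calc _ ≤ n ^ (1 - κ) / s₀ ^ (1 - κ) * Φ s₀ := this
    _ = _ := by ring

end PowerScale

/-- The scaling condition compares only distances with a ratio up to a square root. Iterating one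
fixed factor `c`, admissible because `c² ≤ y`, reaches all ratios. Each step loses `D₀`, which is
absorbed by half of the exponent because `D₀ ≤ c^(κ₃/2)`. For the remaining factor `ρ` the lower
bound uses monotonicity alone. -/
lemma IsRegularScale.growth {ψ : ℝ → ℝ} {n₀ D₀ κ₃ c : ℝ} (hψ : IsRegularScale ψ n₀ D₀ κ₃)
    (hκ₃ : 0 < κ₃) (hκ₃' : κ₃ < 1 / 2) (hc : 1 < c) (hcD : D₀ ≤ c ^ (κ₃ / 2))
    {y : ℝ} (hy : max n₀ (c ^ 2) ≤ y) (k : ℕ) {ρ : ℝ} (hρ : 1 ≤ ρ) (hρc : ρ ≤ c) :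
    ψ (c ^ k * (ρ * y)) ≤ (c ^ k * ρ) ^ (1 - κ₃) * ψ y ∧
      (c ^ k) ^ (κ₃ / 2) * ψ y ≤ ψ (c ^ k * (ρ * y)) := by
  have hc0 : 0 < c := by linarith
  have hy1 : n₀ ≤ y := (le_max_left _ _).trans hy
  have hy2 : c ^ 2 ≤ y := (le_max_right _ _).trans hy
  have hy0 : 0 < y := lt_of_lt_of_le (by positivity) hy2
  have hroot : ∀ n, y ≤ n → c ≤ n ^ (1 / 2 : ℝ) := by
    intro n hn
    rw [← Real.sqrt_eq_rpow]
    exact Real.le_sqrt_of_sq_le (hy2.trans hn)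
  have hstep : ∀ n, y ≤ n → ∀ r, 1 ≤ r → r ≤ c → ψ (r * n) ≤ r ^ (1 - κ₃) * ψ n ∧
      ψ n ≤ D₀ / r ^ κ₃ * ψ (r * n) := by
    intro n hn r hr hrc
    have hrn : y ≤ r * n := hn.trans (le_mul_of_one_le_left (by linarith) hr)
    have h := hψ.scaling (r * n) (hy1.trans hrn) r hr (hrc.trans (hroot _ hrn))
    rw [mul_div_cancel_left₀ _ (by linarith)] at h
    refine ⟨?_, h.2⟩
    have hp : 0 < r ^ (1 - κ₃) := Real.rpow_pos_of_pos (by linarith) _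
    have := h.1
    rw [one_div, inv_mul_le_iff₀ hp] at this
    exact this
  have hρy : y ≤ ρ * y := le_mul_of_one_le_left hy0.le hρ
  induction k with
  | zero =>
    simp only [pow_zero, one_mul, Real.one_rpow]
    exact ⟨(hstep y le_rfl ρ hρ hρc).1, hψ.mono (Set.mem_Ici.2 hy1)
      (Set.mem_Ici.2 (hy1.trans hρy)) hρy⟩
  | succ k ih =>
    have hn : y ≤ c ^ k * (ρ * y) :=
      hρy.trans (le_mul_of_one_le_left (by positivity) (one_le_pow₀ hc.le))
    obtain ⟨h1, h2⟩ := hstep _ hn c hc.le le_rfl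
    have e : c ^ (k + 1) * (ρ * y) = c * (c ^ k * (ρ * y)) := by ring
    rw [e]
    constructor
    · refine h1.trans ?_
      have e2 : (c ^ (k + 1) * ρ) = c * (c ^ k * ρ) := by ring
      rw [e2, Real.mul_rpow hc0.le (by positivity), mul_assoc]
      gcongr
      exact ih.1
    · have hck : 0 < c ^ (κ₃ / 2) := Real.rpow_pos_of_pos hc0 _
      have h3 : ψ (c ^ k * (ρ * y)) ≤ (c ^ (κ₃ / 2))⁻¹ * ψ (c * (c ^ k * (ρ * y))) := by
        refine h2.trans ?_
        have hp := hψ.pos (c * (c ^ k * (ρ * y))) (by positivity)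
        gcongr
        rw [div_le_iff₀ (by positivity)]
        have : c ^ κ₃ = c ^ (κ₃ / 2) * c ^ (κ₃ / 2) := by
          rw [← Real.rpow_add hc0]; congr 1; ring
        rw [this, inv_mul_cancel_left₀ hck.ne']
        exact hcD
      rw [le_inv_mul_iff₀ hck] at h3
      refine le_trans ?_ h3
      rw [pow_succ', Real.mul_rpow hc0.le (by positivity), mul_assoc]
      gcongr
      exact ih.2

/-- A regular scale function is comparable to a power scale. -/
lemma IsRegularScale.exists_isPowerScale {ψ : ℝ → ℝ} {n₀ D₀ κ₃ : ℝ}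
    (hψ : IsRegularScale ψ n₀ D₀ κ₃) (hD₀ : 1 < D₀) (hκ₃ : 0 < κ₃) (hκ₃' : κ₃ < 1 / 2) :
    ∃ (Φ : ℝ → ℝ) (s₀ D : ℝ), 1 ≤ s₀ ∧ 0 < D ∧ IsPowerScale Φ (κ₃ / 2) s₀ ∧
      ∀ s, s₀ ≤ s → ψ s ≤ Φ s ∧ Φ s ≤ D * ψ s := by
  set κ := κ₃ / 2 with hκ
  have hκ0 : 0 < κ := by positivity
  obtain ⟨c, hc, hcD⟩ : ∃ c : ℝ, 1 < c ∧ D₀ ≤ c ^ κ := by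
    refine ⟨D₀ ^ (1 / κ), Real.one_lt_rpow hD₀ (by positivity), ?_⟩
    rw [← Real.rpow_mul (by linarith), one_div, inv_mul_cancel₀ hκ0.ne', Real.rpow_one]
  have hc0 : 0 < c := by linarith
  set s₀ := max n₀ (c ^ 2) with hs₀
  have hs₀1 : 1 ≤ s₀ := (one_le_pow₀ hc.le).trans (le_max_right _ _)
  have hgrow : ∀ y n, s₀ ≤ y → y ≤ n → ψ n ≤ (n / y) ^ (1 - κ₃) * ψ y ∧
      (n / y) ^ κ * ψ y ≤ c ^ κ * ψ n := by
    intro y n hy hyn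
    have hy0 : 0 < y := by linarith
    obtain ⟨k, hk1, hk2⟩ := exists_nat_pow_near ((one_le_div hy0).2 hyn) hc
    have hck : 0 < c ^ k := by positivity
    have hρ : 1 ≤ n / y / c ^ k := (one_le_div hck).2 hk1
    have hρc : n / y / c ^ k ≤ c := by
      rw [div_le_iff₀ hck]
      rw [pow_succ'] at hk2
      exact hk2.le
    have h := hψ.growth hκ₃ hκ₃' hc hcD hy k hρ hρc
    have e1 : c ^ k * (n / y / c ^ k * y) = n := by field_simp
    have e2 : c ^ k * (n / y / c ^ k) = n / y := by field_simp
    rw [e1, e2] at h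
    refine ⟨h.1, ?_⟩
    have hψy := hψ.pos y hy0
    have hny : 0 ≤ n / y := div_nonneg (by linarith) hy0.le
    calc (n / y) ^ κ * ψ y ≤ (c * c ^ k) ^ κ * ψ y := by
          gcongr
          rw [← pow_succ']
          exact hk2.le
      _ = c ^ κ * ((c ^ k) ^ κ * ψ y) := by rw [Real.mul_rpow hc0.le hck.le, mul_assoc]
      _ ≤ _ := by gcongr; exact h.2
  -- Taking the supremum over all smaller scales, each extended by its minimal growth, gives the
  -- lower power bound with constant one; it exceeds `ψ` by at most the factor `c^κ`.
  set F : ℝ → Set ℝ := fun s => (fun s' => ψ s' * (s / s') ^ κ) '' Set.Icc s₀ s with hF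
  have hbdd : ∀ s, s₀ ≤ s → ∀ x ∈ F s, x ≤ c ^ κ * ψ s := by
    rintro s hs _ ⟨s', hs', rfl⟩
    dsimp only
    rw [mul_comm]
    exact (hgrow s' s hs'.1 hs'.2).2
  have hself : ∀ s, s₀ ≤ s → ψ s ∈ F s := by
    intro s hs
    refine ⟨s, ⟨hs, le_rfl⟩, ?_⟩
    dsimp only
    rw [div_self (by linarith), Real.one_rpow, mul_one]
  have hle : ∀ s, s₀ ≤ s → ψ s ≤ sSup (F s) := fun s hs => le_csSup ⟨_, hbdd s hs⟩ (hself s hs)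
  have hne : ∀ s, s₀ ≤ s → (F s).Nonempty := fun s hs => ⟨_, hself s hs⟩
  refine ⟨fun s => sSup (F s), s₀, c ^ κ, hs₀1, by positivity, ⟨?_, ?_, ?_⟩,
    fun s hs => ⟨hle s hs, csSup_le (hne s hs) (hbdd s hs)⟩⟩
  · exact fun s hs => (hψ.pos s (by linarith)).trans_le (hle s hs)
  · intro y n hy hyn
    have hy0 : 0 < y := by linarith
    have hp : 0 < (n / y) ^ κ := Real.rpow_pos_of_pos (div_pos (by linarith) hy0) _
    rw [mul_comm, ← le_div_iff₀ hp]
    refine csSup_le (hne y hy) ?_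
    rintro _ ⟨s', hs', rfl⟩
    rw [le_div_iff₀ hp]
    refine le_csSup ⟨_, hbdd n (hy.trans hyn)⟩ ⟨s', ⟨hs'.1, hs'.2.trans hyn⟩, ?_⟩
    have hs'0 : 0 < s' := by linarith [hs'.1]
    dsimp only
    rw [mul_assoc, ← Real.mul_rpow (by positivity) (div_nonneg (by linarith) hy0.le)]
    congr 2
    field_simp
  · intro y n hy hyn
    have hy0 : 0 < y := by linarith
    refine csSup_le (hne n (hy.trans hyn)) ?_
    rintro _ ⟨s', hs', rfl⟩
    have hs'0 : 0 < s' := by linarith [hs'.1]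
    have hn0 : 0 < n := by linarith
    have hny : 1 ≤ n / y := (one_le_div hy0).2 hyn
    dsimp only
    rcases le_total s' y with h | h
    · have h1 : ψ s' * (y / s') ^ κ ≤ sSup (F y) := le_csSup ⟨_, hbdd y hy⟩ ⟨s', ⟨hs'.1, h⟩, rfl⟩
      have h2 : (n / y) ^ κ ≤ (n / y) ^ (1 - κ) :=
        Real.rpow_le_rpow_of_exponent_le hny (by rw [hκ]; linarith)
      have h3 : 0 < sSup (F y) := (hψ.pos y hy0).trans_le (hle y hy)
      calc ψ s' * (n / s') ^ κ = (n / y) ^ κ * (ψ s' * (y / s') ^ κ) := by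
            have : n / s' = (n / y) * (y / s') := by field_simp
            rw [this, Real.mul_rpow (by positivity) (by positivity)]
            ring
        _ ≤ (n / y) ^ κ * sSup (F y) := by gcongr
        _ ≤ _ := by gcongr
    · have h1 := (hgrow y s' hy h).1
      have hs'y : 1 ≤ s' / y := (one_le_div hy0).2 h
      have hns' : 1 ≤ n / s' := (one_le_div hs'0).2 hs'.2
      have h2 : (s' / y) ^ (1 - κ₃) ≤ (s' / y) ^ (1 - κ) :=
        Real.rpow_le_rpow_of_exponent_le hs'y (by rw [hκ]; linarith)
      have h3 : (n / s') ^ κ ≤ (n / s') ^ (1 - κ) :=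
        Real.rpow_le_rpow_of_exponent_le hns' (by rw [hκ]; linarith)
      have h4 := hψ.pos y hy0
      calc ψ s' * (n / s') ^ κ ≤ ((s' / y) ^ (1 - κ) * ψ y) * (n / s') ^ (1 - κ) := by
            gcongr
            exact h1.trans (by gcongr)
        _ = (n / y) ^ (1 - κ) * ψ y := by
            have : n / y = (s' / y) * (n / s') := by field_simp
            rw [this, Real.mul_rpow (by positivity) (by positivity)]
            ring
        _ ≤ _ := by
            gcongr
            exact hle y hy

/-! ### Chaining: a single step -/

section UpperChain

variable {d : ℕ} [NeZero d] {Ω : Type*} [MeasurableSpace Ω]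

/-- `x` lies before `u`, at distance about `m`, in a parabolic neighbourhood of the axis. -/
def IsNear (Φ : ℝ → ℝ) (m : ℝ) (u x : EuclideanSpace ℝ (Fin d)) : Prop :=
  m ≤ (u - x) 0 ∧ (u - x) 0 ≤ 2 * m ∧ perp (u - x) ≤ √(m * Φ m)

/-- Some point near `u` has a passage time to `u` that exceeds its first-order value by `E`. -/
def slowEvent (T : Ω → EuclideanSpace ℝ (Fin d) → EuclideanSpace ℝ (Fin d) → ℝ) (μ : ℝ)
    (Φ : ℝ → ℝ) (m : ℝ) (u : EuclideanSpace ℝ (Fin d)) (E : ℝ) : Set Ω :=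
  {ω | ∃ x, IsNear Φ m u x ∧ μ * (u - x) 0 + E < T ω x u}

lemma IsPowerScale.sqrt_le {Φ : ℝ → ℝ} {κ s₀ : ℝ} (hΦ : IsPowerScale Φ κ s₀) (hκ : 0 ≤ κ)
    (hs₀ : 1 ≤ s₀) {c m : ℝ} (hc : 1 ≤ c) (hm : s₀ ≤ m / c) :
    √(m * Φ m) ≤ c * √(m / c * Φ (m / c)) := by
  have hc0 : 0 < c := by linarith
  have hm0 : 0 < m := by
    have : 0 < m / c := by linarith
    by_contra h
    have := div_nonpos_of_nonpos_of_nonneg (not_lt.1 h) hc0.le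
    linarith
  have h1 := hΦ.le_mul hκ hs₀ hm (div_le_self hm0.le hc) (by rw [mul_div_cancel₀ _ hc0.ne'])
  have h2 := hΦ.pos _ hm
  rw [← Real.sqrt_sq hc0.le, ← Real.sqrt_mul (sq_nonneg c), Real.sqrt_sq hc0.le]
  apply Real.sqrt_le_sqrt
  calc m * Φ m ≤ m * (c * Φ (m / c)) := by gcongr
    _ = _ := by field_simp

/-- The point `x`, moved forward by `3/2` of `m / c`, is rounded to the grid; this leaves a forward
gap between one and two times `m / c`. The width shrinks at most by the factor `c` from scale `m` to
`m / c`, so the number of indices depends only on `c` and `d`. -/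
lemma exists_isNear_grid {Φ : ℝ → ℝ} {κ s₀ : ℝ} (hΦ : IsPowerScale Φ κ s₀) (hκ : 0 ≤ κ)
    (hs₀ : 1 ≤ s₀) {c m : ℝ} (hc : 8 ≤ c) (hm : s₀ ≤ m / c) {u x : EuclideanSpace ℝ (Fin d)}
    (hx : IsNear Φ m u x) :
    ∃ k ∈ gridBox d (⌈2 * d * c⌉₊ + 1), IsNear Φ (m / c)
      (gridPoint u (fun i => if i = 0 then m / c else √(m / c * Φ (m / c)) / d) k) x := by
  set l := m / c with hl
  set w := √(l * Φ l) with hw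
  have hc0 : 0 < c := by linarith
  have hl0 : 0 < l := by linarith
  have hml : m = c * l := by rw [hl]; field_simp
  have hΦl := hΦ.pos l hm
  have hw0 : 0 < w := Real.sqrt_pos.2 (mul_pos hl0 hΦl)
  have hd : (1 : ℝ) ≤ d := by exact_mod_cast NeZero.one_le
  set τ : Fin d → ℝ := fun i => if i = 0 then l else w / d with hτdef
  have hτ : ∀ i, 0 < τ i := by
    intro i
    rw [hτdef]
    dsimp only
    split_ifs
    · exact hl0
    · positivity
  obtain ⟨k, hk1, hk2⟩ := exists_gridPoint u (x + axisPoint d (3 / 2 * l)) hτ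
  have hwm : √(m * Φ m) ≤ c * w := hΦ.sqrt_le hκ hs₀ (by linarith) hm
  obtain ⟨hx1, hx2, hx3⟩ := hx
  rw [PiLp.sub_apply] at hx1 hx2
  have hdc : (2 * d * c : ℝ) ≤ ⌈2 * d * c⌉₊ := Nat.le_ceil _
  have hcdc : c ≤ d * c := le_mul_of_one_le_left hc0.le hd
  refine ⟨k, ?_, ?_, ?_, ?_⟩
  · rw [mem_gridBox]
    intro i
    have h1 : |(k i : ℝ)| ≤ 2 * d * c + 1 := by
      refine (hk2 i).trans ?_
      by_cases hi : i = 0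
      · subst hi
        have h2 : |(x + axisPoint d (3 / 2 * l)) 0 - u 0| ≤ 2 * (c * l) := by
          rw [PiLp.add_apply, axisPoint_apply_zero, abs_le]
          constructor <;> nlinarith
        have h3 : |(x + axisPoint d (3 / 2 * l)) 0 - u 0| / τ 0 ≤ 2 * c := by
          have : τ 0 = l := if_pos rfl
          rw [this, div_le_iff₀ hl0]
          linarith
        linarith
      · have h2 : |(x + axisPoint d (3 / 2 * l)) i - u i| ≤ c * w := by
          rw [PiLp.add_apply, axisPoint_apply_ne hi, add_zero, abs_sub_comm, ← PiLp.sub_apply]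
          exact (abs_apply_le_perp _ hi).trans (hx3.trans hwm)
        have h3 : |(x + axisPoint d (3 / 2 * l)) i - u i| / τ i ≤ d * c := by
          have : τ i = w / d := if_neg hi
          rw [this, div_le_iff₀ (by positivity)]
          refine h2.trans (le_of_eq ?_)
          field_simp
        linarith
    have h2 : |(k i : ℝ)| ≤ ((⌈2 * d * c⌉₊ + 1 : ℕ) : ℝ) := by push_cast; linarith
    rw [← Int.cast_abs] at h2
    exact_mod_cast h2
  · have h0 := hk1 0
    have : τ 0 = l := if_pos rfl
    rw [this, PiLp.add_apply, axisPoint_apply_zero, abs_le] at h0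
    rw [PiLp.sub_apply]
    linarith
  · have h0 := hk1 0
    have : τ 0 = l := if_pos rfl
    rw [this, PiLp.add_apply, axisPoint_apply_zero, abs_le] at h0
    rw [PiLp.sub_apply]
    linarith
  · have h2 : perp (gridPoint u τ k - x) ≤ d * (w / d / 2) := by
      refine perp_le_of_forall_abs_le (by positivity) fun i hi => ?_
      have h0 := hk1 i
      have : τ i = w / d := if_neg hi
      rw [this, PiLp.add_apply, axisPoint_apply_ne hi, add_zero, abs_sub_comm] at h0
      rwa [PiLp.sub_apply]
    have e : d * (w / d / 2) = w / 2 := by field_simp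
    rw [e] at h2
    linarith

variable {P : Measure Ω} [IsProbabilityMeasure P]
  {T : Ω → EuclideanSpace ℝ (Fin d) → EuclideanSpace ℝ (Fin d) → ℝ} {h ψ : ℝ → ℝ}
  {C₀ C₁ κ₁ κ₂ μ : ℝ}

lemma prob_biUnion_le {ι : Type*} (s : Finset ι) (A : ι → Set Ω) {p : ℝ}
    (hp : ∀ i ∈ s, P.real (A i) ≤ p) : P.real (⋃ i ∈ s, A i) ≤ s.card * p := by
  refine (measureReal_biUnion_finset_le s A).trans ?_
  refine (Finset.sum_le_card_nsmul s _ p hp).trans ?_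
  rw [nsmul_eq_mul]

/-- The path from `x` to `u` is taken through a grid point. By Pythagoras the transverse offset adds
only `4 Φ m` to the distance from the grid point to `u`. So a slow `x` forces either a slow point on
scale `m / c` near some grid point, or a deviation by `τ` between a grid point and `u`. The number
of grid points does not depend on `m`. -/
lemma prob_slowEvent_step (hT : IsPassageModel P T h ψ C₀ C₁ κ₁ κ₂) (hC₁ : 0 ≤ C₁) (hκ₂ : 0 ≤ κ₂)
    (hC₀ : 0 ≤ C₀)
    (hμ : 0 ≤ μ) {Φ : ℝ → ℝ} {κ s₀ : ℝ} (hΦ : IsPowerScale Φ κ s₀) (hκ : 0 ≤ κ)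
    (hs₀ : 1 ≤ s₀) (hψ : ∀ s, s₀ ≤ s → ψ s ≤ Φ s) {M : ℝ} (hM : 0 ≤ M)
    (hh : ∀ s, s₀ ≤ s → h s ≤ μ * s + M * Φ s)
    {c m τ : ℝ} (hc : 8 ≤ c) (hm : s₀ ≤ m / c) (hΦm : Φ m ≤ m / 2) (hτ : 1 ≤ τ)
    (hτ' : τ ≤ C₀ * (m / 2) ^ κ₂) {E p : ℝ}
    (hp : ∀ v : EuclideanSpace ℝ (Fin d), P.real (slowEvent T μ Φ (m / c) v E) ≤ p)
    (u : EuclideanSpace ℝ (Fin d)) :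
    P.real (slowEvent T μ Φ m u (E + (4 + 4 * μ) * (τ + M) * Φ m)) ≤
      (2 * (⌈2 * d * c⌉₊ + 1) + 1 : ℝ) ^ d * (p + C₁ * Real.exp (-C₀ * τ ^ κ₁)) := by
  have hc0 : 0 < c := by linarith
  have hl0 : 0 < m / c := by linarith
  have hml : m = c * (m / c) := by field_simp
  have hm8 : 8 * (m / c) ≤ m := by
    conv_rhs => rw [hml]
    gcongr
  have hm0 : 0 < m := by linarith
  have hms : s₀ ≤ m / 2 := by linarith
  set R : ℕ := ⌈2 * d * c⌉₊ + 1 with hR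
  set G : (Fin d → ℤ) → EuclideanSpace ℝ (Fin d) := fun k =>
    gridPoint u (fun i => if i = 0 then m / c else √(m / c * Φ (m / c)) / d) k with hG
  set D : (Fin d → ℤ) → Set Ω := fun k =>
    {ω | m / 2 ≤ ‖G k - u‖ ∧ τ * ψ ‖G k - u‖ < |T ω (G k) u - h ‖G k - u‖|} with hD
  have hDp : ∀ k, P.real (D k) ≤ C₁ * Real.exp (-C₀ * τ ^ κ₁) := by
    intro k
    by_cases hk : m / 2 ≤ ‖G k - u‖
    · refine le_trans (measureReal_mono (fun ω hω => hω.2) (measure_ne_top _ _))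
        (hT.conc (G k) u (by linarith) τ (by linarith) (hτ'.trans ?_))
      gcongr
    · have : D k = ∅ := by
        ext ω
        simp only [hD, Set.mem_ofPred_eq, Set.mem_empty_iff_false, iff_false, not_and]
        exact fun h => absurd h hk
      rw [this, measureReal_empty]
      positivity
  have hsub : ∀ᵐ ω ∂P, ω ∈ slowEvent T μ Φ m u (E + (4 + 4 * μ) * (τ + M) * Φ m) →
      ω ∈ ⋃ k ∈ gridBox d R, (slowEvent T μ Φ (m / c) (G k) E ∪ D k) := by
    filter_upwards [hT.metric] with ω hω
    rintro ⟨x, hx, hxu⟩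
    obtain ⟨k, hk, hnear⟩ := exists_isNear_grid hΦ hκ hs₀ hc hm hx
    refine Set.mem_biUnion hk ?_
    change IsNear Φ (m / c) (G k) x at hnear
    by_contra hcon
    rw [Set.mem_union, not_or] at hcon
    obtain ⟨hcon1, hcon2⟩ := hcon
    have h1 : T ω x (G k) ≤ μ * (G k - x) 0 + E := by
      by_contra h'
      exact hcon1 ⟨x, hnear, not_le.1 h'⟩
    obtain ⟨hx1, hx2, hx3⟩ := hx
    obtain ⟨hn1, hn2, hn3⟩ := hnear
    have e1 : (u - G k) 0 = (u - x) 0 - (G k - x) 0 := by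
      simp only [PiLp.sub_apply]; ring
    have h2 : m / 2 ≤ (u - G k) 0 := by rw [e1]; linarith
    have h3 : (u - G k) 0 ≤ 2 * m := by rw [e1]; linarith
    have hΦm0 := hΦ.pos m (by linarith)
    have hwl : √(m / c * Φ (m / c)) ≤ √(m * Φ m) := by
      apply Real.sqrt_le_sqrt
      have := hΦ.mono hκ hs₀ hm (by linarith : m / c ≤ m)
      have := hΦ.pos _ hm
      gcongr
      linarith
    have h4 : perp (u - G k) ≤ 2 * √(m * Φ m) := by
      have e2 : u - G k = (u - x) - (G k - x) := by abel
      rw [e2]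
      refine (perp_sub_le _ _).trans ?_
      linarith
    have h5 : perp (u - G k) ^ 2 ≤ 4 * (m * Φ m) := by
      have := pow_le_pow_left₀ (perp_nonneg _) h4 2
      rw [mul_pow, Real.sq_sqrt (by positivity)] at this
      linarith
    have h6 : ‖u - G k‖ ≤ (u - G k) 0 + 4 * Φ m := by
      have h7 := norm_sub_apply_zero_le (x := u - G k) (by linarith)
      have h8 : perp (u - G k) ^ 2 / (2 * (u - G k) 0) ≤ 4 * Φ m := by
        rw [div_le_iff₀ (by linarith)]
        nlinarith
      linarith
    have h7 : m / 2 ≤ ‖u - G k‖ := h2.trans ((le_abs_self _).trans (abs_apply_le_norm _ 0))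
    rw [norm_sub_rev] at h6 h7
    have h8 : T ω (G k) u ≤ h ‖G k - u‖ + τ * ψ ‖G k - u‖ := by
      by_contra h'
      refine hcon2 ⟨h7, lt_of_lt_of_le ?_ (le_abs_self _)⟩
      linarith
    have hs : s₀ ≤ ‖G k - u‖ := hms.trans h7
    have h9 : Φ ‖G k - u‖ ≤ 4 * Φ m := by
      rcases le_total ‖G k - u‖ m with h' | h'
      · have := hΦ.mono hκ hs₀ hs h'
        linarith
      · exact hΦ.le_mul hκ hs₀ (by linarith) h' (by linarith)
    have h10 := hh _ hs
    have h11 := hψ _ hs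
    have h12 : τ * ψ ‖G k - u‖ ≤ τ * (4 * Φ m) :=
      mul_le_mul_of_nonneg_left (h11.trans h9) (by linarith)
    have h13 : M * Φ ‖G k - u‖ ≤ M * (4 * Φ m) := mul_le_mul_of_nonneg_left h9 hM
    have h14 : μ * ‖G k - u‖ ≤ μ * ((u - G k) 0 + 4 * Φ m) := mul_le_mul_of_nonneg_left h6 hμ
    have h15 := hω.2.2 x (G k) u
    have h16 : μ * Φ m ≤ μ * (τ + M) * Φ m := by
      have : μ * 1 ≤ μ * (τ + M) := mul_le_mul_of_nonneg_left (by linarith) hμ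
      nlinarith
    rw [e1] at h14
    linarith
  have h1 : P.real (slowEvent T μ Φ m u (E + (4 + 4 * μ) * (τ + M) * Φ m)) ≤
      P.real (⋃ k ∈ gridBox d R, (slowEvent T μ Φ (m / c) (G k) E ∪ D k)) :=
    ENNReal.toReal_mono (measure_ne_top _ _) (measure_mono_ae hsub)
  refine h1.trans ((prob_biUnion_le _ _ (p := p + C₁ * Real.exp (-C₀ * τ ^ κ₁))
    fun k _ => ?_).trans (le_of_eq ?_))
  · exact (measureReal_union_le _ _).trans (add_le_add (hp _) (hDp k))
  · rw [card_gridBox]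
    push_cast [hR]
    ring

end UpperChain

/-! ### Chaining: iteration over all scales -/

section UpperChain

variable {d : ℕ} [NeZero d] {Ω : Type*} [MeasurableSpace Ω]
  {P : Measure Ω} [IsProbabilityMeasure P]
  {T : Ω → EuclideanSpace ℝ (Fin d) → EuclideanSpace ℝ (Fin d) → ℝ} {h ψ : ℝ → ℝ}
  {C₀ C₁ κ₁ κ₂ μ : ℝ}

lemma slowEvent_anti (Φ : ℝ → ℝ) (m : ℝ) (u : EuclideanSpace ℝ (Fin d)) {E E' : ℝ} (h : E ≤ E') :
    slowEvent T μ Φ m u E' ⊆ slowEvent T μ Φ m u E := by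
  rintro ω ⟨x, hx, hxu⟩
  exact ⟨x, hx, by linarith⟩

/-- On the scale `n^(κ/4)` the almost linear bound gives passage times of order `n^(κ/2)`, which is
below `Φ n`. Chaining can therefore stop there. -/
lemma prob_slowEvent_base (hT : IsPassageModel P T h ψ C₀ C₁ κ₁ κ₂) (hμ : 0 ≤ μ) {κ : ℝ}
    (hκ : 0 < κ) (hκ' : κ < 1 / 2) :
    ∃ σ : ℝ, 0 < σ ∧ ∀ b c : ℝ, 0 < b → ∀ᶠ n : ℝ in atTop, ∀ m, n ^ (κ / 4) ≤ m → m ≤ c * n ^ (κ / 4) →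
      ∀ Φ : ℝ → ℝ, b * n ^ κ ≤ Φ n → Φ m ≤ m → ∀ u : EuclideanSpace ℝ (Fin d),
        P.real (slowEvent T μ Φ m u (Φ n)) ≤ Real.exp (-n ^ σ) := by
  obtain ⟨σ, hσ, hlin⟩ := hT.linear (κ / 4) (by positivity)
  refine ⟨σ, hσ, fun b c hb => ?_⟩
  filter_upwards [hlin, eventually_mul_rpow_le (3 * c) (show κ / 4 < 2 by linarith),
    eventually_mul_rpow_le (4 * c / b) (show κ / 2 < κ by linarith), eventually_ge_atTop 1]
    with n hn h1 h2 hn1 m hm1 hm2 Φ hΦ hΦm u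
  refine le_trans (measureReal_mono ?_ (measure_ne_top _ _)) (hn u)
  rintro ω ⟨x, ⟨hx1, hx2, hx3⟩, hxu⟩
  have hn1' : 1 ≤ n ^ (κ / 4) := Real.one_le_rpow hn1 (by positivity)
  have hm0 : 0 < m := by linarith
  have hw : √(m * Φ m) ≤ m := by
    rw [Real.sqrt_le_left hm0.le, sq]
    gcongr
  have h3 : ‖u - x‖ ≤ 3 * m := by
    refine (norm_le_abs_add_perp _).trans ?_
    rw [abs_of_nonneg (by linarith)]
    linarith
  refine ⟨x, u, ?_, ?_, lt_of_le_of_lt ?_ hxu⟩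
  · rw [norm_sub_rev]
    nlinarith
  · rw [sub_self, norm_zero]
    positivity
  · rw [norm_sub_rev]
    have h4 : 0 ≤ μ * (u - x) 0 := mul_nonneg hμ (by linarith)
    have h5 : n ^ (κ / 2) = n ^ (κ / 4) * n ^ (κ / 4) := by
      rw [← Real.rpow_add (by linarith)]; congr 1; ring
    rw [div_mul_eq_mul_div, div_le_iff₀ hb] at h2
    have h6 : ‖u - x‖ + 1 ≤ 4 * c * n ^ (κ / 4) := by nlinarith
    calc n ^ (κ / 4) * (‖u - x‖ + 1) ≤ n ^ (κ / 4) * (4 * c * n ^ (κ / 4)) := by gcongr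
      _ = 4 * c * n ^ (κ / 2) := by rw [h5]; ring
      _ ≤ _ := by linarith

lemma eventually_mul_exp_rpow_le (N : ℝ) {c a ε : ℝ} (hc : 0 < c) (ha : 0 < a) (hε : 0 < ε) :
    ∀ᶠ t : ℝ in atTop, N * Real.exp (-(c * t ^ a)) ≤ ε := by
  have h1 : Tendsto (fun t : ℝ => N * Real.exp (-(c * t ^ a))) atTop (nhds (N * 0)) :=
    (Real.tendsto_exp_neg_atTop_nhds_zero.comp
      ((tendsto_rpow_atTop ha).const_mul_atTop hc)).const_mul N
  rw [mul_zero] at h1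
  exact h1.eventually_le_const hε

/-- Doubling `t` gains in the exponent because `2^κ₁ > 1`, and halving `C₀` leaves room for the
second term. Both gains beat the fixed number `N` of grid points, so the same form of bound passes
from one scale to the next. -/
lemma eventually_step_exp_le (N C₁ : ℝ) (hC₀ : 0 < C₀) (hκ₁ : 0 < κ₁) :
    ∀ᶠ t : ℝ in atTop, N * (Real.exp (-(C₀ / 2) * (2 * t) ^ κ₁) + C₁ * Real.exp (-C₀ * t ^ κ₁)) ≤
      Real.exp (-(C₀ / 2) * t ^ κ₁) := by
  have h2 : (1 : ℝ) < 2 ^ κ₁ := Real.one_lt_rpow one_lt_two hκ₁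
  filter_upwards [eventually_mul_exp_rpow_le N (c := C₀ / 2 * (2 ^ κ₁ - 1)) (a := κ₁)
      (by have : 0 < (2 : ℝ) ^ κ₁ - 1 := by linarith
          positivity) hκ₁ one_half_pos,
    eventually_mul_exp_rpow_le (N * C₁) (c := C₀ / 2) (half_pos hC₀) hκ₁ one_half_pos,
    eventually_ge_atTop 0] with t h3 h4 ht
  rw [Real.mul_rpow zero_le_two ht]
  have e1 : Real.exp (-(C₀ / 2) * (2 ^ κ₁ * t ^ κ₁)) =
      Real.exp (-(C₀ / 2 * (2 ^ κ₁ - 1) * t ^ κ₁)) * Real.exp (-(C₀ / 2) * t ^ κ₁) := by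
    rw [← Real.exp_add]; congr 1; ring
  have e2 : Real.exp (-C₀ * t ^ κ₁) =
      Real.exp (-(C₀ / 2 * t ^ κ₁)) * Real.exp (-(C₀ / 2) * t ^ κ₁) := by
    rw [← Real.exp_add]; congr 1; ring
  rw [e1, e2]
  have := Real.exp_pos (-(C₀ / 2) * t ^ κ₁)
  nlinarith

set_option maxHeartbeats 800000 in
/-- Chaining: the passage times from all points near `u` to `u` are simultaneously bounded by their
first-order values up to the fluctuation scale. -/
lemma exists_upperChain (hT : IsPassageModel P T h ψ C₀ C₁ κ₁ κ₂) (hC₀ : 0 < C₀) (hC₁ : 0 < C₁)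
    (hκ₁ : 0 < κ₁) (hκ₂ : 0 < κ₂) (hμ : 0 < μ) {κ b B s₀ : ℝ} (hκ : 0 < κ) (hκ' : κ < 1 / 2)
    (hb : 0 < b) (hs₀ : 1 ≤ s₀) :
    ∃ C t₀ δ n₁ : ℝ, 0 < C ∧ 1 ≤ t₀ ∧ 0 < δ ∧ ∀ Φ : ℝ → ℝ, IsPowerScale Φ κ s₀ →
      (∀ s, s₀ ≤ s → ψ s ≤ Φ s) → (∀ s, s₀ ≤ s → b * s ^ κ ≤ Φ s ∧ Φ s ≤ B * s ^ (1 - κ)) →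
      ∀ M, 0 ≤ M → (∀ s, s₀ ≤ s → h s ≤ μ * s + M * Φ s) → ∀ n, n₁ ≤ n → ∀ t, t₀ ≤ t → t ≤ n ^ δ →
        ∀ u : EuclideanSpace ℝ (Fin d),
          P.real (slowEvent T μ Φ n u (C * (t + M) * Φ n)) ≤ Real.exp (-(C₀ / 2) * t ^ κ₁) := by
  obtain ⟨σ, hσ, hbase⟩ := prob_slowEvent_base (h := h) (ψ := ψ) (μ := μ) hT hμ.le hκ hκ'
  -- All deviation parameters stay below `n^(2γ)`. This `γ` keeps them in the range of the
  -- concentration hypothesis even on the smallest scale, and keeps their probability bounds above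
  -- the failure probability `exp(-n^σ)` of the base scale.
  set γ := min (κ / 4 * κ₂) (σ / κ₁) / 4 with hγ
  have hγ0 : 0 < γ := by
    have : 0 < min (κ / 4 * κ₂) (σ / κ₁) := lt_min (by positivity) (by positivity)
    positivity
  have hγ1 : 2 * γ < κ / 4 * κ₂ := by
    have := min_le_left (κ / 4 * κ₂) (σ / κ₁)
    linarith
  have hγ2 : 2 * γ * κ₁ < σ := by
    have h1 := min_le_right (κ / 4 * κ₂) (σ / κ₁)
    have h2 : 2 * γ < σ / κ₁ := by linarith
    rwa [lt_div_iff₀ hκ₁] at h2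
  -- Passing to the next smaller scale divides `Φ` by at least `4` while the deviation parameter
  -- doubles, so the errors are summable. The condition `2 ≤ c^γ` bounds `2^J` by `n^γ` for the
  -- number `J` of scales.
  obtain ⟨c, hc8, hcκ, hcγ⟩ : ∃ c : ℝ, 8 ≤ c ∧ 4 ≤ c ^ κ ∧ 2 ≤ c ^ γ :=
    ((eventually_ge_atTop 8).and (((tendsto_rpow_atTop hκ).eventually_ge_atTop 4).and
      ((tendsto_rpow_atTop hγ0).eventually_ge_atTop 2))).exists
  have hc0 : 0 < c := by linarith
  set N : ℝ := (2 * (⌈2 * d * c⌉₊ + 1) + 1 : ℝ) ^ d with hN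
  obtain ⟨t₀, ht₀⟩ := eventually_atTop.1 ((eventually_step_exp_le N C₁ hC₀ hκ₁).and
    (eventually_ge_atTop 1))
  have hκ4 : 0 < κ / 4 := by positivity
  obtain ⟨m₁, hm₁⟩ := eventually_atTop.1
    (eventually_mul_rpow_le (2 * B) (show 1 - κ < 1 by linarith))
  obtain ⟨n₁, hn₁⟩ := eventually_atTop.1 ((hbase b c hb).and
    (((tendsto_rpow_atTop hκ4).eventually_ge_atTop (max s₀ m₁)).and
    ((eventually_mul_rpow_le (2 ^ κ₂ / C₀) hγ1).and
    ((eventually_mul_rpow_le (C₀ / 2) hγ2).and (eventually_ge_atTop 1)))))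
  refine ⟨1 + 2 * (4 + 4 * μ), t₀, γ, n₁, by positivity, (ht₀ t₀ le_rfl).2, hγ0, ?_⟩
  intro Φ hΦ hψ hbB M hM hh n hn t ht htn u
  obtain ⟨hb1, hb2, hb3, hb4, hn1⟩ := hn₁ n hn
  have hn0 : 0 < n := by linarith
  have ht1 : 1 ≤ t := (ht₀ t ht).2
  obtain ⟨J, hJ1, hJ2⟩ := exists_nat_pow_near
    (Real.one_le_rpow hn1 (show 0 ≤ 1 - κ / 4 by linarith)) (show 1 < c by linarith)
  have hnρ : n ^ (κ / 4) * n ^ (1 - κ / 4) = n := by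
    rw [← Real.rpow_add hn0]
    simp
  have hρ0 : 0 < n ^ (κ / 4) := Real.rpow_pos_of_pos hn0 _
  have hlevel : ∀ a, a ≤ J → n ^ (κ / 4) ≤ n / c ^ a := by
    intro a ha
    rw [le_div_iff₀ (by positivity)]
    calc n ^ (κ / 4) * c ^ a ≤ n ^ (κ / 4) * n ^ (1 - κ / 4) := by
          gcongr
          exact (pow_le_pow_right₀ (by linarith) ha).trans hJ1
      _ = n := hnρ
  have hlast : n / c ^ J ≤ c * n ^ (κ / 4) := by
    rw [div_le_iff₀ (by positivity)]
    calc n = n ^ (κ / 4) * n ^ (1 - κ / 4) := hnρ.symm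
      _ ≤ n ^ (κ / 4) * c ^ (J + 1) := by gcongr
      _ = _ := by ring
  have hsmall : ∀ m, n ^ (κ / 4) ≤ m → Φ m ≤ m / 2 := by
    intro m hm
    have h1 := hm₁ m ((le_max_right _ _).trans (hb2.trans hm))
    rw [Real.rpow_one] at h1
    have h2 := (hbB m ((le_max_left _ _).trans (hb2.trans hm))).2
    linarith
  have hs₀n : s₀ ≤ n := ((le_max_left _ _).trans hb2).trans (by simpa using hlevel 0 (Nat.zero_le _))
  have h2J : (2 : ℝ) ^ J * t ≤ n ^ (2 * γ) := by
    have h1 : (2 : ℝ) ^ J ≤ n ^ γ := by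
      calc (2 : ℝ) ^ J ≤ (c ^ γ) ^ J := by gcongr
        _ = (c ^ J) ^ γ := by
          rw [← Real.rpow_natCast, ← Real.rpow_natCast, ← Real.rpow_mul hc0.le,
            ← Real.rpow_mul hc0.le, mul_comm]
        _ ≤ (n ^ (1 - κ / 4)) ^ γ := by gcongr
        _ ≤ n ^ γ := by
          gcongr
          exact Real.rpow_le_self_of_one_le hn1 (by linarith)
    calc (2 : ℝ) ^ J * t ≤ n ^ γ * n ^ γ := by gcongr
      _ = _ := by rw [← Real.rpow_add hn0]; congr 1; ring
  have hΦn := hΦ.pos n hs₀n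
  -- The bracket contains the tails of the geometric series of errors from the scales below `n /
  -- c^a`. The induction starts at the smallest scale, `a = J`, and ends at `a = 0`.
  have hmain : ∀ j a : ℕ, a + j = J → ∀ u : EuclideanSpace ℝ (Fin d),
      P.real (slowEvent T μ Φ (n / c ^ a) u
        (Φ n * (1 + 2 * (4 + 4 * μ) * (t / 2 ^ a + M / 4 ^ a)))) ≤
      Real.exp (-(C₀ / 2) * (2 ^ a * t) ^ κ₁) := by
    intro j
    induction j with
    | zero =>
      intro a ha u
      obtain rfl : a = J := by omega
      refine (measureReal_mono (slowEvent_anti Φ _ u (E := Φ n) ?_) (measure_ne_top _ _)).trans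
        ((hb1 _ (hlevel a le_rfl) hlast Φ (hbB n hs₀n).1 ?_ u).trans ?_)
      · have h1 : 0 ≤ 2 * (4 + 4 * μ) * (t / 2 ^ a + M / 4 ^ a) := by positivity
        nlinarith
      · have h1 := hsmall _ (hlevel a le_rfl)
        have h2 := hlevel a le_rfl
        linarith
      · apply Real.exp_le_exp.2
        have h1 : (2 ^ a * t) ^ κ₁ ≤ (n ^ (2 * γ)) ^ κ₁ := by gcongr
        rw [← Real.rpow_mul hn0.le] at h1
        nlinarith
    | succ j ih =>
      intro a ha u
      have ih' := ih (a + 1) (by omega)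
      have e : n / c ^ (a + 1) = n / c ^ a / c := by rw [pow_succ]; field_simp
      rw [e] at ih'
      have hla := hlevel a (by omega)
      have hls := hlevel (a + 1) (by omega)
      have hτ1 : 1 ≤ 2 ^ a * t := one_le_mul_of_one_le_of_one_le (one_le_pow₀ one_le_two) ht1
      have hτt : t₀ ≤ 2 ^ a * t := ht.trans (le_mul_of_one_le_left (by linarith)
        (one_le_pow₀ one_le_two))
      have hstep := prob_slowEvent_step hT hC₁.le hκ₂.le hC₀.le hμ.le hΦ hκ.le hs₀ hψ hM hh hc8
        (m := n / c ^ a) (τ := 2 ^ a * t)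
        (by rw [← e]; exact (le_max_left _ _).trans (hb2.trans hls)) (hsmall _ hla) hτ1 ?_ ih' u
      · refine (measureReal_mono (slowEvent_anti Φ _ u ?_) (measure_ne_top _ _)).trans
          (hstep.trans ?_)
        · have h1 : Φ (n / c ^ a) ≤ Φ n / 4 ^ a := by
            have h2 := hΦ.lower (n / c ^ a) n ((le_max_left _ _).trans (hb2.trans hla))
              (div_le_self hn0.le (one_le_pow₀ (by linarith)))
            have h3 : (4 : ℝ) ^ a ≤ (n / (n / c ^ a)) ^ κ := by
              rw [div_div_cancel₀ hn0.ne', ← Real.rpow_natCast, ← Real.rpow_natCast,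
                ← Real.rpow_mul hc0.le, mul_comm (a : ℝ), Real.rpow_mul hc0.le]
              gcongr
            have h4 := hΦ.pos (n / c ^ a) ((le_max_left _ _).trans (hb2.trans hla))
            rw [le_div_iff₀ (by positivity)]
            nlinarith
          have h2 : (4 + 4 * μ) * (2 ^ a * t + M) * Φ (n / c ^ a) ≤
              (4 + 4 * μ) * (2 ^ a * t + M) * (Φ n / 4 ^ a) := by gcongr
          have h3 : (4 : ℝ) ^ a = 2 ^ a * 2 ^ a := by rw [← mul_pow]; norm_num
          have h4 : (0 : ℝ) < 2 ^ a := by positivity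
          have h5 : (2 ^ a * t + M) * (Φ n / 4 ^ a) = Φ n * (t / 2 ^ a + M / 4 ^ a) := by
            rw [h3]; field_simp
          rw [mul_assoc (4 + 4 * μ) (2 ^ a * t + M) (Φ n / 4 ^ a), h5] at h2
          refine (add_le_add_right h2 _).trans ?_
          have h6 : t / 2 ^ (a + 1) = t / 2 ^ a / 2 := by rw [pow_succ]; field_simp
          have h7 : M / 4 ^ (a + 1) = M / 4 ^ a / 4 := by rw [pow_succ]; field_simp
          rw [h6, h7]
          have h8 : 0 ≤ Φ n * (4 + 4 * μ) * (M / 4 ^ a) := by positivity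
          linarith
        · have h1 := (ht₀ _ hτt).1
          rw [pow_succ', mul_assoc (2 : ℝ) (2 ^ a) t]
          exact h1
      · have h1 : (2 : ℝ) ^ a ≤ 2 ^ J := pow_le_pow_right₀ one_le_two (by omega)
        have h2 : (2 : ℝ) ^ a * t ≤ n ^ (2 * γ) :=
          (mul_le_mul_of_nonneg_right h1 (by linarith)).trans h2J
        have h3 : (n ^ (κ / 4)) ^ κ₂ ≤ (n / c ^ a) ^ κ₂ := by gcongr
        rw [← Real.rpow_mul hn0.le] at h3
        rw [div_mul_eq_mul_div, div_le_iff₀ hC₀] at hb3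
        have h5 : (0 : ℝ) < 2 ^ κ₂ := by positivity
        rw [Real.div_rpow (by positivity) zero_le_two, ← mul_div_assoc, le_div_iff₀ h5]
        nlinarith
  have hfin := hmain J 0 (by omega) u
  simp only [pow_zero, div_one, one_mul] at hfin
  refine (measureReal_mono (slowEvent_anti Φ _ u ?_) (measure_ne_top _ _)).trans hfin
  have : 0 ≤ Φ n * (t + M - 1) := mul_nonneg hΦn.le (by linarith)
  nlinarith

end UpperChain

/-! ### Simultaneous lower bounds with a polynomial loss -/

section MidPoint

variable {d : ℕ} [NeZero d] {Ω : Type*} [MeasurableSpace Ω]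
  {P : Measure Ω} [IsProbabilityMeasure P]
  {T : Ω → EuclideanSpace ℝ (Fin d) → EuclideanSpace ℝ (Fin d) → ℝ} {h ψ : ℝ → ℝ}
  {C₀ C₁ κ₁ κ₂ μ A : ℝ}

lemma IsMeanTime.const_nonneg (hh : IsMeanTime h μ A) : 0 ≤ A := by
  have h1 := hh.upper 0 le_rfl
  have h2 := hh.lower 0 le_rfl
  linarith

lemma IsMeanTime.le_mul (hh : IsMeanTime h μ A) {s : ℝ} (hs : 1 ≤ s) : h s ≤ 2 * A * s := by
  have h1 := hh.upper s (by linarith)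
  have h2 := hh.const_nonneg
  nlinarith

lemma eventually_card_mul_exp_le (d : ℕ) (K C : ℝ) {c a ε : ℝ} (hK : 0 ≤ K) (hC : 0 ≤ C)
    (hc : 0 < c) (ha : 0 < a) (hε : 0 < ε) :
    ∀ᶠ r : ℝ in atTop, (2 * (⌈K * r⌉₊ + 1) + 1 : ℝ) ^ d * (C * Real.exp (-c * r ^ a)) ≤ ε := by
  filter_upwards [eventually_poly_mul_exp_le ((2 * K + 5) ^ d * C) d hc (half_pos ha)
    (half_lt_self ha), eventually_mul_exp_rpow_le 1 (c := 1) one_pos (half_pos ha) hε,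
    eventually_ge_atTop 1] with r h1 h2 hr
  rw [one_mul, one_mul] at h2
  refine le_trans ?_ (h1.trans h2)
  have h3 : (2 * (⌈K * r⌉₊ + 1) + 1 : ℝ) ≤ (2 * K + 5) * r := by
    have := (Nat.ceil_lt_add_one (show 0 ≤ K * r by positivity)).le
    linarith
  calc (2 * (⌈K * r⌉₊ + 1) + 1 : ℝ) ^ d * (C * Real.exp (-c * r ^ a))
      ≤ ((2 * K + 5) * r) ^ d * (C * Real.exp (-c * r ^ a)) := by gcongr
    _ = _ := by rw [mul_pow, Real.rpow_natCast]; ring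

set_option maxHeartbeats 800000 in
/-- Up to a small power of the distance, passage times from a point are simultaneously bounded from
below by their means. -/
lemma prob_lt_mean_sub_le (hT : IsPassageModel P T h ψ C₀ C₁ κ₁ κ₂) (hh : IsMeanTime h μ A)
    (hC₀ : 0 < C₀) (hC₁ : 0 < C₁) (hκ₁ : 0 < κ₁) (hκ₂ : 0 < κ₂) {Φ : ℝ → ℝ} {κ s₀ : ℝ}
    (hΦ : IsPowerScale Φ κ s₀) (hκ : 0 < κ) (hs₀ : 1 ≤ s₀) (hψ : ∀ s, s₀ ≤ s → ψ s ≤ Φ s)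
    {K κ' : ℝ} (hK : 1 ≤ K) (hκ' : 0 < κ') :
    ∀ᶠ r : ℝ in atTop, ∀ a : EuclideanSpace ℝ (Fin d),
      P.real {ω | ∃ z, r ≤ ‖z - a‖ ∧ ‖z - a‖ ≤ K * r ∧ T ω a z < h ‖z - a‖ - r ^ κ' * Φ r} ≤
        1 / 8 := by
  obtain ⟨σ', hσ', hlin⟩ := hT.linear (κ / 2) (by positivity)
  -- Deviations of size `r^θ` lie in the admissible range, beat the polynomial number of grid
  -- points, and are of smaller order than the allowed `r^κ'`.
  set θ := min (κ' / 2) (κ₂ / 2) with hθ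
  have hθ0 : 0 < θ := lt_min (by positivity) (by positivity)
  have hθ1 : θ < κ' := (min_le_left _ _).trans_lt (half_lt_self hκ')
  have hθ2 : θ < κ₂ := (min_le_right _ _).trans_lt (half_lt_self hκ₂)
  have hA := hh.const_nonneg
  have hb : 0 < Φ s₀ / s₀ ^ κ := div_pos (hΦ.pos _ le_rfl) (Real.rpow_pos_of_pos (by linarith) _)
  filter_upwards [hlin, eventually_card_mul_exp_le d K C₁ (a := θ * κ₁) (ε := 1 / 16)
      (by linarith) hC₁.le hC₀ (by positivity) (by norm_num),
    eventually_mul_exp_rpow_le 1 (c := 1) (a := σ') (ε := 1 / 16) one_pos hσ' (by norm_num),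
    eventually_mul_rpow_le (2 ^ κ₂ / C₀) hθ2, eventually_mul_rpow_le (2 * K) hθ1,
    eventually_mul_rpow_le ((A + 1) * (2 * d + 1) * 2 / (Φ s₀ / s₀ ^ κ)) (half_lt_self hκ),
    eventually_mul_rpow_le (K + 4 * d) (show (1 : ℝ) < 2 by norm_num),
    eventually_ge_atTop (max (2 * s₀) (4 * d))]
    with r h1 h2 h3 h4 h5 h6 h7 hr a
  have hr1 : 2 * s₀ ≤ r := (le_max_left _ _).trans hr
  have hr2 : 4 * d ≤ r := (le_max_right _ _).trans hr
  have hr0 : 1 ≤ r := by linarith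
  have hKr : K * r ≤ r ^ (2 : ℝ) := by
    rw [Real.rpow_one, add_mul] at h7
    have : 0 ≤ 4 * (d : ℝ) * r := by positivity
    linarith
  set R : ℕ := ⌈K * r⌉₊ + 1 with hR
  set v : (Fin d → ℤ) → EuclideanSpace ℝ (Fin d) := fun k => gridPoint a (fun _ => 1) k with hv
  set D : (Fin d → ℤ) → Set Ω := fun k =>
    {ω | r / 2 ≤ ‖a - v k‖ ∧ r ^ θ * ψ ‖a - v k‖ < |T ω a (v k) - h ‖a - v k‖|} with hD
  set F : Set Ω := {ω | ∃ x y, ‖x - a‖ ≤ r ^ (2 : ℝ) ∧ ‖y - a‖ ≤ r ^ (2 : ℝ) ∧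
        r ^ (κ / 2) * (‖x - y‖ + 1) < T ω x y} with hF
  have hDp : ∀ k, P.real (D k) ≤ C₁ * Real.exp (-C₀ * r ^ (θ * κ₁)) := by
    intro k
    by_cases hk : r / 2 ≤ ‖a - v k‖
    · rw [Real.rpow_mul (by linarith)]
      refine le_trans (measureReal_mono (fun ω hω => hω.2) (measure_ne_top _ _))
        (hT.conc a (v k) (by linarith) _ (by positivity) ?_)
      rw [div_mul_eq_mul_div, div_le_iff₀ hC₀] at h4
      have h8 : (r / 2) ^ κ₂ ≤ ‖a - v k‖ ^ κ₂ := by gcongr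
      have h9 : (0 : ℝ) < 2 ^ κ₂ := by positivity
      rw [Real.div_rpow (by linarith) zero_le_two, div_le_iff₀ h9] at h8
      have h10 : C₀ * r ^ κ₂ ≤ C₀ * (‖a - v k‖ ^ κ₂ * 2 ^ κ₂) :=
        mul_le_mul_of_nonneg_left h8 hC₀.le
      have h11 : 2 ^ κ₂ * r ^ θ ≤ 2 ^ κ₂ * (C₀ * ‖a - v k‖ ^ κ₂) := by linarith
      exact le_of_mul_le_mul_left h11 h9
    · have : D k = ∅ := by
        ext ω
        simp only [hD, Set.mem_ofPred_eq, Set.mem_empty_iff_false, iff_false, not_and]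
        exact fun h => absurd h hk
      rw [this, measureReal_empty]
      positivity
  have hsub : ∀ᵐ ω ∂P, ω ∈ {ω | ∃ z, r ≤ ‖z - a‖ ∧ ‖z - a‖ ≤ K * r ∧
      T ω a z < h ‖z - a‖ - r ^ κ' * Φ r} → ω ∈ (⋃ k ∈ gridBox d R, D k) ∪ F := by
    filter_upwards [hT.metric] with ω hω
    rintro ⟨z, hz1, hz2, hz3⟩
    by_contra hcon
    rw [Set.mem_union, not_or] at hcon
    obtain ⟨hcon1, hcon2⟩ := hcon
    have hzn : 0 < ‖z - a‖ := by linarith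
    -- Pulling `z` by `d` towards `a` before rounding yields a grid point that is no farther from
    -- `a` than `z`, so that subadditivity bounds `h ‖z - a‖` by the value at the grid point plus a
    -- constant.
    set x := z - ((d : ℝ) / ‖z - a‖) • (z - a) with hx
    have hzx : ‖z - x‖ = d := by
      rw [hx, sub_sub_cancel, norm_smul, Real.norm_of_nonneg (by positivity),
        div_mul_cancel₀ _ hzn.ne']
    have hxa : ‖x - a‖ = ‖z - a‖ - d := by
      have e : x - a = (1 - (d : ℝ) / ‖z - a‖) • (z - a) := by
        rw [hx, sub_smul, one_smul]; abel
      have h8 : (d : ℝ) / ‖z - a‖ ≤ 1 := (div_le_one hzn).2 (by linarith)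
      rw [e, norm_smul, Real.norm_of_nonneg (by linarith), sub_mul, one_mul,
        div_mul_cancel₀ _ hzn.ne']
    have hd0 : (0 : ℝ) ≤ d := Nat.cast_nonneg d
    obtain ⟨k, hk, hxv⟩ := exists_unitGrid a (x := x) (R := K * r) (by linarith)
    change ‖x - v k‖ ≤ d at hxv
    have hva : ‖a - v k‖ ≤ ‖z - a‖ := by
      have : ‖a - v k‖ ≤ ‖x - a‖ + ‖x - v k‖ := by
        have e : a - v k = -(x - a) + (x - v k) := by abel
        rw [e]
        refine (norm_add_le _ _).trans ?_
        rw [norm_neg]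
      linarith
    have hzv : ‖z - v k‖ ≤ 2 * d := by
      have := norm_sub_le_norm_sub_add_norm_sub z x (v k)
      linarith
    have hav : ‖z - a‖ - 2 * d ≤ ‖a - v k‖ := by
      have := norm_sub_le_norm_sub_add_norm_sub z (v k) a
      rw [norm_sub_rev (v k) a] at this
      linarith
    have hr2v : r / 2 ≤ ‖a - v k‖ := by linarith
    have hTv : h ‖a - v k‖ - r ^ θ * ψ ‖a - v k‖ ≤ T ω a (v k) := by
      by_contra h'
      refine hcon1 (Set.mem_biUnion hk ⟨hr2v, lt_of_lt_of_le ?_ (neg_le_abs _)⟩)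
      linarith
    have hlinv : T ω z (v k) ≤ r ^ (κ / 2) * (‖z - v k‖ + 1) := by
      by_contra h'
      refine hcon2 ⟨z, v k, ?_, ?_, not_le.1 h'⟩
      · linarith
      · rw [norm_sub_rev]
        linarith
    have htri := hω.2.2 a z (v k)
    have hhz := hh.subadd ‖a - v k‖ (‖z - a‖ - ‖a - v k‖) (norm_nonneg _) (by linarith)
    rw [add_sub_cancel] at hhz
    have hh2 := hh.upper (‖z - a‖ - ‖a - v k‖) (by linarith)
    have hs : s₀ ≤ ‖a - v k‖ := by linarith
    have hrs : s₀ ≤ r := by linarith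
    have hΦv : Φ ‖a - v k‖ ≤ K * Φ r := by
      have hp := hΦ.pos r hrs
      rcases le_total ‖a - v k‖ r with h' | h'
      · have := hΦ.mono hκ.le hs₀ hs h'
        nlinarith
      · exact hΦ.le_mul hκ.le hs₀ hrs h' (by linarith)
    have h8 : r ^ θ * ψ ‖a - v k‖ ≤ r ^ θ * (K * Φ r) := by
      gcongr
      exact (hψ _ hs).trans hΦv
    have hΦr := hΦ.pos r hrs
    have h9 : (A + 1) * (2 * d + 1) * 2 * r ^ (κ / 2) ≤ Φ r := by
      rw [div_mul_eq_mul_div, div_le_iff₀ hb] at h6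
      have := hΦ.rpow_le hs₀ hrs
      linarith
    have h10 : r ^ (κ / 2) * (‖z - v k‖ + 1) ≤ r ^ (κ / 2) * (2 * d + 1) := by gcongr
    have hrκ : 1 ≤ r ^ (κ / 2) := Real.one_le_rpow hr0 (by positivity)
    have h11 : h (‖z - a‖ - ‖a - v k‖) ≤ A * (2 * d + 1) * r ^ (κ / 2) := by
      refine hh2.trans ((?_ : _ ≤ A * (2 * d + 1)).trans (le_mul_of_one_le_right (by positivity) hrκ))
      gcongr
      linarith
    have hrκ' : 1 ≤ r ^ κ' := Real.one_le_rpow hr0 hκ'.le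
    have h12 : 2 * K * r ^ θ * Φ r ≤ r ^ κ' * Φ r := by gcongr
    have h13 : Φ r ≤ r ^ κ' * Φ r := le_mul_of_one_le_left hΦr.le hrκ'
    linarith
  rw [one_mul, one_mul] at h3
  have h8 : P.real ((⋃ k ∈ gridBox d R, D k) ∪ F) ≤ 1 / 8 := by
    refine (measureReal_union_le _ _).trans ?_
    have h9 := (prob_biUnion_le (P := P) (gridBox d R) D fun k _ => hDp k)
    rw [card_gridBox] at h9
    have h10 := h1 a
    push_cast [hR] at h9
    linarith
  exact le_trans (ENNReal.toReal_mono (measure_ne_top _ _) (measure_mono_ae hsub)) h8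

end MidPoint

/-! ### From approximate halving to a bound at every distance -/

section Descent

variable {h : ℝ → ℝ} {μ A κ s₀ L₁ n η a : ℝ}

/-- At a sufficiently large distance the bound holds because of the term `η s` alone. Each halving
step preserves it: the nonrandom fluctuation is halved, whereas `Ψ` shrinks at most by the factor
`2^(1-κ) < 2`, and `B` satisfies `(B/2 + 1) 2^(1-κ) ≤ B`. The steps go down by factors between `1/2`
and `5/8`, so they cannot jump over the window. -/
lemma IsMeanTime.exists_window (hh : IsMeanTime h μ A) (hκ : 0 < κ) (hs₀ : 1 ≤ s₀)
    {Ψ : ℝ → ℝ} (hΨ : IsPowerScale Ψ κ s₀) (ha : 0 ≤ a)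
    (hstep : ∀ L, L₁ ≤ L → ∃ s, L / 2 ≤ s ∧ s ≤ 5 / 8 * L ∧
      h s - μ * s ≤ (h L - μ * L) / 2 + a * Ψ L)
    (hn : 2 * L₁ ≤ n) (hn' : 4 * s₀ ≤ n) (hη : 0 < η) :
    ∃ s, n / 4 ≤ s ∧ s ≤ n / 2 ∧
      h s - μ * s ≤ 2 / (1 - 2 ^ (-κ)) * a * Ψ s + η * s := by
  set B : ℝ := 2 / (1 - 2 ^ (-κ)) with hB
  have h2κ : (2 : ℝ) ^ (-κ) < 1 := Real.rpow_lt_one_of_one_lt_of_neg one_lt_two (by linarith)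
  have hB0 : 0 < B := by
    have : (0 : ℝ) < 1 - 2 ^ (-κ) := by linarith
    positivity
  have hBeq : (B / 2 + 1) * 2 ^ (1 - κ) ≤ B := by
    have e : (2 : ℝ) ^ (1 - κ) = 2 * 2 ^ (-κ) := by
      rw [sub_eq_add_neg, Real.rpow_add two_pos, Real.rpow_one]
    have h1 : B * (1 - 2 ^ (-κ)) = 2 := div_mul_cancel₀ _ (by linarith)
    rw [e]
    nlinarith
  have hind : ∀ (k : ℕ) (L : ℝ), n / 2 ≤ L → L ≤ (8 / 5) ^ k * (n / 2) →
      h L - μ * L ≤ B * a * Ψ L + η * L → ∃ s, n / 4 ≤ s ∧ s ≤ n / 2 ∧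
        h s - μ * s ≤ B * a * Ψ s + η * s := by
    intro k
    induction k with
    | zero =>
      intro L hL1 hL2 hL3
      rw [pow_zero, one_mul] at hL2
      exact ⟨L, by linarith, hL2, hL3⟩
    | succ k ih =>
      intro L hL1 hL2 hL3
      obtain ⟨s, hs1, hs2, hs3⟩ := hstep L (by linarith)
      have hs0 : s₀ ≤ s := by linarith
      have hspos : 0 < s := by linarith
      have h1 : Ψ L ≤ 2 ^ (1 - κ) * Ψ s := by
        have h2 := hΨ.upper s L hs0 (by linarith)
        have h3 : L / s ≤ 2 := by rw [div_le_iff₀ hspos]; linarith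
        have h4 := hΨ.pos s hs0
        by_cases hκ1 : κ ≤ 1
        · have : (L / s) ^ (1 - κ) ≤ 2 ^ (1 - κ) :=
            Real.rpow_le_rpow (div_nonneg (by linarith) hspos.le) h3 (by linarith)
          nlinarith
        · have h5 := hΨ.lower s L hs0 (by linarith)
          have h6 : s ≤ L := by linarith
          have h7 : 1 ≤ L / s := (one_le_div hspos).2 h6
          have h8 : (L / s) ^ (1 - κ) ≤ 1 := Real.rpow_le_one_of_one_le_of_nonpos h7 (by linarith)
          have h9 : 1 < L / s := by rw [lt_div_iff₀ hspos]; linarith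
          have h10 : 1 < (L / s) ^ κ := Real.one_lt_rpow h9 hκ
          nlinarith
      have h5 : h s - μ * s ≤ B * a * Ψ s + η * s := by
        have h6 : (B / 2 + 1) * a * Ψ L ≤ (B / 2 + 1) * a * (2 ^ (1 - κ) * Ψ s) := by gcongr
        have h7 : ((B / 2 + 1) * 2 ^ (1 - κ)) * (a * Ψ s) ≤ B * (a * Ψ s) := by
          have := hΨ.pos s hs0
          gcongr
        have h8 : η * (L / 2) ≤ η * s := by gcongr
        linarith
      rcases le_total s (n / 2) with h' | h'
      · exact ⟨s, by linarith, h', h5⟩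
      · refine ih s h' ?_ h5
        rw [pow_succ] at hL2
        linarith
  obtain ⟨s₁, hs₁⟩ := hh.limit η hη
  obtain ⟨k, hk⟩ := pow_unbounded_of_one_lt (max s₁ n / (n / 2)) (show (1 : ℝ) < 8 / 5 by norm_num)
  have hn2 : 0 < n / 2 := by linarith
  rw [div_lt_iff₀ hn2] at hk
  refine hind k (max s₁ n) ?_ hk.le ?_
  · have := le_max_right s₁ n
    linarith
  · have h1 := hs₁ _ (le_max_left s₁ n)
    have h2 : 0 ≤ B * a * Ψ (max s₁ n) := by
      have := hΨ.pos (max s₁ n) (by have := le_max_right s₁ n; linarith)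
      positivity
    linarith

/-- A nonrandom fluctuation that halves, up to an error `Ψ`, when the distance is halved is of
order `Ψ`. -/
lemma IsMeanTime.descent (hh : IsMeanTime h μ A) (hκ : 0 < κ) (hs₀ : 1 ≤ s₀) :
    ∃ G, 0 < G ∧ ∀ L₁ : ℝ, ∃ A₂, 0 ≤ A₂ ∧ ∀ Ψ : ℝ → ℝ, IsPowerScale Ψ κ s₀ → ∀ a, 0 ≤ a →
      (∀ L, L₁ ≤ L → ∃ s, L / 2 ≤ s ∧ s ≤ 5 / 8 * L ∧
        h s - μ * s ≤ (h L - μ * L) / 2 + a * Ψ L) →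
      ∀ n, s₀ ≤ n → h n - μ * n ≤ G * a * Ψ n + A₂ := by
  set B : ℝ := 2 / (1 - 2 ^ (-κ)) with hB
  have h2κ : (2 : ℝ) ^ (-κ) < 1 := Real.rpow_lt_one_of_one_lt_of_neg one_lt_two (by linarith)
  have hB0 : 0 < B := by
    have : (0 : ℝ) < 1 - 2 ^ (-κ) := by linarith
    positivity
  have h3κ : ((4 : ℝ) / 3) ^ (-κ) < 1 :=
    Real.rpow_lt_one_of_one_lt_of_neg (by norm_num) (by linarith)
  set θ : ℝ := (4 / 3) ^ (-κ) with hθ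
  have hθ0 : 0 < 1 - θ := by linarith
  -- The constant `G` is fixed before `L₁`: in the bootstrap the halving step, and with it `L₁`, is
  -- chosen in terms of `G`. Only the additive constant depends on `L₁`.
  refine ⟨B / (1 - θ), by positivity, fun L₁ => ?_⟩
  set n₂ : ℝ := max (2 * L₁) (4 * s₀) with hn₂
  have hn₂s : 4 * s₀ ≤ n₂ := le_max_right _ _
  have hA := hh.const_nonneg
  have hμ := hh.speed_pos
  refine ⟨A * (n₂ + 1), mul_nonneg hA (by linarith), fun Ψ hΨ a ha hstep => ?_⟩
  set G : ℝ := B / (1 - θ) with hG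
  have hG0 : 0 < G := by positivity
  have hGeq : B + G * θ = G := by
    have : G * (1 - θ) = B := div_mul_cancel₀ _ hθ0.ne'
    linarith
  -- A piece `s` from the window is split off by subadditivity. What remains is at most `3 n / 4`,
  -- where `Ψ` has decreased by the factor `θ`, and `B + G θ = G` closes the induction. Finally `η`
  -- tends to zero.
  have hind : ∀ η : ℝ, 0 < η → ∀ (k : ℕ) (n : ℝ), s₀ ≤ n → n ≤ (4 / 3) ^ k * n₂ →
      h n - μ * n ≤ G * a * Ψ n + 4 * η * n + A * (n₂ + 1) := by
    intro η hη k
    have hbase : ∀ n, s₀ ≤ n → n ≤ n₂ →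
        h n - μ * n ≤ G * a * Ψ n + 4 * η * n + A * (n₂ + 1) := by
      intro n hn hn'
      have h1 := hh.upper n (by linarith)
      have h2 : A * (n + 1) ≤ A * (n₂ + 1) := by gcongr
      have h3 := hΨ.pos n hn
      have h4 : 0 ≤ G * a * Ψ n := by positivity
      have h5 : 0 ≤ 4 * η * n := mul_nonneg (by linarith) (by linarith)
      have h6 : 0 ≤ μ * n := mul_nonneg hμ.le (by linarith)
      linarith
    induction k with
    | zero => exact fun n hn hn' => hbase n hn (by simpa using hn')
    | succ k ih =>
      intro n hn hn'
      rcases le_total n n₂ with hle | hle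
      · exact hbase n hn hle
      have hn0 : 0 < n := by linarith
      obtain ⟨s, hs1, hs2, hs3⟩ := hh.exists_window hκ hs₀ hΨ ha hstep
        ((le_max_left _ _).trans hle) ((le_max_right _ _).trans hle) hη
      have hn's : s₀ ≤ n - s := by linarith
      have h1 := ih (n - s) hn's (by rw [pow_succ] at hn'; linarith)
      have h2 := hh.subadd s (n - s) (by linarith) (by linarith)
      rw [add_sub_cancel] at h2
      have hns0 : 0 < n - s := by linarith
      have h4 : 1 ≤ n / s := (one_le_div (by linarith)).2 (by linarith)
      have hΨs : Ψ s ≤ Ψ n := hΨ.mono hκ.le hs₀ (by linarith) (by linarith)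
      have hΨn := hΨ.pos n hn
      have hΨ' : Ψ (n - s) ≤ θ * Ψ n := by
        have h5 := hΨ.lower (n - s) n hn's (by linarith)
        have h6 : (4 / 3 : ℝ) ≤ n / (n - s) := by rw [le_div_iff₀ hns0]; linarith
        have h7 : (4 / 3 : ℝ) ^ κ ≤ (n / (n - s)) ^ κ :=
          Real.rpow_le_rpow (by norm_num) h6 hκ.le
        have h8 := hΨ.pos _ hn's
        have h9 : (4 / 3 : ℝ) ^ κ * Ψ (n - s) ≤ Ψ n := by nlinarith
        rw [hθ, Real.rpow_neg (by norm_num), inv_mul_eq_div,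
          le_div_iff₀ (Real.rpow_pos_of_pos (by norm_num) _)]
        linarith
      have h5 : B * a * Ψ s ≤ B * a * Ψ n := by gcongr
      have h6 : G * a * Ψ (n - s) ≤ G * a * (θ * Ψ n) := by gcongr
      have h7 : B * a * Ψ n + G * a * (θ * Ψ n) = G * a * Ψ n := by
        calc _ = (B + G * θ) * (a * Ψ n) := by ring
          _ = _ := by rw [hGeq]; ring
      have h8 : 0 ≤ η * s := mul_nonneg hη.le (by linarith)
      linarith
  intro n hn
  have hn0 : 0 < n := by linarith
  refine le_of_forall_pos_le_add fun ε hε => ?_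
  obtain ⟨k, hk⟩ := pow_unbounded_of_one_lt (n / n₂) (show (1 : ℝ) < 4 / 3 by norm_num)
  rw [div_lt_iff₀ (by linarith)] at hk
  have h1 := hind (ε / (4 * n)) (by positivity) k n hn hk.le
  have h2 : 4 * (ε / (4 * n)) * n = ε := by field_simp
  linarith

end Descent

/-! ### Events on the middle hyperplane -/

section MidPoint

variable {d : ℕ} [NeZero d] {Ω : Type*} [MeasurableSpace Ω]
  {P : Measure Ω} [IsProbabilityMeasure P]
  {T : Ω → EuclideanSpace ℝ (Fin d) → EuclideanSpace ℝ (Fin d) → ℝ} {h ψ : ℝ → ℝ}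
  {C₀ C₁ κ₁ κ₂ μ A : ℝ}

/-- An almost optimal path from `0` to `2 r e₁` crosses the middle hyperplane or leaves a large
ball. -/
def HasCrossing (P : Measure Ω)
    (T : Ω → EuclideanSpace ℝ (Fin d) → EuclideanSpace ℝ (Fin d) → ℝ) : Prop :=
  ∀ K : ℝ, 3 ≤ K → ∀ σ : ℝ, 0 < σ → ∀ᶠ r : ℝ in atTop,
    P.real {ω | T ω 0 (axisPoint d (2 * r)) ≤ K * r ∧
      ¬∃ z, ((z 0 = r ∧ ‖z‖ ≤ K * r) ∨ ‖z‖ = K * r) ∧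
        T ω 0 z + T ω z (axisPoint d (2 * r)) ≤ T ω 0 (axisPoint d (2 * r)) + r ^ σ} ≤ 1 / 16

/-- Some point of a large ball in the hyperplane `z 0 = r` is reached from `0` before time `X`. -/
def planeEvent (T : Ω → EuclideanSpace ℝ (Fin d) → EuclideanSpace ℝ (Fin d) → ℝ) (K r X : ℝ) :
    Set Ω :=
  {ω | ∃ z, z 0 = r ∧ ‖z‖ ≤ K * r ∧ T ω 0 z < X}

/-- The passage times, reflected by `x ↦ b - x`. -/
def reflectTime (T : Ω → EuclideanSpace ℝ (Fin d) → EuclideanSpace ℝ (Fin d) → ℝ)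
    (b : EuclideanSpace ℝ (Fin d)) (ω : Ω) (x y : EuclideanSpace ℝ (Fin d)) : ℝ :=
  T ω (b - x) (b - y)

/-- The set `s` need not be measurable: if it contained almost every point, its outer measure would
be one. -/
lemma exists_of_prob_lt_one {s : Set Ω} (hs : P.real s < 1) {p : Ω → Prop}
    (hp : ∀ᵐ ω ∂P, p ω) : ∃ ω, p ω ∧ ω ∉ s := by
  by_contra hcon
  push Not at hcon
  have h1 : ∀ᵐ ω ∂P, ω ∈ s := hp.mono hcon
  have h2 : P s = 1 := (measure_congr (eventuallyEq_univ.2 h1)).trans measure_univ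
  rw [measureReal_def, h2] at hs
  simp at hs

end MidPoint

/-! ### The midpoint inequality and the a priori bound -/

section MidPoint

variable {d : ℕ} [NeZero d] {Ω : Type*} [MeasurableSpace Ω]
  {P : Measure Ω} [IsProbabilityMeasure P]
  {T : Ω → EuclideanSpace ℝ (Fin d) → EuclideanSpace ℝ (Fin d) → ℝ} {h ψ : ℝ → ℝ}
  {C₀ C₁ κ₁ κ₂ μ A : ℝ} {Φ : ℝ → ℝ} {κ s₀ : ℝ}

lemma IsPowerScale.eventually_mul_rpow_le (hΦ : IsPowerScale Φ κ s₀) (hs₀ : 1 ≤ s₀) (C : ℝ)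
    {β : ℝ} (hC : 0 ≤ C) (hβ : β < κ) :
    ∀ᶠ r : ℝ in atTop, C * r ^ β * Φ r ≤ r := by
  filter_upwards [EuclideanFPP.eventually_mul_rpow_le (C * (Φ s₀ / s₀ ^ (1 - κ)))
    (show β + (1 - κ) < 1 by linarith), eventually_ge_atTop s₀] with r h1 h2
  rw [Real.rpow_one, Real.rpow_add (by linarith)] at h1
  have h3 := hΦ.le_rpow hs₀ h2
  have h4 : 0 ≤ C * r ^ β := mul_nonneg hC (Real.rpow_nonneg (by linarith) _)
  have h5 := mul_le_mul_of_nonneg_left h3 h4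
  linarith

lemma IsPowerScale.eventually_rpow_le (hΦ : IsPowerScale Φ κ s₀) (hs₀ : 1 ≤ s₀) {β : ℝ}
    (hβ : β < κ) : ∀ᶠ r : ℝ in atTop, r ^ β ≤ Φ r := by
  have hb : 0 < Φ s₀ / s₀ ^ κ := div_pos (hΦ.pos _ le_rfl) (Real.rpow_pos_of_pos (by linarith) _)
  filter_upwards [EuclideanFPP.eventually_mul_rpow_le (1 / (Φ s₀ / s₀ ^ κ)) hβ,
    eventually_ge_atTop s₀] with r h1 h2
  rw [one_div, inv_mul_le_iff₀ hb] at h1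
  exact h1.trans (hΦ.rpow_le hs₀ h2)

lemma IsPowerScale.mul_rpow (hΦ : IsPowerScale Φ κ s₀) (hs₀ : 1 ≤ s₀) {β : ℝ} (hβ : 0 ≤ β) :
    IsPowerScale (fun s => Φ s * s ^ β) (κ - β) s₀ := by
  refine hΦ.mul hs₀ (by linarith) (β := β) (by linarith)
    (fun s hs => Real.rpow_pos_of_pos (by linarith) _) (fun y n hy hyn => ?_) fun y n hy hyn => ?_
  · exact Real.rpow_le_rpow (by linarith) hyn hβ
  · have hy0 : 0 < y := by linarith
    rw [← Real.mul_rpow (div_nonneg (by linarith) hy0.le) hy0.le, div_mul_cancel₀ _ hy0.ne']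

set_option maxHeartbeats 800000 in
-- The exceptional events have total probability below one. Outside them the passage time to `2 r
-- e₁` is close to its mean and a near-optimal path goes through some `z`. If `z` lies on the plane,
-- both halves take at least `μ r + Y`. If `z` lies on the sphere, the path is already too slow.
lemma exists_midpoint (hT : IsPassageModel P T h ψ C₀ C₁ κ₁ κ₂) (hh : IsMeanTime h μ A)
    (hcross : HasCrossing P T)
    (hC₀ : 0 < C₀) (hC₁ : 0 < C₁) (hκ₁ : 0 < κ₁) (hκ₂ : 0 < κ₂)
    (hΦ : IsPowerScale Φ κ s₀) (hκ : 0 < κ) (hκ1 : κ < 1) (hs₀ : 1 ≤ s₀)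
    (hψ : ∀ s, s₀ ≤ s → ψ s ≤ Φ s) :
    ∃ K t, 3 ≤ K ∧ 0 < t ∧ ∀ᶠ r : ℝ in atTop, ∀ Y,
      P.real (planeEvent T K r (μ * r + Y)) ≤ 1 / 8 →
      P.real (planeEvent (reflectTime T (axisPoint d (2 * r))) K r (μ * r + Y)) ≤ 1 / 8 →
      2 * Y ≤ h (2 * r) - μ * (2 * r) + t * Φ (2 * r) := by
  have hA := hh.const_nonneg
  have hμ := hh.speed_pos
  -- The passage time is at most `(4 A + 1) r`, so `HasCrossing` applies; reaching the sphere takes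
  -- almost `μ K r ≥ (4 A + 4) r`.
  set K : ℝ := max 3 (4 * A + 1) + (4 * A + 4) / μ with hK
  have hK0 : 0 ≤ (4 * A + 4) / μ := by positivity
  have hK3 : 3 ≤ K := by have := le_max_left 3 (4 * A + 1); linarith
  have hKA : 4 * A + 1 ≤ K := by have := le_max_right 3 (4 * A + 1); linarith
  have hKμ : 4 * A + 4 ≤ μ * K := by
    have h1 : (4 * A + 4) / μ ≤ K := by have := le_max_left 3 (4 * A + 1); linarith
    rw [div_le_iff₀ hμ] at h1
    linarith
  obtain ⟨t, ht1, ht2⟩ := ((eventually_mul_exp_rpow_le C₁ hC₀ hκ₁ (ε := 1 / 8)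
    (by norm_num)).and (eventually_ge_atTop 1)).exists
  -- Reflection sends `z` to `2 r e₁ - z`, which can be farther from the origin by `2 r`; hence `K +
  -- 2`.
  refine ⟨K + 2, t + 1, by linarith, by linarith, ?_⟩
  have hs : Tendsto (fun r : ℝ => 2 * r) atTop atTop := tendsto_id.const_mul_atTop two_pos
  filter_upwards [hcross K hK3 (κ / 2) (by positivity),
    prob_lt_mean_sub_le hT hh hC₀ hC₁ hκ₁ hκ₂ hΦ hκ hs₀ hψ (K := K) (κ' := κ / 2) (by linarith)
      (by positivity), hs.eventually (hΦ.eventually_mul_rpow_le hs₀ (2 * t) (β := 0) (by linarith) hκ),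
    hΦ.eventually_mul_rpow_le hs₀ 1 zero_le_one (half_lt_self hκ),
    hs.eventually (hΦ.eventually_rpow_le hs₀ (half_lt_self hκ)),
    (tendsto_rpow_atTop hκ₂).eventually_ge_atTop (t / C₀),
    eventually_ge_atTop s₀] with r h1 h2 h3 h4 h5 h6 hr Y hY1 hY2
  have hr1 : 1 ≤ r := by linarith
  have hr0 : 0 < r := by linarith
  rw [Real.rpow_zero, mul_one] at h3
  rw [one_mul] at h4
  have hnorm : ‖(0 : EuclideanSpace ℝ (Fin d)) - axisPoint d (2 * r)‖ = 2 * r := by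
    rw [zero_sub, norm_neg, norm_axisPoint, abs_of_pos (by linarith)]
  have hE1 := hT.conc 0 (axisPoint d (2 * r)) (by rw [hnorm]; linarith) t (by linarith) (by
    rw [hnorm]
    rw [div_le_iff₀ hC₀] at h6
    have : r ^ κ₂ ≤ (2 * r) ^ κ₂ := by gcongr; linarith
    have := mul_le_mul_of_nonneg_left this hC₀.le
    linarith)
  rw [hnorm, neg_mul] at hE1
  have hE5 := h2 0
  have hprob := lt_of_le_of_lt ((measureReal_union_le (μ := P) _ _).trans (add_le_add
    ((measureReal_union_le _ _).trans (add_le_add ((measureReal_union_le _ _).trans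
    (add_le_add ((measureReal_union_le _ _).trans (add_le_add (hE1.trans ht1) h1)) hE5)) hY1)) hY2))
    (show ((1 : ℝ) / 8 + 1 / 16 + 1 / 8 + 1 / 8 + 1 / 8) < 1 by norm_num)
  obtain ⟨ω, hω, hnot⟩ := exists_of_prob_lt_one hprob hT.metric
  simp only [Set.mem_union, not_or] at hnot
  obtain ⟨⟨⟨⟨hn1, hn2⟩, hn3⟩, hn4⟩, hn5⟩ := hnot
  have hT1 : T ω 0 (axisPoint d (2 * r)) ≤ h (2 * r) + t * ψ (2 * r) := by
    by_contra h'
    refine hn1 ?_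
    change t * ψ (2 * r) < |_|
    exact lt_of_lt_of_le (by linarith) (le_abs_self _)
  have hψ2 : t * ψ (2 * r) ≤ t * Φ (2 * r) := by
    have := hψ (2 * r) (by linarith)
    gcongr
  have hh2 := hh.le_mul (s := 2 * r) (by linarith)
  have hT2 : T ω 0 (axisPoint d (2 * r)) ≤ (4 * A + 1) * r := by linarith
  have hT3 : T ω 0 (axisPoint d (2 * r)) ≤ K * r := hT2.trans (by gcongr)
  have hr5 : r ^ (κ / 2) ≤ (2 * r) ^ (κ / 2) := by gcongr; linarith
  have hrr : r ^ (κ / 2) ≤ r := by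
    have := Real.rpow_le_self_of_one_le hr1 (show κ / 2 ≤ 1 by linarith)
    exact this
  obtain ⟨z, hz, hzT⟩ : ∃ z, ((z 0 = r ∧ ‖z‖ ≤ K * r) ∨ ‖z‖ = K * r) ∧
      T ω 0 z + T ω z (axisPoint d (2 * r)) ≤ T ω 0 (axisPoint d (2 * r)) + r ^ (κ / 2) := by
    by_contra h'
    exact hn2 ⟨hT3, h'⟩
  rcases hz with ⟨hz0, hzK⟩ | hzK
  · have e1 : μ * r + Y ≤ T ω 0 z := by
      by_contra h'
      refine hn4 ⟨z, hz0, hzK.trans ?_, not_le.1 h'⟩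
      gcongr
      linarith
    have e2 : μ * r + Y ≤ T ω (axisPoint d (2 * r)) z := by
      by_contra h'
      refine hn5 ⟨axisPoint d (2 * r) - z, ?_, ?_, ?_⟩
      · rw [PiLp.sub_apply, axisPoint_apply_zero, hz0]; ring
      · refine (norm_sub_le _ _).trans ?_
        rw [norm_axisPoint, abs_of_pos (by linarith)]
        linarith
      · rw [reflectTime, sub_zero, sub_sub_cancel]
        exact not_le.1 h'
    rw [hω.2.1] at e2
    linarith
  · exfalso
    have e1 : h (K * r) - r ^ (κ / 2) * Φ r ≤ T ω 0 z := by
      by_contra h'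
      refine hn3 ⟨z, ?_, ?_, ?_⟩
      · rw [sub_zero, hzK]
        nlinarith
      · rw [sub_zero, hzK]
      · rw [sub_zero, hzK]
        exact not_le.1 h'
    have e2 := hh.lower (K * r) (by positivity)
    have e3 := hω.1 z (axisPoint d (2 * r))
    have e4 : (4 * A + 4) * r ≤ μ * K * r := by gcongr
    linarith

/-- The a priori bound for the nonrandom fluctuations. -/
lemma exists_apriori (hT : IsPassageModel P T h ψ C₀ C₁ κ₁ κ₂) (hh : IsMeanTime h μ A)
    (hcross : HasCrossing P T)
    (hC₀ : 0 < C₀) (hC₁ : 0 < C₁) (hκ₁ : 0 < κ₁) (hκ₂ : 0 < κ₂)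
    (hΦ : IsPowerScale Φ κ s₀) (hκ : 0 < κ) (hκ1 : κ < 1) (hs₀ : 1 ≤ s₀)
    (hψ : ∀ s, s₀ ≤ s → ψ s ≤ Φ s) {β : ℝ} (hβ : 0 < β) (hβκ : β < κ) :
    ∃ M, 0 < M ∧ ∀ s, s₀ ≤ s → h s - μ * s ≤ M * (s ^ β * Φ s) := by
  have hμ := hh.speed_pos
  obtain ⟨K, t, hK3, ht0, hmid⟩ := exists_midpoint hT hh hcross hC₀ hC₁ hκ₁ hκ₂ hΦ hκ hκ1 hs₀ hψ
  have hΨ := hΦ.mul_rpow hs₀ hβ.le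
  obtain ⟨G, hG, hdesc⟩ := hh.descent (sub_pos.2 hβκ) hs₀
  obtain ⟨s₁, hs₁⟩ := hh.limit (μ / 8) (by positivity)
  have hd2 : Tendsto (fun L : ℝ => L / 2) atTop atTop := tendsto_id.atTop_div_const two_pos
  obtain ⟨L₁, hL₁⟩ := eventually_atTop.1 ((hd2.eventually hmid).and ((hd2.eventually
    (prob_lt_mean_sub_le hT hh hC₀ hC₁ hκ₁ hκ₂ hΦ hκ hs₀ hψ (K := K) (by linarith) hβ)).and
    ((hΦ.eventually_mul_rpow_le hs₀ (16 * (2 + t) / μ) (by positivity) hβκ).and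
    (eventually_ge_atTop (max (2 * s₀) s₁)))))
  obtain ⟨A₂, hA₂, hfin⟩ := hdesc L₁
  have hpos := hΨ.pos s₀ le_rfl
  refine ⟨G * (2 + t) + A₂ / (Φ s₀ * s₀ ^ β), by positivity, fun s hs => ?_⟩
  have h1 := hfin _ hΨ (2 + t) (by linarith) ?_ s hs
  · have h2 := hΨ.mono (by linarith) hs₀ le_rfl hs
    have h3 : A₂ ≤ A₂ / (Φ s₀ * s₀ ^ β) * (Φ s * s ^ β) := by
      calc A₂ = A₂ / (Φ s₀ * s₀ ^ β) * (Φ s₀ * s₀ ^ β) := (div_mul_cancel₀ _ hpos.ne').symm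
        _ ≤ _ := by gcongr
    rw [mul_comm (s ^ β)]
    linarith
  intro L hL
  obtain ⟨hm, hp, hL3, hL4⟩ := hL₁ L hL
  by_contra hcon
  push Not at hcon
  have hL5 : 2 * s₀ ≤ L := (le_max_left _ _).trans hL4
  have hgL := hs₁ L ((le_max_right _ _).trans hL4)
  rw [div_mul_eq_mul_div, div_mul_eq_mul_div, div_le_iff₀ hμ] at hL3
  set r := L / 2 with hr
  have e : 2 * r = L := by rw [hr]; ring
  rw [e] at hm
  have hr0 : 1 ≤ r := by linarith
  -- Distances up to `5 L / 8` are covered by the negated conclusion. Beyond, `μ ρ` alone suffices,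
  -- because the target exceeds `μ L / 2` by at most `μ L / 8`.
  have hclaim : ∀ ρ, r ≤ ρ →
      μ * r + ((h L - μ * L) / 2 + (2 + t) * (Φ L * L ^ β) - r ^ β * Φ r) ≤ h ρ - r ^ β * Φ r := by
    intro ρ hρ
    rcases le_total ρ (5 / 8 * L) with h' | h'
    · have h2 := hcon ρ hρ h'
      have h3 : μ * r ≤ μ * ρ := by gcongr
      linarith
    · have h2 := hh.lower ρ (by linarith)
      have h3 : μ * (5 / 8 * L) ≤ μ * ρ := by gcongr
      have h4 : μ * L = 2 * (μ * r) := by rw [← e]; ring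
      linarith
  have hnorm : ∀ z : EuclideanSpace ℝ (Fin d), z 0 = r → r ≤ ‖z‖ := fun z hz =>
    hz ▸ (le_abs_self _).trans (abs_apply_le_norm z 0)
  have h2 := hm ((h L - μ * L) / 2 + (2 + t) * (Φ L * L ^ β) - r ^ β * Φ r) ((measureReal_mono ?_ (measure_ne_top _ _)).trans (hp 0))
    ((measureReal_mono ?_ (measure_ne_top _ _)).trans (hp (axisPoint d L)))
  · have h3 : r ^ β * Φ r ≤ Φ L * L ^ β := by
      have := hΨ.mono (by linarith) hs₀ (show s₀ ≤ r by linarith) (show r ≤ L by linarith)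
      linarith
    have h4 : Φ L ≤ Φ L * L ^ β := le_mul_of_one_le_right (hΦ.pos L (by linarith)).le
      (Real.one_le_rpow (by linarith) hβ.le)
    have h5 : t * Φ L ≤ t * (Φ L * L ^ β) := by gcongr
    have h6 := hΨ.pos L (by linarith)
    nlinarith
  · rintro ω ⟨z, hz0, hzK, hz⟩
    refine ⟨z, ?_⟩
    rw [sub_zero]
    exact ⟨hnorm z hz0, hzK, hz.trans_le (hclaim _ (hnorm z hz0))⟩
  · rintro ω ⟨z, hz0, hzK, hz⟩
    refine ⟨axisPoint d L - z, ?_⟩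
    rw [sub_sub_cancel_left, norm_neg]
    refine ⟨hnorm z hz0, hzK, ?_⟩
    rw [reflectTime, sub_zero] at hz
    exact hz.trans_le (hclaim _ (hnorm z hz0))

end MidPoint

lemma summable_one_div_one_add_abs_sq : Summable fun j : ℤ => 1 / (1 + |(j : ℝ)|) ^ 2 := by
  have h : Summable fun n : ℕ => 1 / (1 + (n : ℝ)) ^ 2 := by
    have := (summable_nat_add_iff 1).2 (Real.summable_one_div_nat_pow.2 one_lt_two)
    refine this.congr fun n => ?_
    push_cast
    rw [add_comm]
  apply Summable.of_nat_of_neg <;> simpa using h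

/-- Each term is at most `t⁻¹ ∏ (1 + |k i|)^(-2)`. The product is summable over the whole lattice,
so a large `t` makes the sum small for all `R` at once. -/
lemma exists_sum_exp_le (d : ℕ) {c a ε : ℝ} (hc : 0 < c) (ha : 0 < a) (hε : 0 < ε) (t₀ : ℝ) :
    ∃ t, t₀ ≤ t ∧ ∀ R : ℕ, ∑ k ∈ gridBox d R, Real.exp (-c * (t * (1 + ‖k‖)) ^ a) ≤ ε := by
  set f : ℤ → ℝ := fun j => 1 / (1 + |(j : ℝ)|) ^ 2 with hf
  set S : ℝ := ∑' j, f j with hS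
  have hf0 : ∀ j, 0 ≤ f j := fun j => by positivity
  have hS0 : 0 ≤ S := tsum_nonneg hf0
  obtain ⟨x₀, hx₀⟩ := eventually_atTop.1
    (eventually_poly_mul_exp_le 1 (2 * d + 1 : ℕ) hc (half_pos ha) (half_lt_self ha))
  obtain ⟨t, ht1, ht2, ht3, ht4⟩ := ((eventually_ge_atTop t₀).and ((eventually_ge_atTop x₀).and
    ((eventually_ge_atTop 1).and (eventually_ge_atTop (S ^ d / ε))))).exists
  refine ⟨t, ht1, fun R => ?_⟩
  have hterm : ∀ k : Fin d → ℤ, Real.exp (-c * (t * (1 + ‖k‖)) ^ a) ≤ t⁻¹ * ∏ i, f (k i) := by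
    intro k
    set x := t * (1 + ‖k‖) with hx
    have hk0 : 0 ≤ ‖k‖ := norm_nonneg k
    have htx : t ≤ x := le_mul_of_one_le_right (by linarith) (by linarith)
    have hx0 : 0 < x := by linarith
    have h1 := hx₀ x (ht2.trans htx)
    rw [one_mul, Real.rpow_natCast] at h1
    have h2 : Real.exp (-x ^ (a / 2)) ≤ 1 := by
      rw [Real.exp_le_one_iff, neg_nonpos]
      positivity
    have h3 : Real.exp (-c * x ^ a) ≤ (x ^ (2 * d + 1))⁻¹ := by
      rw [le_inv_comm₀ (Real.exp_pos _) (by positivity), ← one_div,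
        le_div_iff₀ (Real.exp_pos _)]
      exact h1.trans h2
    refine h3.trans ?_
    have h4 : ∏ i, f (k i) = (∏ i, (1 + |(k i : ℝ)|) ^ 2)⁻¹ := by
      rw [← Finset.prod_inv_distrib]
      simp only [hf, one_div]
    rw [h4, ← mul_inv]
    have h5 : ∏ i, (1 + |(k i : ℝ)|) ^ 2 ≤ (1 + ‖k‖) ^ (2 * d) := by
      calc ∏ i, (1 + |(k i : ℝ)|) ^ 2 ≤ ∏ _i : Fin d, (1 + ‖k‖) ^ 2 := by
            refine Finset.prod_le_prod (fun i _ => by positivity) fun i _ => ?_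
            have : |(k i : ℝ)| ≤ ‖k‖ := norm_le_pi_norm k i
            gcongr
        _ = _ := by rw [Finset.prod_const, Finset.card_univ, Fintype.card_fin, ← pow_mul]
    have h6 : 0 < ∏ i, (1 + |(k i : ℝ)|) ^ 2 := Finset.prod_pos fun i _ => by positivity
    apply inv_anti₀ (by positivity)
    calc t * ∏ i, (1 + |(k i : ℝ)|) ^ 2 ≤ t * (1 + ‖k‖) ^ (2 * d) := by gcongr
      _ ≤ x * x ^ (2 * d) := by
          have : 1 + ‖k‖ ≤ x := le_mul_of_one_le_left (by linarith) ht3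
          gcongr
      _ = _ := by ring
  refine (Finset.sum_le_sum fun k _ => hterm k).trans ?_
  rw [← Finset.mul_sum, gridBox, ← Finset.prod_univ_sum]
  have h7 : ∑ j ∈ Finset.Icc (-(R : ℤ)) R, f j ≤ S :=
    summable_one_div_one_add_abs_sq.sum_le_tsum _ fun j _ => hf0 j
  rw [Finset.prod_const, Finset.card_univ, Fintype.card_fin]
  have h8 : (∑ j ∈ Finset.Icc (-(R : ℤ)) R, f j) ^ d ≤ S ^ d :=
    pow_le_pow_left₀ (Finset.sum_nonneg fun j _ => hf0 j) h7 d
  rw [inv_mul_le_iff₀ (by linarith)]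
  rw [div_le_iff₀ hε] at ht4
  linarith

/-! ### A lower bound for all points of the middle hyperplane -/

section Plane

variable {d : ℕ} [NeZero d] {Ω : Type*} [MeasurableSpace Ω]
  {P : Measure Ω} [IsProbabilityMeasure P]
  {T : Ω → EuclideanSpace ℝ (Fin d) → EuclideanSpace ℝ (Fin d) → ℝ} {h ψ : ℝ → ℝ}
  {C₀ C₁ κ₁ κ₂ μ A : ℝ} {Θ : ℝ → ℝ} {κ s₀ : ℝ}

/-- Reflections in different points differ by a translation, so the constants obtained by chaining
for one reflection serve for all. -/
lemma slowEvent_reflectTime (T : Ω → EuclideanSpace ℝ (Fin d) → EuclideanSpace ℝ (Fin d) → ℝ)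
    (Φ : ℝ → ℝ) (m E : ℝ) (b u : EuclideanSpace ℝ (Fin d)) :
    slowEvent (reflectTime T b) μ Φ m u E = slowEvent (reflectTime T 0) μ Φ m (u - b) E := by
  have hkey : ∀ x : EuclideanSpace ℝ (Fin d), u - b - (x - b) = u - x := fun x => by abel
  have hneg : ∀ x : EuclideanSpace ℝ (Fin d), 0 - (x - b) = b - x := fun x => by abel
  ext ω
  constructor
  · rintro ⟨x, hx, hxu⟩
    refine ⟨x - b, ?_, ?_⟩
    · rw [IsNear, hkey]; exact hx
    · rw [hkey, reflectTime, hneg, hneg]; exact hxu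
  · rintro ⟨x, hx, hxu⟩
    have hxb : x + b - b = x := by abel
    refine ⟨x + b, ?_, ?_⟩
    · rw [IsNear, ← hkey, hxb]; exact hx
    · rw [← hkey, hxb, reflectTime, ← hneg, ← hneg u, hxb]
      exact hxu

/-- The grid points lie beyond the plane by `3/2` of `r / c`; since `z` is on the plane, its label
has `k 0 = 0`. The last estimate is the curvature of the sphere: the excess `‖w‖ - w 0` grows
quadratically with the label. It pays for larger deviations at labels far from the axis. -/
lemma exists_plane_grid {c r K : ℝ} (hc : 3 ≤ c)
    (hK : 0 ≤ K) (hm : 1 ≤ r / c) (hΘm : Θ (r / c) ≤ r / c) (hΘ1 : 1 ≤ Θ (r / c))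
    {z : EuclideanSpace ℝ (Fin d)} (hz0 : z 0 = r) (hz : ‖z‖ ≤ K * r) :
    ∃ k ∈ gridBox d (⌈d * K * r⌉₊ + 1), ∃ w : EuclideanSpace ℝ (Fin d),
      w = gridPoint (axisPoint d (r + 3 / 2 * (r / c)))
        (fun i => if i = 0 then r / c else √(r / c * Θ (r / c)) / d) k ∧
      IsNear Θ (r / c) w z ∧ ‖w‖ ≤ (K + 1) * r ∧
      ‖k‖ ^ 2 * (r / c * Θ (r / c) / d ^ 2) ≤ 2 * (K + 1) * r * (‖w‖ - w 0) := by
  set m := r / c with hm'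
  set W := √(m * Θ m) with hW
  have hm1 : 1 ≤ m := hm
  have hr : r = c * m := by rw [hm']; field_simp
  have hr3 : 3 * m ≤ r := by rw [hr]; gcongr
  have hW1 : 1 ≤ W := Real.one_le_sqrt.2 (one_le_mul_of_one_le_of_one_le hm1 hΘ1)
  have hWm : W ≤ m := by
    rw [hW, Real.sqrt_le_left (by linarith), sq]
    gcongr
  have hd : (1 : ℝ) ≤ d := by exact_mod_cast NeZero.one_le
  set τ : Fin d → ℝ := fun i => if i = 0 then m else W / d with hτdef
  have hτ0 : τ 0 = m := if_pos rfl
  have hτi : ∀ i, i ≠ 0 → τ i = W / d := fun i hi => if_neg hi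
  have hτ : ∀ i, 0 < τ i := by
    intro i
    by_cases hi : i = 0
    · rw [hi, hτ0]; linarith
    · rw [hτi i hi]; positivity
  set u := axisPoint d (r + 3 / 2 * m) with hu
  obtain ⟨k, hk1, hk2⟩ := exists_gridPoint u (z + axisPoint d (3 / 2 * m)) hτ
  have hk0 : k 0 = 0 := by
    have h1 := hk2 0
    rw [PiLp.add_apply, hu, axisPoint_apply_zero, axisPoint_apply_zero, hz0, sub_self, abs_zero,
      zero_div, zero_add] at h1
    by_contra hne
    have h2 : (1 : ℝ) ≤ |(k 0 : ℝ)| := by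
      rw [← Int.cast_abs]
      exact_mod_cast Int.one_le_abs hne
    linarith
  set w := gridPoint u τ k with hw
  have hw0 : w 0 = r + 3 / 2 * m := by
    rw [hw, gridPoint_apply, hk0, hu, axisPoint_apply_zero]
    simp
  have hwz : (w - z) 0 = 3 / 2 * m := by
    rw [PiLp.sub_apply, hw0, hz0]; ring
  have hperp : perp (w - z) ≤ W := by
    have h2 : perp (w - z) ≤ d * (W / d / 2) := by
      refine perp_le_of_forall_abs_le (by positivity) fun i hi => ?_
      have h0 := hk1 i
      rw [hτi i hi, PiLp.add_apply, axisPoint_apply_ne hi, add_zero, abs_sub_comm] at h0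
      rwa [PiLp.sub_apply]
    have e : d * (W / d / 2) = W / 2 := by field_simp
    rw [e] at h2
    linarith
  have hwn : ‖w‖ ≤ (K + 1) * r := by
    have h1 : ‖w‖ ≤ ‖z‖ + ‖w - z‖ := by
      have := norm_add_le z (w - z)
      rwa [add_sub_cancel] at this
    have h2 := norm_le_abs_add_perp (w - z)
    rw [hwz, abs_of_pos (by linarith)] at h2
    linarith
  have hkperp : ‖k‖ * (W / d) ≤ perp w := by
    rw [← le_div_iff₀ (by positivity)]
    refine (pi_norm_le_iff_of_nonneg (div_nonneg (perp_nonneg _) (by positivity))).2 fun i => ?_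
    by_cases hi : i = 0
    · rw [hi, hk0, norm_zero]
      exact div_nonneg (perp_nonneg _) (by positivity)
    · rw [le_div_iff₀ (by positivity), Int.norm_eq_abs]
      have h1 := abs_apply_le_perp w hi
      rw [hw, gridPoint_apply, hu, axisPoint_apply_ne hi, zero_add, hτi i hi, abs_mul,
        abs_of_pos (by positivity : 0 < W / d)] at h1
      rw [mul_comm]
      exact h1
  refine ⟨k, ?_, w, rfl, ⟨by rw [hwz]; linarith, by rw [hwz]; linarith, hperp⟩, hwn, ?_⟩
  · rw [mem_gridBox]
    intro i
    have h1 : |(k i : ℝ)| ≤ d * K * r + 1 := by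
      have hnn : 0 ≤ d * K * r := mul_nonneg (mul_nonneg (by linarith) hK) (by linarith)
      by_cases hi : i = 0
      · rw [hi, hk0, Int.cast_zero, abs_zero]
        linarith
      · refine (hk2 i).trans ?_
        rw [PiLp.add_apply, axisPoint_apply_ne hi, add_zero, hu, axisPoint_apply_ne hi, sub_zero,
          hτi i hi]
        have h2 : |z i| ≤ K * r := (abs_apply_le_norm z i).trans hz
        have h3 : |z i| / (W / d) ≤ d * K * r := by
          rw [div_le_iff₀ (by positivity)]
          calc |z i| ≤ K * r := h2
            _ ≤ K * r * W := le_mul_of_one_le_right (mul_nonneg hK (by linarith)) hW1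
            _ = _ := by field_simp
        linarith
    have h2 : |(k i : ℝ)| ≤ ((⌈d * K * r⌉₊ + 1 : ℕ) : ℝ) := by
      push_cast
      exact h1.trans (by have := Nat.le_ceil (d * K * r); linarith)
    rw [← Int.cast_abs] at h2
    exact_mod_cast h2
  · have h1 : (‖k‖ * (W / d)) ^ 2 ≤ perp w ^ 2 := pow_le_pow_left₀ (by positivity) hkperp 2
    rw [mul_pow, div_pow, hW, Real.sq_sqrt (by positivity)] at h1
    have h2 := norm_sq_eq w
    have h3 : w 0 ≤ ‖w‖ := (le_abs_self _).trans (abs_apply_le_norm w 0)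
    have h4 : perp w ^ 2 = (‖w‖ + w 0) * (‖w‖ - w 0) := by linarith
    have h5 : (‖w‖ + w 0) * (‖w‖ - w 0) ≤ 2 * (K + 1) * r * (‖w‖ - w 0) := by
      have : 0 ≤ ‖w‖ - w 0 := by linarith
      gcongr
      linarith
    linarith

/-- The inequality `T(0, z) ≥ T(0, w) - T(z, w)` is used with a grid point `w` beyond `z`:
concentration bounds the first term from below, chaining the second from above. Each label has its
own deviation `t k`, so the union bound can be a convergent sum instead of the number of grid
points. The arithmetic is isolated in `hnum`. -/
lemma prob_planeEvent_le (hT : IsPassageModel P T h ψ C₀ C₁ κ₁ κ₂) (hC₁ : 0 ≤ C₁)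
    (hC₀ : 0 ≤ C₀) (hκ₂ : 0 ≤ κ₂)
    {c r K : ℝ} (hc : 3 ≤ c)
    (hK : 0 ≤ K) (hm : 1 ≤ r / c) (hΘm : Θ (r / c) ≤ r / c) (hΘ1 : 1 ≤ Θ (r / c))
    {t E : (Fin d → ℤ) → ℝ} {X : ℝ} (ht : ∀ k, 0 ≤ t k) (ht' : ∀ k, t k ≤ C₀ * r ^ κ₂)
    (hslow : ∀ k u, P.real (slowEvent T μ Θ (r / c) u (E k)) ≤ Real.exp (-(C₀ / 2) * t k ^ κ₁))
    (hnum : ∀ (k : Fin d → ℤ) (ρ w₀ : ℝ), r ≤ w₀ → w₀ ≤ r + 2 * (r / c) → w₀ ≤ ρ →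
      ρ ≤ (K + 1) * r → ‖k‖ ^ 2 * (r / c * Θ (r / c) / d ^ 2) ≤ 2 * (K + 1) * r * (ρ - w₀) →
      X ≤ h ρ - t k * ψ ρ - μ * (w₀ - r) - E k) :
    P.real (planeEvent T K r X) ≤ ∑ k ∈ gridBox d (⌈d * K * r⌉₊ + 1),
      (1 + C₁) * Real.exp (-(C₀ / 2) * t k ^ κ₁) := by
  set w : (Fin d → ℤ) → EuclideanSpace ℝ (Fin d) := fun k =>
    gridPoint (axisPoint d (r + 3 / 2 * (r / c)))
        (fun i => if i = 0 then r / c else √(r / c * Θ (r / c)) / d) k with hw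
  have hr1 : 1 ≤ r := by
    rw [le_div_iff₀ (by linarith)] at hm
    linarith
  set D : (Fin d → ℤ) → Set Ω := fun k =>
    {ω | r ≤ ‖0 - w k‖ ∧ t k * ψ ‖0 - w k‖ < |T ω 0 (w k) - h ‖0 - w k‖|} with hD
  have hDp : ∀ k, P.real (D k) ≤ C₁ * Real.exp (-(C₀ / 2) * t k ^ κ₁) := by
    intro k
    by_cases hk : r ≤ ‖0 - w k‖
    · refine le_trans (measureReal_mono (fun ω hω => hω.2) (measure_ne_top _ _))
        ((hT.conc 0 (w k) (by linarith) (t k) (ht k) ((ht' k).trans ?_)).trans ?_)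
      · gcongr
      · have : 0 ≤ C₀ * t k ^ κ₁ := mul_nonneg hC₀ (Real.rpow_nonneg (ht k) _)
        exact mul_le_mul_of_nonneg_left (Real.exp_le_exp.2 (by linarith)) hC₁
    · have : D k = ∅ := by
        ext ω
        simp only [hD, Set.mem_ofPred_eq, Set.mem_empty_iff_false, iff_false, not_and]
        exact fun h => absurd h hk
      rw [this, measureReal_empty]
      positivity
  have hsub : ∀ᵐ ω ∂P, ω ∈ planeEvent T K r X →
      ω ∈ ⋃ k ∈ gridBox d (⌈d * K * r⌉₊ + 1), (slowEvent T μ Θ (r / c) (w k) (E k) ∪ D k) := by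
    filter_upwards [hT.metric] with ω hω
    rintro ⟨z, hz0, hzK, hzX⟩
    obtain ⟨k, hk, v, hv, hnear, hvn, hkv⟩ := exists_plane_grid hc hK hm hΘm hΘ1 hz0 hzK
    change v = w k at hv
    subst hv
    refine Set.mem_biUnion hk ?_
    by_contra hcon
    rw [Set.mem_union, not_or] at hcon
    obtain ⟨hcon1, hcon2⟩ := hcon
    have h1 : T ω z (w k) ≤ μ * (w k - z) 0 + E k := by
      by_contra h'
      exact hcon1 ⟨z, hnear, not_le.1 h'⟩
    obtain ⟨hn1, hn2, -⟩ := hnear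
    rw [PiLp.sub_apply, hz0] at hn1 hn2 h1
    have h3 : (w k) 0 ≤ ‖w k‖ := (le_abs_self _).trans (abs_apply_le_norm _ 0)
    have h4 := hnum k ‖w k‖ ((w k) 0) (by linarith) (by linarith) h3 hvn hkv
    have h5 : h ‖w k‖ - t k * ψ ‖w k‖ ≤ T ω 0 (w k) := by
      by_contra h'
      refine hcon2 ?_
      have e : ‖0 - w k‖ = ‖w k‖ := by rw [zero_sub, norm_neg]
      refine ⟨by rw [e]; linarith, ?_⟩
      rw [e]
      exact lt_of_lt_of_le (by linarith) (neg_le_abs _)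
    have h6 := hω.2.2 0 z (w k)
    linarith
  refine (ENNReal.toReal_mono (measure_ne_top _ _) (measure_mono_ae hsub)).trans ?_
  refine (measureReal_biUnion_finset_le _ _).trans (Finset.sum_le_sum fun k _ => ?_)
  refine (measureReal_union_le _ _).trans ?_
  have := add_le_add (hslow k (w k)) (hDp k)
  linarith

end Plane

/-! ### Ingredients of the bootstrap -/

section Bootstrap

variable {d : ℕ} [NeZero d] {Ω : Type*} [MeasurableSpace Ω]
  {P : Measure Ω} [IsProbabilityMeasure P]
  {T : Ω → EuclideanSpace ℝ (Fin d) → EuclideanSpace ℝ (Fin d) → ℝ} {h ψ : ℝ → ℝ}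
  {C₀ C₁ κ₁ κ₂ μ A : ℝ} {Φ : ℝ → ℝ} {κ s₀ : ℝ}

/-- The chaining bound for the passage times and for their reflections, with common constants. -/
lemma exists_upperChain_reflect (hT : IsPassageModel P T h ψ C₀ C₁ κ₁ κ₂) (hC₀ : 0 < C₀)
    (hC₁ : 0 < C₁) (hκ₁ : 0 < κ₁) (hκ₂ : 0 < κ₂) (hμ : 0 < μ) {b B : ℝ} (hκ : 0 < κ)
    (hκ' : κ < 1 / 2) (hb : 0 < b) (hs₀ : 1 ≤ s₀) :
    ∃ C t₀ δ n₁ : ℝ, 0 < C ∧ 1 ≤ t₀ ∧ 0 < δ ∧ ∀ Φ : ℝ → ℝ, IsPowerScale Φ κ s₀ →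
      (∀ s, s₀ ≤ s → ψ s ≤ Φ s) → (∀ s, s₀ ≤ s → b * s ^ κ ≤ Φ s ∧ Φ s ≤ B * s ^ (1 - κ)) →
      ∀ M, 0 ≤ M → (∀ s, s₀ ≤ s → h s ≤ μ * s + M * Φ s) → ∀ n, n₁ ≤ n → ∀ t, t₀ ≤ t → t ≤ n ^ δ →
        (∀ u : EuclideanSpace ℝ (Fin d),
          P.real (slowEvent T μ Φ n u (C * (t + M) * Φ n)) ≤ Real.exp (-(C₀ / 2) * t ^ κ₁)) ∧
        ∀ b u : EuclideanSpace ℝ (Fin d),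
          P.real (slowEvent (reflectTime T b) μ Φ n u (C * (t + M) * Φ n)) ≤
            Real.exp (-(C₀ / 2) * t ^ κ₁) := by
  obtain ⟨C, t₀, δ, n₁, hC, ht₀, hδ, H⟩ :=
    exists_upperChain (B := B) hT hC₀ hC₁ hκ₁ hκ₂ hμ hκ hκ' hb hs₀
  obtain ⟨C', t₀', δ', n₁', hC', ht₀', hδ', H'⟩ :=
    exists_upperChain (T := reflectTime T 0) (B := B) (hT.reflect 0) hC₀ hC₁ hκ₁ hκ₂ hμ hκ hκ' hb hs₀
  refine ⟨max C C', max t₀ t₀', min δ δ', max (max n₁ n₁') s₀, hC.trans_le (le_max_left _ _),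
    ht₀.trans (le_max_left _ _), lt_min hδ hδ', ?_⟩
  intro Φ hΦ hψ hbB M hM hh n hn t ht htn
  have hn1 : n₁ ≤ n := (le_max_left _ _).trans ((le_max_left _ _).trans hn)
  have hn2 : n₁' ≤ n := (le_max_right _ _).trans ((le_max_left _ _).trans hn)
  have hns : s₀ ≤ n := (le_max_right _ _).trans hn
  have ht1 := (le_max_left _ _).trans ht
  have ht2 := (le_max_right _ _).trans ht
  have htn1 := htn.trans (Real.rpow_le_rpow_of_exponent_le (by linarith) (min_le_left δ δ'))
  have htn2 := htn.trans (Real.rpow_le_rpow_of_exponent_le (by linarith) (min_le_right δ δ'))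
  have hΦn := hΦ.pos n hns
  have hE : C * (t + M) * Φ n ≤ max C C' * (t + M) * Φ n := by
    have : 0 ≤ t + M := by linarith
    gcongr
    exact le_max_left _ _
  have hE' : C' * (t + M) * Φ n ≤ max C C' * (t + M) * Φ n := by
    have : 0 ≤ t + M := by linarith
    gcongr
    exact le_max_right _ _
  constructor
  · exact fun u => (measureReal_mono (slowEvent_anti Φ n u hE) (measure_ne_top _ _)).trans
      (H Φ hΦ hψ hbB M hM hh n hn1 t ht1 htn1 u)
  · intro b u
    rw [slowEvent_reflectTime]
    exact (measureReal_mono (slowEvent_anti Φ n _ hE') (measure_ne_top _ _)).trans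
      (H' Φ hΦ hψ hbB M hM hh n hn2 t ht2 htn2 _)

/-- With `δ > 0` the perturbed scale dominates `δ s^(κ/2) Φ s`, so the a priori bound holds on it
with a finite constant. The exponent and `s₀` do not depend on `δ`, which keeps the later constants
uniform as `δ` tends to zero. -/
lemma IsPowerScale.perturb (hΦ : IsPowerScale Φ κ s₀) (hκ : 0 < κ) (hs₀ : 1 ≤ s₀) {δ : ℝ}
    (hδ : 0 ≤ δ) : IsPowerScale (fun s => Φ s * (1 + δ * s ^ (κ / 2))) (κ / 2) s₀ := by
  have hpow : ∀ s, s₀ ≤ s → 0 ≤ s ^ (κ / 2) := fun s hs => Real.rpow_nonneg (by linarith) _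
  refine hΦ.mul hs₀ (by linarith) (β := κ / 2) (by linarith) (fun s hs => ?_)
    (fun y n hy hyn => ?_) fun y n hy hyn => ?_
  · have := mul_nonneg hδ (hpow s hs)
    linarith
  · have : y ^ (κ / 2) ≤ n ^ (κ / 2) := Real.rpow_le_rpow (by linarith) hyn (by positivity)
    gcongr
  · have hy0 : 0 < y := by linarith
    have h1 : 1 ≤ (n / y) ^ (κ / 2) := Real.one_le_rpow ((one_le_div hy0).2 hyn) (by positivity)
    have h2 : n ^ (κ / 2) = (n / y) ^ (κ / 2) * y ^ (κ / 2) := by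
      rw [← Real.mul_rpow (div_nonneg (by linarith) hy0.le) hy0.le, div_mul_cancel₀ _ hy0.ne']
    rw [h2]
    linarith

lemma perturb_le {δ s β x : ℝ} (hδ : δ ≤ 1) (hs : 1 ≤ s) (hβ : 0 ≤ β) (hx : 0 ≤ x) :
    x * (1 + δ * s ^ β) ≤ 2 * s ^ β * x := by
  have h1 : 1 ≤ s ^ β := Real.one_le_rpow hs hβ
  have h2 : δ * s ^ β ≤ 1 * s ^ β := by gcongr
  nlinarith

lemma le_perturb {δ s β x : ℝ} (hδ : 0 ≤ δ) (hs : 0 ≤ s) (hx : 0 ≤ x) :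
    x ≤ x * (1 + δ * s ^ β) := by
  have h1 : 0 ≤ δ * s ^ β := mul_nonneg hδ (Real.rpow_nonneg hs _)
  exact le_mul_of_one_le_right hx (by linarith)

lemma linear_le_quadratic {q N x : ℝ} (hq : 0 < q) : x * N ≤ q * N ^ 2 + x ^ 2 / (4 * q) := by
  have h1 : 0 ≤ (2 * q * N - x) ^ 2 / (4 * q) := by positivity
  have h2 : (2 * q * N - x) ^ 2 / (4 * q) = q * N ^ 2 - x * N + x ^ 2 / (4 * q) := by
    field_simp
    ring
  linarith

/-- The deviations `t (1 + ‖k‖)` are capped at `(r / c)^θ` to stay in the range of the concentration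
hypothesis. The capped labels are only polynomially many, and each contributes a stretched
exponential. -/
lemma eventually_sum_weight_le (d : ℕ) {c K C t θ : ℝ} (hC₀ : 0 < C₀) (hκ₁ : 0 < κ₁) (hK : 0 ≤ K)
    (hC : 0 < C) (hc : 1 ≤ c) (hθ : 0 < θ)
    (ht : ∀ R : ℕ, ∑ k ∈ gridBox d R, Real.exp (-(C₀ / 2) * (t * (1 + ‖k‖)) ^ κ₁) ≤ 1 / (16 * C)) :
    ∀ᶠ r : ℝ in atTop, ∑ k ∈ gridBox d (⌈d * K * r⌉₊ + 1),
      C * Real.exp (-(C₀ / 2) * (min (t * (1 + ‖k‖)) ((r / c) ^ θ)) ^ κ₁) ≤ 1 / 8 := by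
  have hc0 : 0 < c := by linarith
  filter_upwards [eventually_card_mul_exp_le d (d * K) C (c := C₀ / 2 * (1 / c) ^ (θ * κ₁))
    (a := θ * κ₁) (ε := 1 / 16) (by positivity) hC.le (by positivity) (by positivity)
    (by norm_num), eventually_ge_atTop 0] with r h1 hr
  set R : ℕ := ⌈d * K * r⌉₊ + 1 with hR
  have h2 : ∀ k ∈ gridBox d R, C * Real.exp (-(C₀ / 2) * (min (t * (1 + ‖k‖)) ((r / c) ^ θ)) ^ κ₁) ≤
      C * Real.exp (-(C₀ / 2) * (t * (1 + ‖k‖)) ^ κ₁) +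
        C * Real.exp (-(C₀ / 2 * (1 / c) ^ (θ * κ₁)) * r ^ (θ * κ₁)) := by
    intro k _
    have e : -(C₀ / 2 * (1 / c) ^ (θ * κ₁)) * r ^ (θ * κ₁) = -(C₀ / 2) * ((r / c) ^ θ) ^ κ₁ := by
      rw [← Real.rpow_mul (by positivity), div_eq_mul_one_div r c,
        Real.mul_rpow hr (by positivity)]
      ring
    rw [e]
    rcases min_choice (t * (1 + ‖k‖)) ((r / c) ^ θ) with h | h
    · rw [h]
      have : 0 ≤ C * Real.exp (-(C₀ / 2) * ((r / c) ^ θ) ^ κ₁) := by positivity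
      linarith
    · rw [h]
      have : 0 ≤ C * Real.exp (-(C₀ / 2) * (t * (1 + ‖k‖)) ^ κ₁) := by positivity
      linarith
  refine (Finset.sum_le_sum h2).trans ?_
  rw [Finset.sum_add_distrib, ← Finset.mul_sum, Finset.sum_const, card_gridBox, nsmul_eq_mul]
  push_cast [hR]
  have h3 := mul_le_mul_of_nonneg_left (ht R) hC.le
  have h4 : C * (1 / (16 * C)) = 1 / 16 := by field_simp
  push_cast [hR] at h3
  linarith

/-- The lower bound for the passage time through the grid point with label `N`. -/
lemma plane_numeric_le {m c r K N ρ w t τ D C M ε L g Θm ΘL ψρ hρ : ℝ} (hm : 0 < m) (hc : 20 ≤ c)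
    (hr : r = c * m) (hL : L = 2 * r) (hK : 0 ≤ K) (hμ : 0 < μ) (hD : 0 < D)
    (hΘm : 0 < Θm) (hΘmL : Θm ≤ ΘL) (hC : 0 < C) (ht : 0 ≤ t) (hτ0 : 0 ≤ τ)
    (hM : 0 ≤ M) (hτ : τ ≤ t * (1 + N)) (hψρ : ψρ ≤ (K + 1) * c * Θm) (hCε : C * Θm ≤ ε * ΘL)
    (hw2 : w ≤ r + 2 * m) (hwρ : w ≤ ρ)
    (hkey : N ^ 2 * (m * Θm / D) ≤ 2 * (K + 1) * r * (ρ - w)) {a' : ℝ}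
    (ha' : a' = (C + (K + 1) * c) * t +
      ((C + (K + 1) * c) * t) ^ 2 / (4 * (μ / (4 * (K + 1) * c * D))))
    {a : ℝ}
    (hfar : g / 2 + (a + 2 * ε * M) * ΘL ≤ μ * L / 40) (hlow : μ * ρ ≤ hρ)
    (hnear : ρ ≤ 5 / 8 * L → g / 2 + (a + 2 * ε * M) * ΘL ≤ hρ - μ * ρ) :
    μ * r + (g / 2 + (a + 2 * ε * M) * ΘL - (a' + ε * M) * ΘL) ≤
      hρ - τ * ψρ - μ * (w - r) - C * (τ + M) * Θm := by
  set x := (C + (K + 1) * c) * t with hx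
  set q := μ / (4 * (K + 1) * c * D) with hq
  have hq0 : 0 < q := by positivity
  have hx0 : 0 ≤ x := by positivity
  have ha'0 : 0 ≤ a' := by rw [ha']; positivity
  -- Half of the gain `μ (ρ - w)` pays for the quadratic term in the label. The other half is kept
  -- for distant points.
  have h1 : q * N ^ 2 * Θm ≤ μ / 2 * (ρ - w) := by
    have e : q * N ^ 2 * Θm = μ / (4 * (K + 1) * c * m) * (N ^ 2 * (m * Θm / D)) := by
      rw [hq]; field_simp
    rw [e, hr] at *
    calc μ / (4 * (K + 1) * c * m) * (N ^ 2 * (m * Θm / D))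
        ≤ μ / (4 * (K + 1) * c * m) * (2 * (K + 1) * (c * m) * (ρ - w)) := by gcongr
      _ = _ := by field_simp; ring
  have h2 : τ * ψρ ≤ τ * ((K + 1) * c * Θm) := by gcongr
  have h3 : (C + (K + 1) * c) * τ * Θm ≤ (x + x * N) * Θm := by
    have : (C + (K + 1) * c) * τ ≤ (C + (K + 1) * c) * (t * (1 + N)) := by gcongr
    have e : (C + (K + 1) * c) * (t * (1 + N)) = x + x * N := by rw [hx]; ring
    rw [e] at this
    gcongr
  -- Completing the square removes the label from the deviation at the price of the constant `a'`.
  have h4 : (x + x * N) * Θm ≤ (q * N ^ 2 + a') * Θm := by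
    have := linear_le_quadratic (N := N) (x := x) hq0
    rw [ha']
    gcongr ?_ * Θm
    linarith
  have h5 : a' * Θm ≤ a' * ΘL := by gcongr
  have h6 : M * (C * Θm) ≤ M * (ε * ΘL) := by gcongr
  have hmain : hρ - μ * ρ + μ * r + μ / 2 * (ρ - w) - (a' + ε * M) * ΘL ≤
      hρ - τ * ψρ - μ * (w - r) - C * (τ + M) * Θm := by linarith
  refine le_trans ?_ hmain
  -- Since `w` is at most `11 L / 20`, a point with `ρ ≥ 5 L / 8` has `ρ - w ≥ 3 L / 40`, and the
  -- kept half of the gain exceeds the target `μ L / 40`.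
  rcases le_total ρ (5 / 8 * L) with h' | h'
  · have h7 := hnear h'
    have h8 : 0 ≤ μ / 2 * (ρ - w) := mul_nonneg (by linarith) (by linarith)
    linarith
  · have h9 : 20 * m ≤ r := by rw [hr]; gcongr
    have h7 : 3 / 40 * L ≤ ρ - w := by linarith
    have h8 : μ / 2 * (3 / 40 * L) ≤ μ / 2 * (ρ - w) := by gcongr
    have h10 : 0 ≤ μ * L := mul_nonneg hμ.le (by nlinarith)
    linarith

end Bootstrap

/-! ### The bootstrap for the nonrandom fluctuations -/

section Bootstrap

variable {d : ℕ} [NeZero d] {Ω : Type*} [MeasurableSpace Ω]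
  {P : Measure Ω} [IsProbabilityMeasure P]
  {T : Ω → EuclideanSpace ℝ (Fin d) → EuclideanSpace ℝ (Fin d) → ℝ} {h ψ : ℝ → ℝ}
  {C₀ C₁ κ₁ κ₂ μ A : ℝ} {Φ : ℝ → ℝ} {κ s₀ : ℝ}

set_option maxHeartbeats 1600000 in
-- The midpoint argument is repeated with chaining on the scale `r / c` in place of a crude union
-- bound, so no power of `L` is lost. The constant `M` enters through the chaining error on the
-- smaller scale, hence with the small factor `ε`, and neither `a` nor `L₁` depends on `M` or `δ`.
lemma exists_halving (hT : IsPassageModel P T h ψ C₀ C₁ κ₁ κ₂) (hh : IsMeanTime h μ A)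
    (hcross : HasCrossing P T)
    (hC₀ : 0 < C₀) (hC₁ : 0 < C₁) (hκ₁ : 0 < κ₁) (hκ₂ : 0 < κ₂)
    (hΦ : IsPowerScale Φ κ s₀) (hκ : 0 < κ) (hκ1 : κ < 1) (hs₀ : 1 ≤ s₀)
    (hψ : ∀ s, s₀ ≤ s → ψ s ≤ Φ s) {ε : ℝ} (hε : 0 < ε) :
    ∃ a L₁, 0 ≤ a ∧ ∀ δ, 0 < δ → δ ≤ 1 → ∀ M, 0 ≤ M →
      (∀ s, s₀ ≤ s → h s - μ * s ≤ M * (Φ s * (1 + δ * s ^ (κ / 2)))) →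
      ∀ L, L₁ ≤ L → ∃ s, L / 2 ≤ s ∧ s ≤ 5 / 8 * L ∧
        h s - μ * s ≤ (h L - μ * L) / 2 + (a + 2 * ε * M) * (Φ L * (1 + δ * L ^ (κ / 2))) := by
  have hμ := hh.speed_pos
  have hκ2 : 0 < κ / 2 := by positivity
  obtain ⟨K, tm, hK3, htm, hmid⟩ := exists_midpoint hT hh hcross hC₀ hC₁ hκ₁ hκ₂ hΦ hκ hκ1 hs₀ hψ
  obtain ⟨A', hA', hapriori⟩ := exists_apriori hT hh hcross hC₀ hC₁ hκ₁ hκ₂ hΦ hκ hκ1 hs₀ hψ hκ2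
    (half_lt_self hκ)
  have hb : 0 < Φ s₀ / s₀ ^ κ := div_pos (hΦ.pos _ le_rfl) (Real.rpow_pos_of_pos (by linarith) _)
  obtain ⟨C, t₀, δ₀, n₁, hC, ht₀, hδ₀, hchain⟩ := exists_upperChain_reflect (κ := κ / 2)
    (b := Φ s₀ / s₀ ^ κ) (B := 2 * (Φ s₀ / s₀ ^ (1 - κ))) hT hC₀ hC₁ hκ₁ hκ₂ hμ hκ2 (by linarith)
    hb hs₀
  -- The second condition yields `C Θ(r / c) ≤ ε Θ L`, which makes the contribution of `M` small.
  obtain ⟨c, hc20, hcε⟩ : ∃ c : ℝ, 20 ≤ c ∧ C / ε ≤ c ^ (κ / 2) :=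
    ((eventually_ge_atTop 20).and ((tendsto_rpow_atTop hκ2).eventually_ge_atTop _)).exists
  have hc0 : 0 < c := by linarith
  obtain ⟨t, ht1, ht2⟩ := exists_sum_exp_le d (half_pos hC₀) hκ₁
    (show 0 < 1 / (16 * (1 + C₁)) by positivity) t₀
  set θ := min δ₀ κ₂ / 2 with hθ
  have hmin : 0 < min δ₀ κ₂ := lt_min hδ₀ hκ₂
  have hθ0 : 0 < θ := half_pos hmin
  have hθ1 : θ ≤ δ₀ := by have := min_le_left δ₀ κ₂; linarith
  have hθ2 : θ < κ₂ := by have := min_le_right δ₀ κ₂; linarith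
  have hd : (1 : ℝ) ≤ d := by exact_mod_cast NeZero.one_le
  have hD : (0 : ℝ) < (d : ℝ) ^ 2 := by positivity
  obtain ⟨C₃, hC₃⟩ : ∃ C₃, C₃ = (C + (K + 1) * c) * t +
      ((C + (K + 1) * c) * t) ^ 2 / (4 * (μ / (4 * (K + 1) * c * (d : ℝ) ^ 2))) := ⟨_, rfl⟩
  have ht0 : 0 < t := by linarith
  have hC₃0 : 0 ≤ C₃ := by
    rw [hC₃]
    have : 0 < K := by linarith
    positivity
  obtain ⟨s₁, hs₁⟩ := hh.limit (μ / 50) (by positivity)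
  have hd2 : Tendsto (fun L : ℝ => L / 2) atTop atTop := tendsto_id.atTop_div_const two_pos
  have hdc : Tendsto (fun L : ℝ => L / 2 / c) atTop atTop := hd2.atTop_div_const hc0
  obtain ⟨L₁, hL₁⟩ := eventually_atTop.1 ((hd2.eventually hmid).and ((hd2.eventually
    (eventually_sum_weight_le d hC₀ hκ₁ (show 0 ≤ K by linarith) (show 0 < 1 + C₁ by linarith)
      (show 1 ≤ c by linarith) hθ0 ht2)).and
    ((hΦ.eventually_mul_rpow_le hs₀ (400 * (C₃ + tm) / μ) (by positivity) (half_lt_self hκ)).and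
    ((hΦ.eventually_mul_rpow_le hs₀ (400 * A' / μ) (by positivity) (half_lt_self hκ)).and
    ((hdc.eventually (hΦ.eventually_mul_rpow_le hs₀ 2 zero_le_two (half_lt_self hκ))).and
    ((hdc.eventually (hΦ.eventually_rpow_le hs₀ (half_lt_self hκ))).and
    ((hd2.eventually (eventually_mul_rpow_le (1 / C₀) hθ2)).and
    ((hdc.eventually ((tendsto_rpow_atTop hθ0).eventually_ge_atTop t₀)).and
    ((hdc.eventually_ge_atTop (max n₁ s₀)).and (eventually_ge_atTop s₁))))))))))
  refine ⟨C₃ + tm, L₁, by positivity, fun δ hδ hδ1 M hM hhM L hL => ?_⟩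
  obtain ⟨hm, hsum, hE1, hE2, hE3, hE4, hE5, hE6, hE7, hE8⟩ := hL₁ L hL
  obtain ⟨Θ, hΘdef⟩ : ∃ Θ : ℝ → ℝ, Θ = fun s => Φ s * (1 + δ * s ^ (κ / 2)) := ⟨_, rfl⟩
  have hΘ : IsPowerScale Θ (κ / 2) s₀ := by rw [hΘdef]; exact hΦ.perturb hκ hs₀ hδ.le
  have hΦΘ : ∀ s, s₀ ≤ s → Φ s ≤ Θ s := fun s hs => by
    rw [hΘdef]; exact le_perturb hδ.le (by linarith) (hΦ.pos s hs).le
  have hΘΦ : ∀ s, s₀ ≤ s → Θ s ≤ 2 * s ^ (κ / 2) * Φ s := fun s hs => by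
    rw [hΘdef]; exact perturb_le hδ1 (by linarith) hκ2.le (hΦ.pos s hs).le
  have hhM' : ∀ s, s₀ ≤ s → h s ≤ μ * s + M * Θ s := fun s hs => by
    have := hhM s hs
    rw [hΘdef]
    linarith
  have hgoal : Φ L * (1 + δ * L ^ (κ / 2)) = Θ L := by rw [hΘdef]
  rw [hgoal]
  have hbB : ∀ s, s₀ ≤ s → Φ s₀ / s₀ ^ κ * s ^ (κ / 2) ≤ Θ s ∧
      Θ s ≤ 2 * (Φ s₀ / s₀ ^ (1 - κ)) * s ^ (1 - κ / 2) := by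
    intro s hs
    have hs1 : 1 ≤ s := by linarith
    constructor
    · have h1 : s ^ (κ / 2) ≤ s ^ κ := Real.rpow_le_rpow_of_exponent_le hs1 (by linarith)
      have h2 := hΦ.rpow_le hs₀ hs
      have h3 := mul_le_mul_of_nonneg_left h1 hb.le
      linarith [hΦΘ s hs]
    · have h1 := hΦ.le_rpow hs₀ hs
      have h2 : s ^ (1 - κ / 2) = s ^ (κ / 2) * s ^ (1 - κ) := by
        rw [← Real.rpow_add (by linarith)]; congr 1; ring
      have h3 : 0 ≤ 2 * s ^ (κ / 2) := by positivity
      have h4 := mul_le_mul_of_nonneg_left h1 h3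
      rw [h2]
      linarith [hΘΦ s hs]
  have hψΘ : ∀ s, s₀ ≤ s → ψ s ≤ Θ s := fun s hs => (hψ s hs).trans (hΦΘ s hs)
  obtain ⟨r, hr⟩ : ∃ r, r = L / 2 := ⟨_, rfl⟩
  rw [← hr] at hm hsum hE3 hE4 hE5 hE6 hE7 ⊢
  have e : L = 2 * r := by rw [hr]; ring
  rw [← e] at hm
  obtain ⟨m, hmdef⟩ : ∃ m, m = r / c := ⟨_, rfl⟩
  have hms : s₀ ≤ m := by rw [hmdef]; exact (le_max_right _ _).trans hE7
  have hmn : n₁ ≤ m := by rw [hmdef]; exact (le_max_left _ _).trans hE7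
  have hm1 : 1 ≤ m := by linarith
  have hrm : r = c * m := by rw [hmdef]; field_simp
  have hmr : m ≤ r := by rw [hrm]; exact le_mul_of_one_le_left (by linarith) (by linarith)
  have hrs : s₀ ≤ r := by linarith
  have hLs : s₀ ≤ L := by linarith
  -- If `M` is so large that the a priori bound is stronger, the claim holds at `s = L / 2`.
  -- Otherwise `ε M Θ L` is bounded by the a priori term, hence is a small part of `L`, for all `L ≥
  -- L₁` with `L₁` independent of `M`.
  by_cases htriv : A' * (L ^ (κ / 2) * Φ L) ≤ ε * M * Θ L
  · refine ⟨r, le_rfl, by linarith, ?_⟩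
    have h1 := hapriori r hrs
    have h2 : r ^ (κ / 2) * Φ r ≤ L ^ (κ / 2) * Φ L := by
      have h3 := hΦ.mono hκ.le hs₀ hrs (show r ≤ L by linarith)
      have h4 := hΦ.pos r hrs
      have h5 : r ^ (κ / 2) ≤ L ^ (κ / 2) := Real.rpow_le_rpow (by linarith) (by linarith) hκ2.le
      have h6 : 0 ≤ L ^ (κ / 2) := Real.rpow_nonneg (by linarith) _
      gcongr
    have h3 := mul_le_mul_of_nonneg_left h2 hA'.le
    have h4 := hh.lower L (by linarith)
    have h5 := hΘ.pos L hLs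
    have h6 : 0 ≤ (C₃ + tm) * Θ L := by positivity
    have h7 : 0 ≤ ε * M * Θ L := by positivity
    linarith
  by_contra hcon
  push Not at htriv hcon
  have hΘm := hΘ.pos m hms
  have hΘL := hΘ.pos L hLs
  have hgL := hs₁ L hE8
  have hfar : (h L - μ * L) / 2 + (C₃ + tm + 2 * ε * M) * Θ L ≤ μ * L / 40 := by
    rw [div_mul_eq_mul_div, div_mul_eq_mul_div, div_le_iff₀ hμ] at hE1 hE2
    have h1 := mul_le_mul_of_nonneg_left (hΘΦ L hLs) (show 0 ≤ C₃ + tm by positivity)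
    have h2 : 0 ≤ μ * L := mul_nonneg hμ.le (by linarith)
    linarith
  set w : (Fin d → ℤ) → ℝ := fun k => min (t * (1 + ‖k‖)) (m ^ θ) with hw
  have hθm : 0 ≤ m ^ θ := Real.rpow_nonneg (by linarith) _
  have hw0 : ∀ k, t₀ ≤ w k := by
    intro k
    refine le_min (ht1.trans (le_mul_of_one_le_right ht0.le ?_)) ?_
    · have := norm_nonneg k
      linarith
    · rw [hmdef]; exact hE6
  have hwm : ∀ k, w k ≤ m ^ δ₀ := fun k => (min_le_right _ _).trans
    (Real.rpow_le_rpow_of_exponent_le hm1 hθ1)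
  have hwC : ∀ k, w k ≤ C₀ * r ^ κ₂ := by
    intro k
    refine (min_le_right _ _).trans ?_
    rw [div_mul_eq_mul_div, one_mul, div_le_iff₀ hC₀] at hE5
    have : m ^ θ ≤ r ^ θ := Real.rpow_le_rpow (by linarith) hmr hθ0.le
    linarith
  have hΘmm : Θ m ≤ m := by
    rw [← hmdef] at hE3
    exact (hΘΦ m hms).trans hE3
  have hΘm1 : 1 ≤ Θ m := by
    rw [← hmdef] at hE4
    exact (Real.one_le_rpow hm1 hκ2.le).trans (hE4.trans (hΦΘ m hms))
  have hΘmL : Θ m ≤ Θ L := hΘ.mono hκ2.le hs₀ hms (by linarith)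
  have hCε : C * Θ m ≤ ε * Θ L := by
    have h1 := hΘ.lower m r hms hmr
    have e1 : r / m = c := by rw [hrm]; field_simp
    rw [e1] at h1
    have h2 := hΘ.mono hκ2.le hs₀ hrs (show r ≤ L by linarith)
    rw [div_le_iff₀ hε] at hcε
    calc C * Θ m ≤ c ^ (κ / 2) * ε * Θ m := by gcongr
      _ = ε * (c ^ (κ / 2) * Θ m) := by ring
      _ ≤ ε * Θ L := by gcongr; linarith
  obtain ⟨Y, hY⟩ : ∃ Y, Y = (h L - μ * L) / 2 + (C₃ + tm + 2 * ε * M) * Θ L -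
      (C₃ + ε * M) * Θ L := ⟨_, rfl⟩
  have hnum : ∀ (k : Fin d → ℤ) (ρ w₀ : ℝ), r ≤ w₀ → w₀ ≤ r + 2 * (r / c) → w₀ ≤ ρ →
      ρ ≤ (K + 1) * r → ‖k‖ ^ 2 * (r / c * Θ (r / c) / d ^ 2) ≤ 2 * (K + 1) * r * (ρ - w₀) →
      μ * r + Y ≤ h ρ - w k * ψ ρ - μ * (w₀ - r) - C * (w k + M) * Θ m := by
    intro k ρ w₀ h1 h2 h3 h4 h5
    rw [← hmdef] at h2 h5
    have hρs : s₀ ≤ ρ := by linarith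
    have hψρ : ψ ρ ≤ (K + 1) * c * Θ m := (hψΘ ρ hρs).trans
      (hΘ.le_mul hκ2.le hs₀ hms (by linarith) (by rw [mul_assoc, ← hrm]; exact h4))
    rw [hY]
    exact plane_numeric_le (by linarith) hc20 hrm e (by linarith) hμ hD hΘm hΘmL hC ht0.le
      (by linarith [hw0 k]) hM (min_le_left _ _) hψρ hCε h2 h3 h5 hC₃ hfar
      (hh.lower ρ (by linarith)) fun h' => (hcon ρ (h1.trans h3) h').le
  rw [← hmdef] at hsum hE7
  have hslow := fun k => hchain Θ hΘ hψΘ hbB M hM hhM' m hmn (w k) (hw0 k) (hwm k)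
  have hfinal := hm Y
    ((prob_planeEvent_le hT hC₁.le hC₀.le hκ₂.le (c := c) (by linarith) (by linarith)
      (by rw [← hmdef]; exact hm1) (by rw [← hmdef]; exact hΘmm) (by rw [← hmdef]; exact hΘm1)
      (fun k => by linarith [hw0 k]) hwC (fun k u => by rw [← hmdef]; exact (hslow k).1 u)
      hnum).trans hsum)
    ((prob_planeEvent_le (hT.reflect (axisPoint d L)) hC₁.le hC₀.le hκ₂.le (c := c) (by linarith)
      (by linarith)
      (by rw [← hmdef]; exact hm1) (by rw [← hmdef]; exact hΘmm) (by rw [← hmdef]; exact hΘm1)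
      (fun k => by linarith [hw0 k]) hwC
      (fun k u => by rw [← hmdef]; exact (hslow k).2 (axisPoint d L) u)
      hnum).trans hsum)
  have h1 : tm * Φ L ≤ tm * Θ L := by gcongr; exact hΦΘ L hLs
  have h2 : 0 < tm * Θ L := by positivity
  have h3 : 0 ≤ ε * M * Θ L := by positivity
  rw [hY] at hfinal
  linarith

/-- The nonrandom fluctuations are bounded by the scale of the random fluctuations. -/
lemma exists_mean_le (hT : IsPassageModel P T h ψ C₀ C₁ κ₁ κ₂) (hh : IsMeanTime h μ A)
    (hcross : HasCrossing P T)
    (hC₀ : 0 < C₀) (hC₁ : 0 < C₁) (hκ₁ : 0 < κ₁) (hκ₂ : 0 < κ₂)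
    (hΦ : IsPowerScale Φ κ s₀) (hκ : 0 < κ) (hκ1 : κ < 1) (hs₀ : 1 ≤ s₀)
    (hψ : ∀ s, s₀ ≤ s → ψ s ≤ Φ s) :
    ∃ M, 0 ≤ M ∧ ∀ s, s₀ ≤ s → h s ≤ μ * s + M * Φ s := by
  have hκ2 : 0 < κ / 2 := by positivity
  obtain ⟨G, hG, hdesc⟩ := hh.descent hκ2 hs₀
  obtain ⟨a, L₁, ha, hhalf⟩ := exists_halving hT hh hcross hC₀ hC₁ hκ₁ hκ₂ hΦ hκ hκ1 hs₀ hψ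
    (show 0 < 1 / (4 * G) by positivity)
  obtain ⟨A₂, hA₂, hfin⟩ := hdesc L₁
  obtain ⟨A', hA', hapriori⟩ := exists_apriori hT hh hcross hC₀ hC₁ hκ₁ hκ₂ hΦ hκ hκ1 hs₀ hψ hκ2
    (half_lt_self hκ)
  have hpos := hΦ.pos s₀ le_rfl
  set B := G * a + A₂ / Φ s₀ with hB
  have hB0 : 0 ≤ B := by positivity
  -- The value `ε = 1 / (4 G)` turns the factor `G` from the descent times `2 ε M` into `M / 2`, so
  -- an admissible constant `M` is improved to `B + M / 2`, with fixed point `2 B`.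
  have himp : ∀ δ, 0 < δ → δ ≤ 1 → ∀ M, 0 ≤ M →
      (∀ s, s₀ ≤ s → h s - μ * s ≤ M * (Φ s * (1 + δ * s ^ (κ / 2)))) →
      ∀ s, s₀ ≤ s → h s - μ * s ≤ (B + M / 2) * (Φ s * (1 + δ * s ^ (κ / 2))) := by
    intro δ hδ hδ1 M hM hhM s hs
    have h1 := hfin _ (hΦ.perturb hκ hs₀ hδ.le) (a + 2 * (1 / (4 * G)) * M) (by positivity)
      (hhalf δ hδ hδ1 M hM hhM) s hs
    have h2 : G * (a + 2 * (1 / (4 * G)) * M) = G * a + M / 2 := by field_simp; ring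
    rw [h2] at h1
    have h3 : Φ s₀ ≤ Φ s * (1 + δ * s ^ (κ / 2)) := (hΦ.mono hκ.le hs₀ le_rfl hs).trans
      (le_perturb hδ.le (by linarith) (hΦ.pos s hs).le)
    have h4 : A₂ ≤ A₂ / Φ s₀ * (Φ s * (1 + δ * s ^ (κ / 2))) := by
      calc A₂ = A₂ / Φ s₀ * Φ s₀ := (div_mul_cancel₀ _ hpos.ne').symm
        _ ≤ _ := by gcongr
    rw [hB]
    linarith
  refine ⟨2 * B, by positivity, fun s hs => ?_⟩
  have hΦs := hΦ.pos s hs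
  have hδbound : ∀ δ, 0 < δ → δ ≤ 1 → h s - μ * s ≤ 2 * B * (Φ s * (1 + δ * s ^ (κ / 2))) := by
    intro δ hδ hδ1
    -- The iteration starts from the a priori constant `A' / δ`, which blows up as `δ` tends to
    -- zero. Its limit `2 B` does not depend on `δ`, so `δ` can be removed afterwards.
    have hn : ∀ n : ℕ, ∀ s, s₀ ≤ s →
        h s - μ * s ≤ (2 * B + (A' / δ) * (1 / 2) ^ n) * (Φ s * (1 + δ * s ^ (κ / 2))) := by
      intro n
      induction n with
      | zero =>
        intro s hs
        have hΦs := hΦ.pos s hs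
        have hsκ : 0 ≤ s ^ (κ / 2) := Real.rpow_nonneg (by linarith) _
        have e : (2 * B + A' / δ * (1 / 2) ^ 0) * (Φ s * (1 + δ * s ^ (κ / 2))) =
            A' * (s ^ (κ / 2) * Φ s) + (2 * B * (Φ s * (1 + δ * s ^ (κ / 2))) + A' / δ * Φ s) := by
          field_simp
          ring
        have h1 := hapriori s hs
        have h2 : 0 ≤ 2 * B * (Φ s * (1 + δ * s ^ (κ / 2))) + A' / δ * Φ s := by positivity
        rw [e]
        linarith
      | succ n ih =>
        intro s hs
        refine (himp δ hδ hδ1 _ (by positivity) ih s hs).trans (le_of_eq ?_)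
        rw [pow_succ]
        ring
    have hlim : Tendsto (fun n : ℕ => (2 * B + (A' / δ) * (1 / 2) ^ n) *
        (Φ s * (1 + δ * s ^ (κ / 2)))) atTop
        (nhds ((2 * B + (A' / δ) * 0) * (Φ s * (1 + δ * s ^ (κ / 2))))) :=
      (((tendsto_pow_atTop_nhds_zero_of_lt_one (by norm_num) (by norm_num)).const_mul _).const_add
        _).mul_const _
    rw [mul_zero, add_zero] at hlim
    exact ge_of_tendsto' hlim fun n => hn n s hs
  have hlim : Tendsto (fun δ : ℝ => 2 * B * (Φ s * (1 + δ * s ^ (κ / 2)))) (nhdsWithin 0 (Set.Ioi 0))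
      (nhds (2 * B * (Φ s * (1 + 0 * s ^ (κ / 2))))) :=
    Tendsto.mono_left (Continuous.tendsto (by fun_prop) 0) nhdsWithin_le_nhds
  rw [zero_mul, add_zero, mul_one] at hlim
  have h1 : h s - μ * s ≤ 2 * B * Φ s := by
    refine ge_of_tendsto hlim ?_
    filter_upwards [Ioo_mem_nhdsGT (show (0 : ℝ) < 1 by norm_num)] with δ hδ
    exact hδbound δ hδ.1 hδ.2.le
  linarith

end Bootstrap

/-! ### Passage times between parabolic boxes -/

section Boxes

variable {d : ℕ} [NeZero d] {Ω : Type*} [MeasurableSpace Ω]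
  {P : Measure Ω} [IsProbabilityMeasure P]
  {T : Ω → EuclideanSpace ℝ (Fin d) → EuclideanSpace ℝ (Fin d) → ℝ} {h ψ : ℝ → ℝ}
  {C₀ C₁ κ₁ κ₂ μ A : ℝ} {Φ : ℝ → ℝ} {κ s₀ : ℝ}

set_option maxHeartbeats 1600000 in
/-- Simultaneous fluctuation bound for the passage times between two parabolic boxes. -/
lemma exists_prob_box_le (hT : IsPassageModel P T h ψ C₀ C₁ κ₁ κ₂) (hh : IsMeanTime h μ A)
    (hcross : HasCrossing P T)
    (hC₀ : 0 < C₀) (hC₁ : 0 < C₁) (hκ₁ : 0 < κ₁) (hκ₂ : 0 < κ₂)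
    (hΦ : IsPowerScale Φ κ s₀) (hκ : 0 < κ) (hκ' : κ < 1 / 2) (hs₀ : 1 ≤ s₀)
    (hψ : ∀ s, s₀ ≤ s → ψ s ≤ Φ s) :
    ∃ C t₀ δ : ℝ, 0 < C ∧ 0 < δ ∧ ∀ᶠ n : ℝ in atTop, ∀ t, t₀ ≤ t → t ≤ n ^ δ →
      P.real {ω | ∃ x y, |x 0| ≤ n / 24 ∧ |y 0 - n| ≤ n / 24 ∧ perp x ≤ √(n / 4 * Φ (n / 4)) ∧
        perp y ≤ √(n / 4 * Φ (n / 4)) ∧ C * (t * Φ n) < |T ω x y - h ‖x - y‖|} ≤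
      (4 + 2 * C₁) * Real.exp (-(C₀ / 2) * t ^ κ₁) := by
  have hμ := hh.speed_pos
  obtain ⟨M, hM, hhM⟩ := exists_mean_le hT hh hcross hC₀ hC₁ hκ₁ hκ₂ hΦ hκ (by linarith) hs₀ hψ
  have hb : 0 < Φ s₀ / s₀ ^ κ := div_pos (hΦ.pos _ le_rfl) (Real.rpow_pos_of_pos (by linarith) _)
  obtain ⟨C, t₀, δ₀, n₁, hC, ht₀, hδ₀, hchain⟩ := exists_upperChain_reflect
    (b := Φ s₀ / s₀ ^ κ) (B := Φ s₀ / s₀ ^ (1 - κ)) hT hC₀ hC₁ hκ₁ hκ₂ hμ hκ hκ' hb hs₀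
  have hmin : 0 < min δ₀ κ₂ := lt_min hδ₀ hκ₂
  refine ⟨(2 * C + 2 + μ) * (1 + M), t₀, min δ₀ κ₂ / 2, by positivity, half_pos hmin, ?_⟩
  have hδ1 : min δ₀ κ₂ / 2 < δ₀ := by have := min_le_left δ₀ κ₂; linarith
  have hδ2 : min δ₀ κ₂ / 2 < κ₂ := by have := min_le_right δ₀ κ₂; linarith
  have hd4 : Tendsto (fun n : ℝ => n / 4) atTop atTop := tendsto_id.atTop_div_const (by norm_num)
  filter_upwards [eventually_mul_rpow_le (4 ^ δ₀) hδ1, eventually_mul_rpow_le (3 ^ κ₂ / C₀) hδ2,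
    hd4.eventually_ge_atTop (max n₁ s₀),
    hd4.eventually (hΦ.eventually_mul_rpow_le hs₀ 1 zero_le_one hκ)] with n hn1 hn2 hn3 hn4 t ht htn
  have hn4s : s₀ ≤ n / 4 := (le_max_right _ _).trans hn3
  have hn0 : 0 < n := by linarith
  rw [Real.rpow_zero, one_mul, one_mul] at hn4
  have ht1 : 1 ≤ t := ht₀.trans ht
  have ht4 : t ≤ (n / 4) ^ δ₀ := by
    rw [Real.div_rpow hn0.le (by norm_num), le_div_iff₀ (by positivity)]
    have : (0 : ℝ) < 4 ^ δ₀ := by positivity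
    nlinarith
  have ht3 : t ≤ C₀ * (n / 3) ^ κ₂ := by
    have h3 : (0 : ℝ) < 3 ^ κ₂ := by positivity
    rw [div_mul_eq_mul_div, div_le_iff₀ hC₀] at hn2
    rw [Real.div_rpow hn0.le (by norm_num), ← mul_div_assoc, le_div_iff₀ h3]
    nlinarith
  have hslow := hchain Φ hΦ hψ (fun s hs => ⟨hΦ.rpow_le hs₀ hs, hΦ.le_rpow hs₀ hs⟩) M hM hhM (n / 4)
    ((le_max_left _ _).trans hn3) t ht ht4
  set E := C * (t + M) * Φ (n / 4) with hE
  set W := √(n / 4 * Φ (n / 4)) with hW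
  have hΦ4 := hΦ.pos _ hn4s
  have hΦn4 : Φ (n / 4) ≤ Φ n := hΦ.mono hκ.le hs₀ hn4s (by linarith)
  have hconc : ∀ a b : ℝ, n / 3 ≤ b - a →
      P.real {ω | t * ψ (b - a) < |T ω (axisPoint d a) (axisPoint d b) - h (b - a)|} ≤
        C₁ * Real.exp (-(C₀ / 2) * t ^ κ₁) := by
    intro a b hab
    have hnorm : ‖axisPoint d a - axisPoint d b‖ = b - a := by
      rw [← axisPoint_sub, norm_axisPoint, abs_sub_comm, abs_of_pos (by linarith)]
    have h1 := hT.conc (axisPoint d a) (axisPoint d b) (by rw [hnorm]; linarith) t (by linarith)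
      (ht3.trans (by rw [hnorm]; gcongr))
    rw [hnorm] at h1
    refine h1.trans (mul_le_mul_of_nonneg_left (Real.exp_le_exp.2 ?_) hC₁.le)
    have : 0 ≤ C₀ * t ^ κ₁ := by positivity
    linarith
  -- The events `S₁`, `S₂`, `S₅` concern the route from `x` through `n/3` and `2n/3` to `y`; the
  -- events `S₃`, `S₄`, `S₆` concern the outer points `-n/3` and `4n/3`. Reflection is used where
  -- the moving point lies after the fixed one.
  set S₁ := slowEvent T μ Φ (n / 4) (axisPoint d (n / 3)) E with hS₁
  set S₂ := slowEvent (reflectTime T 0) μ Φ (n / 4) (axisPoint d (-(2 * n / 3))) E with hS₂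
  set S₃ := slowEvent (reflectTime T 0) μ Φ (n / 4) (axisPoint d (n / 3)) E with hS₃
  set S₄ := slowEvent T μ Φ (n / 4) (axisPoint d (4 * n / 3)) E with hS₄
  set S₅ := {ω | t * ψ (2 * n / 3 - n / 3) <
    |T ω (axisPoint d (n / 3)) (axisPoint d (2 * n / 3)) - h (2 * n / 3 - n / 3)|} with hS₅
  set S₆ := {ω | t * ψ (4 * n / 3 - -(n / 3)) <
    |T ω (axisPoint d (-(n / 3))) (axisPoint d (4 * n / 3)) - h (4 * n / 3 - -(n / 3))|} with hS₆
  have hprob : P.real (S₁ ∪ S₂ ∪ S₃ ∪ S₄ ∪ S₅ ∪ S₆) ≤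
      (4 + 2 * C₁) * Real.exp (-(C₀ / 2) * t ^ κ₁) := by
    refine ((measureReal_union_le _ _).trans (add_le_add ((measureReal_union_le _ _).trans
      (add_le_add ((measureReal_union_le _ _).trans (add_le_add ((measureReal_union_le _ _).trans
      (add_le_add ((measureReal_union_le _ _).trans (add_le_add (hslow.1 _) (hslow.2 0 _)))
      (hslow.2 0 _))) (hslow.1 _))) (hconc _ _ ?_))) (hconc _ _ ?_))).trans (le_of_eq ?_)
    · linarith
    · linarith
    · ring
  refine le_trans (ENNReal.toReal_mono (measure_ne_top _ _) (measure_mono_ae ?_)) hprob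
  filter_upwards [hT.metric] with ω hω
  rintro ⟨x, y, hx0, hy0, hxp, hyp, hxy⟩
  by_contra hcon
  have hcon' : ω ∉ S₁ ∪ S₂ ∪ S₃ ∪ S₄ ∪ S₅ ∪ S₆ := hcon
  simp only [Set.mem_union, not_or] at hcon'
  obtain ⟨⟨⟨⟨⟨c1, c2⟩, c3⟩, c4⟩, c5⟩, c6⟩ := hcon'
  rw [abs_le] at hx0 hy0
  have hbefore : ∀ (z : EuclideanSpace ℝ (Fin d)) (a : ℝ), n / 4 ≤ a - z 0 → a - z 0 ≤ n / 2 →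
      perp z ≤ W → ω ∉ slowEvent T μ Φ (n / 4) (axisPoint d a) E →
      T ω z (axisPoint d a) ≤ μ * (a - z 0) + E := by
    intro z a h1 h2 h3 h4
    by_contra h'
    have h0 : (axisPoint d a - z) 0 = a - z 0 := by rw [PiLp.sub_apply, axisPoint_apply_zero]
    refine h4 ⟨z, ⟨by rw [h0]; exact h1, by rw [h0]; linarith, ?_⟩, by rw [h0]; exact not_le.1 h'⟩
    refine (perp_sub_le _ _).trans ?_
    rw [perp_axisPoint, zero_add]
    exact h3
  have hafter : ∀ (z : EuclideanSpace ℝ (Fin d)) (a : ℝ), n / 4 ≤ z 0 - a → z 0 - a ≤ n / 2 →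
      perp z ≤ W → ω ∉ slowEvent (reflectTime T 0) μ Φ (n / 4) (axisPoint d (-a)) E →
      T ω (axisPoint d a) z ≤ μ * (z 0 - a) + E := by
    intro z a h1 h2 h3 h4
    by_contra h'
    have hneg : -axisPoint d (-a) = axisPoint d a := by
      rw [← zero_sub, ← axisPoint_zero (d := d), ← axisPoint_sub]
      congr 1
      ring
    have h0 : (axisPoint d (-a) - -z) 0 = z 0 - a := by
      rw [PiLp.sub_apply, axisPoint_apply_zero, PiLp.neg_apply]
      ring
    refine h4 ⟨-z, ⟨by rw [h0]; exact h1, by rw [h0]; linarith, ?_⟩, ?_⟩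
    · refine (perp_sub_le _ _).trans ?_
      rw [perp_axisPoint, zero_add, perp_neg]
      exact h3
    · rw [h0, reflectTime, zero_sub, zero_sub, neg_neg, hneg, hω.2.1]
      exact not_le.1 h'
  have b1 := hbefore x (n / 3) (by linarith) (by linarith) hxp c1
  have b2 := hafter y (2 * n / 3) (by linarith) (by linarith) hyp c2
  have b3 := hafter x (-(n / 3)) (by linarith) (by linarith) hxp (by rw [neg_neg]; exact c3)
  have b4 := hbefore y (4 * n / 3) (by linarith) (by linarith) hyp c4
  have b5 : T ω (axisPoint d (n / 3)) (axisPoint d (2 * n / 3)) ≤ μ * (n / 3) + (t + M) * Φ n := by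
    have e : 2 * n / 3 - n / 3 = n / 3 := by ring
    have h1 : T ω (axisPoint d (n / 3)) (axisPoint d (2 * n / 3)) ≤ h (n / 3) + t * ψ (n / 3) := by
      by_contra h'
      refine c5 ?_
      change t * ψ (2 * n / 3 - n / 3) < |_ - h (2 * n / 3 - n / 3)|
      rw [e]
      exact lt_of_lt_of_le (by linarith) (le_abs_self _)
    have h2 := hhM (n / 3) (by linarith)
    have h3 : Φ (n / 3) ≤ Φ n := hΦ.mono hκ.le hs₀ (by linarith) (by linarith)
    have h4 := mul_le_mul_of_nonneg_left ((hψ (n / 3) (by linarith)).trans h3)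
      (show 0 ≤ t by linarith)
    have h5 := mul_le_mul_of_nonneg_left h3 hM
    linarith
  have b6 : μ * (5 * n / 3) - 2 * t * Φ n ≤
      T ω (axisPoint d (-(n / 3))) (axisPoint d (4 * n / 3)) := by
    have e : 4 * n / 3 - -(n / 3) = 5 * n / 3 := by ring
    have h1 : h (5 * n / 3) - t * ψ (5 * n / 3) ≤
        T ω (axisPoint d (-(n / 3))) (axisPoint d (4 * n / 3)) := by
      by_contra h'
      refine c6 ?_
      change t * ψ (4 * n / 3 - -(n / 3)) < |_ - h (4 * n / 3 - -(n / 3))|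
      rw [e]
      exact lt_of_lt_of_le (by linarith) (neg_le_abs _)
    have h2 := hh.lower (5 * n / 3) (by linarith)
    have h3 : Φ (5 * n / 3) ≤ 2 * Φ n := hΦ.le_mul hκ.le hs₀ (by linarith) (by linarith)
      (by linarith)
    have h4 := mul_le_mul_of_nonneg_left ((hψ (5 * n / 3) (by linarith)).trans h3)
      (show 0 ≤ t by linarith)
    linarith
  have t1 := hω.2.2 x (axisPoint d (n / 3)) y
  have t2 := hω.2.2 (axisPoint d (n / 3)) (axisPoint d (2 * n / 3)) y
  -- Inserting `x` and `y` between the outer points turns upper bounds for the two end pieces into a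
  -- lower bound for `T ω x y`.
  have t3 := hω.2.2 (axisPoint d (-(n / 3))) x (axisPoint d (4 * n / 3))
  have t4 := hω.2.2 x y (axisPoint d (4 * n / 3))
  have hE' : E ≤ C * (t + M) * Φ n := by
    rw [hE]
    have : 0 ≤ C * (t + M) := by positivity
    gcongr
  have hΦn := hΦ.pos n (by linarith)
  have hup : T ω x y ≤ μ * (y 0 - x 0) + (2 * C + 1) * ((t + M) * Φ n) := by linarith
  have hlo : μ * (y 0 - x 0) - 2 * t * Φ n - 2 * C * ((t + M) * Φ n) ≤ T ω x y := by linarith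
  have hW4 : W ≤ n / 4 := by
    rw [hW, Real.sqrt_le_left (by linarith), sq]
    gcongr
  have hyx0 : (y - x) 0 = y 0 - x 0 := by rw [PiLp.sub_apply]
  have hperp : perp (y - x) ≤ 2 * W := (perp_sub_le _ _).trans (by linarith)
  have hnorm1 : y 0 - x 0 ≤ ‖x - y‖ := by
    rw [norm_sub_rev, ← hyx0]
    exact (le_abs_self _).trans (abs_apply_le_norm _ 0)
  -- The width of the boxes is chosen such that the transverse displacement changes the distance by
  -- at most `Φ n`; thus the mean, too, equals `μ (y 0 - x 0)` up to `O(Φ n)`.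
  have hnorm2 : ‖x - y‖ ≤ y 0 - x 0 + Φ n := by
    have h1 := norm_sub_apply_zero_le (x := y - x) (by rw [hyx0]; linarith)
    have h2 : perp (y - x) ^ 2 ≤ n * Φ n := by
      have h3 := pow_le_pow_left₀ (perp_nonneg _) hperp 2
      rw [mul_pow, hW, Real.sq_sqrt (by positivity)] at h3
      have : n * Φ (n / 4) ≤ n * Φ n := by gcongr
      linarith
    rw [hyx0] at h1
    have h3 : perp (y - x) ^ 2 / (2 * (y 0 - x 0)) ≤ Φ n := by
      rw [div_le_iff₀ (by linarith)]
      have : Φ n * n ≤ Φ n * (2 * (y 0 - x 0)) := by gcongr; linarith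
      linarith
    rw [norm_sub_rev]
    linarith
  have hnorm3 : ‖x - y‖ ≤ 2 * n := by
    have h1 := norm_le_abs_add_perp (y - x)
    rw [hyx0, abs_of_pos (by linarith)] at h1
    rw [norm_sub_rev]
    linarith
  have hmean1 := hh.lower ‖x - y‖ (norm_nonneg _)
  have hmean2 := hhM ‖x - y‖ (by linarith)
  have hΦxy : Φ ‖x - y‖ ≤ 2 * Φ n := by
    rcases le_total ‖x - y‖ n with h' | h'
    · have := hΦ.mono hκ.le hs₀ (show s₀ ≤ ‖x - y‖ by linarith) h'
      linarith
    · exact hΦ.le_mul hκ.le hs₀ (by linarith) h' hnorm3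
  have m1 := mul_le_mul_of_nonneg_left hnorm1 hμ.le
  have m2 := mul_le_mul_of_nonneg_left hnorm2 hμ.le
  have m3 := mul_le_mul_of_nonneg_left hΦxy hM
  have p1 : t + M ≤ (1 + M) * t := by nlinarith
  have p2 : (t + M) * Φ n ≤ (1 + M) * t * Φ n := by gcongr
  have p3 : 0 < (t + M) * Φ n := by positivity
  have p4 : Φ n ≤ (t + M) * Φ n := le_mul_of_one_le_left hΦn.le (by linarith)
  have p5 := mul_le_mul_of_nonneg_left p4 hμ.le
  have p6 := mul_le_mul_of_nonneg_left p2 (show 0 ≤ 2 * C + 2 + μ by positivity)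
  have p7 : 0 ≤ μ * ((t + M) * Φ n) := by positivity
  refine absurd hxy (not_lt.2 (abs_le.2 ⟨?_, ?_⟩))
  · linarith
  · linarith

end Boxes

/-! ### Iterated logarithms -/

lemma tendsto_iterLog (k : ℕ) : Tendsto (iterLog k) atTop atTop := by
  induction k with
  | zero => exact tendsto_id
  | succ k ih =>
    refine (Real.tendsto_log_atTop.comp ih).congr fun n => ?_
    rw [Function.comp_apply, iterLog, iterLog, Function.iterate_succ_apply']

lemma iterLog_succ (k : ℕ) (n : ℝ) : iterLog (k + 1) n = Real.log (iterLog k n) := by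
  rw [iterLog, iterLog, Function.iterate_succ_apply']

lemma eventually_iterLog_succ_le (k : ℕ) : ∀ᶠ n : ℝ in atTop, iterLog (k + 1) n ≤ Real.log n := by
  induction k with
  | zero => exact Eventually.of_forall fun n => le_rfl
  | succ k ih =>
    filter_upwards [ih, (tendsto_iterLog (k + 1)).eventually_ge_atTop 0] with n h1 h2
    rw [iterLog_succ]
    exact (Real.log_le_self h2).trans h1

lemma eventually_mul_log_rpow_le (D s : ℝ) {δ : ℝ} (hδ : 0 < δ) :
    ∀ᶠ n : ℝ in atTop, D * Real.log n ^ s ≤ n ^ δ := by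
  have h := (isLittleO_log_rpow_rpow_atTop s hδ).bound (show 0 < 1 / (|D| + 1) by positivity)
  filter_upwards [h, eventually_ge_atTop 1] with n hn hn1
  have hlog : 0 ≤ Real.log n ^ s := Real.rpow_nonneg (Real.log_nonneg hn1) _
  rw [Real.norm_of_nonneg hlog, Real.norm_of_nonneg (Real.rpow_nonneg (by linarith) _),
    div_mul_eq_mul_div, one_mul, le_div_iff₀ (by positivity)] at hn
  have h1 : D ≤ |D| + 1 := by have := le_abs_self D; linarith
  have h2 := mul_le_mul_of_nonneg_right h1 hlog
  linarith

/-- The exponential equals `X^(-(r+1))`, and the spare factor `X` absorbs the constant `C`. -/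
lemma mul_exp_log_le {X C c D κ r : ℝ} (hX : 1 < X) (hC : C ≤ X) (hκ : 0 < κ)
    (hD : 0 ≤ D) (hDc : c * D ^ κ = r + 1) :
    C * Real.exp (-c * (D * Real.log X ^ (1 / κ)) ^ κ) ≤ 1 / X ^ r := by
  have hX0 : 0 < X := by linarith
  have hlog : 0 ≤ Real.log X := Real.log_nonneg hX.le
  have h1 : (Real.log X ^ (1 / κ)) ^ κ = Real.log X := by
    rw [← Real.rpow_mul hlog, one_div, inv_mul_cancel₀ hκ.ne', Real.rpow_one]
  have h2 : -c * (D * Real.log X ^ (1 / κ)) ^ κ = Real.log X * (-(r + 1)) := by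
    rw [Real.mul_rpow hD (Real.rpow_nonneg hlog _), h1, ← hDc]
    ring
  rw [h2, ← Real.rpow_def_of_pos hX0, Real.rpow_neg hX0.le, Real.rpow_add hX0, Real.rpow_one,
    one_div, mul_inv]
  have h3 : 0 < X ^ r := Real.rpow_pos_of_pos hX0 _
  calc C * ((X ^ r)⁻¹ * X⁻¹) ≤ X * ((X ^ r)⁻¹ * X⁻¹) := by gcongr
    _ = (X ^ r)⁻¹ := by field_simp

lemma etaExponent_pos {κ₁ κ₃ : ℝ} (hκ₁ : 0 < κ₁) (hκ₃ : 0 < κ₃) : 0 < etaExponent κ₁ κ₃ := by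
  unfold etaExponent
  positivity

/-! ### The flat boxes of the theorem -/

section Boxes

variable {d : ℕ} [NeZero d] {Ω : Type*} [MeasurableSpace Ω]
  {P : Measure Ω} [IsProbabilityMeasure P]
  {T : Ω → EuclideanSpace ℝ (Fin d) → EuclideanSpace ℝ (Fin d) → ℝ} {h ψ : ℝ → ℝ}
  {C₀ C₁ κ₁ κ₂ μ A : ℝ}

/-- A flat box lies in the parabolic box as soon as the logarithmic denominator is at least `4`,
because `Φ n ≤ 4 Φ (n/4)`. The precise exponent `η` plays no role beyond this. -/
lemma flatBox_bounds {Φ : ℝ → ℝ} {κ s₀ η n : ℝ} {k : ℕ} (hΦ : IsPowerScale Φ κ s₀) (hκ : 0 < κ)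
    (hs₀ : 1 ≤ s₀) (hψ0 : 0 ≤ ψ n) (hψ : ψ n ≤ Φ n) (hn : s₀ ≤ n / 4) (hΦn : 24 * Φ n ≤ n)
    (hX : 4 ≤ iterLog k n ^ η) {x : EuclideanSpace ℝ (Fin d)} (hx : x ∈ flatBox d ψ η k n) :
    |x 0| ≤ n / 24 ∧ perp x ≤ √(n / 4 * Φ (n / 4)) := by
  obtain ⟨h1, h2⟩ := hx
  have hn0 : 0 < n := by linarith
  refine ⟨by linarith, ?_⟩
  change perp x ≤ _ at h2
  have h3 : Φ n ≤ 4 * Φ (n / 4) := hΦ.le_mul hκ.le hs₀ hn (by linarith) (by linarith)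
  have h4 : n ^ (1 / 2 : ℝ) * ψ n ^ (1 / 2 : ℝ) / iterLog k n ^ η ≤ √(n * ψ n) / 4 := by
    rw [Real.sqrt_mul hn0.le, Real.sqrt_eq_rpow, Real.sqrt_eq_rpow]
    gcongr
  refine h2.trans (h4.trans ?_)
  refine Real.le_sqrt_of_sq_le ?_
  rw [div_pow, Real.sq_sqrt (by positivity)]
  have h5 : n * ψ n ≤ n * (4 * Φ (n / 4)) := by
    gcongr
    linarith
  linarith

lemma exists_prob_flatBox_le (hT : IsPassageModel P T h ψ C₀ C₁ κ₁ κ₂) (hh : IsMeanTime h μ A)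
    (hcross : HasCrossing P T) {n₀ D₀ κ₃ : ℝ}
    (hC₀ : 0 < C₀) (hC₁ : 0 < C₁) (hκ₁ : 0 < κ₁) (hκ₂ : 0 < κ₂) (hD₀ : 1 < D₀) (hκ₃ : 0 < κ₃)
    (hκ₃' : κ₃ < 1 / 2) (hψ : IsRegularScale ψ n₀ D₀ κ₃) {k : ℕ} (hk : 1 ≤ k) {r : ℝ}
    (hr : 0 < r) :
    ∃ D : ℝ, 0 < D ∧ ∀ᶠ n : ℝ in atTop,
      P.real {ω | ∃ x ∈ flatBox d ψ (etaExponent κ₁ κ₃) (k - 1) n,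
        ∃ z ∈ flatBox d ψ (etaExponent κ₁ κ₃) (k - 1) n,
          D * ψ n * iterLog k n ^ (1 / κ₁) <
            |T ω x (axisPoint d n + z) - h ‖x - (axisPoint d n + z)‖|} ≤
        1 / iterLog (k - 1) n ^ r := by
  obtain ⟨j, rfl⟩ : ∃ j, k = j + 1 := ⟨k - 1, by omega⟩
  rw [Nat.add_sub_cancel]
  obtain ⟨Φ, s₀, G, hs₀, hG, hΦ, hψΦ⟩ := hψ.exists_isPowerScale hD₀ hκ₃ hκ₃'
  have hκ : 0 < κ₃ / 2 := by positivity
  obtain ⟨C, t₀, δ, hC, hδ, hbox⟩ := exists_prob_box_le hT hh hcross hC₀ hC₁ hκ₁ hκ₂ hΦ hκ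
    (by linarith) hs₀ fun s hs => (hψΦ s hs).1
  -- This is the solution of `(C₀ / 2) D'^κ₁ = r + 1`, the relation needed in `mul_exp_log_le` with
  -- `X = log^(k-1) n`.
  set D' : ℝ := (2 / C₀ * (r + 1)) ^ (1 / κ₁) with hD'
  have hD'0 : 0 < D' := by positivity
  have hD'c : C₀ / 2 * D' ^ κ₁ = r + 1 := by
    rw [hD', ← Real.rpow_mul (by positivity), one_div, inv_mul_cancel₀ hκ₁.ne', Real.rpow_one]
    field_simp
  refine ⟨C * G * D', by positivity, ?_⟩
  have hX := tendsto_iterLog j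
  have hd4 : Tendsto (fun n : ℝ => n / 4) atTop atTop := tendsto_id.atTop_div_const (by norm_num)
  filter_upwards [hbox, eventually_iterLog_succ_le j, eventually_mul_log_rpow_le D' (1 / κ₁) hδ,
    hX.eventually_gt_atTop 1, hX.eventually_ge_atTop (4 + 2 * C₁),
    ((tendsto_rpow_atTop (etaExponent_pos hκ₁ hκ₃)).comp hX).eventually_ge_atTop 4,
    (((tendsto_rpow_atTop (one_div_pos.2 hκ₁)).comp (tendsto_iterLog (j + 1))).const_mul_atTop
      hD'0).eventually_ge_atTop t₀,
    hd4.eventually_ge_atTop s₀, hΦ.eventually_mul_rpow_le hs₀ 24 (by norm_num) hκ]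
    with n h1 h2 h3 h4 h5 h6 h7 h8 h9
  simp only [Function.comp_apply] at h6 h7
  rw [Real.rpow_zero, mul_one] at h9
  have hn0 : 0 < n := by linarith
  have hns : s₀ ≤ n := by linarith
  have hψ0 := hψ.pos n hn0
  have hL0 : 0 ≤ iterLog (j + 1) n := by
    rw [iterLog_succ]
    exact Real.log_nonneg h4.le
  have hL1 : 0 ≤ iterLog (j + 1) n ^ (1 / κ₁) := Real.rpow_nonneg hL0 _
  -- The deviation is at most a constant times a power of `log n`, so it lies in the admissible
  -- range `t ≤ n^δ`.
  have htn : D' * iterLog (j + 1) n ^ (1 / κ₁) ≤ n ^ δ := by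
    refine le_trans ?_ h3
    gcongr
  refine le_trans (measureReal_mono ?_ (measure_ne_top _ _)) ((h1 _ h7 htn).trans ?_)
  · rintro ω ⟨x, hx, z, hz, hxz⟩
    obtain ⟨hx1, hx2⟩ := flatBox_bounds hΦ hκ hs₀ hψ0.le (hψΦ n hns).1 h8 h9 h6 hx
    obtain ⟨hz1, hz2⟩ := flatBox_bounds hΦ hκ hs₀ hψ0.le (hψΦ n hns).1 h8 h9 h6 hz
    refine ⟨x, axisPoint d n + z, hx1, ?_, hx2, ?_, lt_of_le_of_lt ?_ hxz⟩
    · rw [PiLp.add_apply, axisPoint_apply_zero, add_sub_cancel_left]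
      exact hz1
    · refine (perp_add_le _ _).trans ?_
      rw [perp_axisPoint, zero_add]
      exact hz2
    · calc C * (D' * iterLog (j + 1) n ^ (1 / κ₁) * Φ n)
          ≤ C * (D' * iterLog (j + 1) n ^ (1 / κ₁) * (G * ψ n)) := by
            gcongr
            exact (hψΦ n hns).2
        _ = _ := by ring
  · rw [iterLog_succ]
    exact mul_exp_log_le h4 h5 hκ₁ hD'0.le hD'c

end Boxes

end EuclideanFPP

theorem mainTheorem2 {d : ℕ} [NeZero d] {α : ℝ} (hα : 1 < α)
    {Ω : Type*} [MeasurableSpace Ω] (P : Measure Ω) [IsProbabilityMeasure P]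
    (Q : Ω → Set (EuclideanSpace ℝ (Fin d))) (hQ : EuclideanFPP.IsRateOnePoisson Q P)
    (q : Ω → EuclideanSpace ℝ (Fin d) → EuclideanSpace ℝ (Fin d))
    (hq : ∀ᵐ ω ∂P, EuclideanFPP.IsNearestPointMap (Q ω) (q ω))
    (T : Ω → EuclideanSpace ℝ (Fin d) → EuclideanSpace ℝ (Fin d) → ℝ)
    (hT : ∀ ω x y, T ω x y = EuclideanFPP.passageTime α (Q ω) (q ω) x y)
    (ψ : ℝ → ℝ) (C₀ C₁ κ₁ κ₂ : ℝ) (hC₀ : 0 < C₀) (hC₁ : 0 < C₁) (hκ₁ : 0 < κ₁) (hκ₂ : 0 < κ₂)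
    (hconc : EuclideanFPP.ConcentratesOnScale P T ψ C₀ C₁ κ₁ κ₂)
    (n₀ D₀ κ₃ : ℝ) (hn₀ : 0 < n₀) (hD₀ : 1 < D₀) (hκ₃ : 0 < κ₃) (hκ₃' : κ₃ < 1 / 2)
    (hψ : EuclideanFPP.IsRegularScale ψ n₀ D₀ κ₃) :
    (∀ x y, Integrable (fun ω => T ω x y) P) ∧
    ∀ k : ℕ, 1 ≤ k → ∀ r : ℝ, 0 < r → ∃ D : ℝ, 0 < D ∧ ∀ᶠ n : ℝ in atTop,
      P.real {ω |
          ∃ x ∈ EuclideanFPP.flatBox d ψ (EuclideanFPP.etaExponent κ₁ κ₃) (k - 1) n,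
          ∃ z ∈ EuclideanFPP.flatBox d ψ (EuclideanFPP.etaExponent κ₁ κ₃) (k - 1) n,
            D * ψ n * EuclideanFPP.iterLog k n ^ (1 / κ₁) <
              |T ω x (EuclideanFPP.axisPoint d n + z)
                - ∫ ω', T ω' x (EuclideanFPP.axisPoint d n + z) ∂P|}
        ≤ 1 / EuclideanFPP.iterLog (k - 1) n ^ r := by
  obtain rfl : T = fun ω => EuclideanFPP.passageTime α (Q ω) (q ω) := by
    funext ω x y
    exact hT ω x y
  have hα0 : 0 < α := by linarith
  refine ⟨fun x y => EuclideanFPP.integrable_passageTime' hα0 hQ hq x y, fun k hk r hr => ?_⟩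
  obtain ⟨μ, A, hh⟩ := EuclideanFPP.exists_isMeanTime_meanTime hα hQ hq
  obtain ⟨D, hD, hD'⟩ := EuclideanFPP.exists_prob_flatBox_le
    (EuclideanFPP.isPassageModel_passageTime hα hQ hq hconc) hh
    (fun K hK σ hσ => EuclideanFPP.prob_not_crossing_le hα hQ hq hK hσ)
    hC₀ hC₁ hκ₁ hκ₂ hD₀ hκ₃ hκ₃' hψ hk hr
  refine ⟨D, hD, ?_⟩
  simpa only [EuclideanFPP.integral_passageTime_eq hα0 hQ hq] using hD'
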